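/- **Conventions.** For a subset $A$ of a metric space, $A^{+L}=\{x : d(x,A)\le L\}$ (with $d(x,\emptyset)=\infty$). A subset $Y$ is *$k$-coarsely connected* if any two of its points are joined by a sequence of points of $Y$ with consecutive distances $\le k$; its *$k$-coarsely connected components* are the classes of this relation; $Y$ is *coarsely connected* if it is $k$-coarsely connected for some $k>0$. $Y$ is *coarsely separated* by a family $\mathcal S$ of subsets if there are $k,L\ge 0$ such that $Y$ is $k$-coarsely connected and, for every $D\ge 0$, there is $S\in\mathcal S$ such that at least two $k$-coarsely connected components of $Y\setminus S^{+L}$ contain points at distance $\ge D$ from $S$. A map $f$ is a *coarse embedding* if $\rho_-(d(x,y))\le d(f(x),f(y))\le\rho_+(d(x,y))$ for some nondecreasing $\rho_\pm:[0,\infty)\to[0,\infty)$ with $\rho_-(t)\to\infty$ as $t\to\infty$. For a connected graph of bounded degree (vertices with the path metric), a family $\mathcal S$ of vertex sets has volume growth $V_{\mathcal S}(r)=\sup_{S\in\mathcal S,\,s\in S}|B(s,r)\cap S|$. Write $f\gtrsim g$ if $f(t)\ge C\,g(Ct+C)+C$ for some $C>0$ and all $t\ge 0$. Let $\mathfrak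 M_{exp}$ (resp. $\mathfrak M_{d}$, $d>0$) be the class of metric spaces quasi-isometric to a connected bounded degree graph in which every coarsely separating family satisfies $V_{\mathcal S}(r)\gtrsim e^{r}$ (resp. $V_{\mathcal S}(r)\gtrsim r^{d}$). If $G$ is generated by a finite set and $H\le G$, the relative growth of $H$ is $\beta_H^G(n)=|\{h\in H: |h|\le n\}|$, with $|\cdot|$ the word length; it is subexponential if $\frac1n\log\beta^G_H(n)\to 0$, and at most $r^d$ if $\beta^G_H(n)\le Cn^d$ for some $C$ and all $n\ge 1$. A graph of groups $(\Gamma,\mathcal A)$ has a non-empty connected oriented graph $\Gamma$ (loops and multiple edges allowed, possibly infinite), groups $A_v$, $A_e$ and injective homomorphisms $A_e\to A_{o(e)}$, $A_e\to A_{t(e)}$. A graph of spaces $X$ associated to it is obtained from finite connected simplicial complexes $X_v$, $X_e$ with $\pi_1(X_v)\cong A_v$, $\pi_1(X_e)\cong A_e$, and from simplicial maps $X_e\to X_{o(e)}$, $X_e\to X_{t(e)}$ inducing the given homomorphisms (up to change of base point), by gluing the two ends of each $X_e\times[0,1]$ to $X_{o(e)}$ and $X_{t(e)}$ along these maps. Its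 universal cover $\tilde X$ carries the piecewise Euclidean path metric for which the edges of the simplices and the interval $[0,1]$ have length one. The vertex-spaces (resp. edge-spaces) of $\tilde X$ are the connected components of the preimages of the $X_v$ (resp. of the $X_e\times\{1/2\}$), that is, the preimages of the vertices (resp. midpoints of edges) of the Bass–Serre tree. **Theorem.** 1. Let $X$ be a graph of spaces associated to a graph of groups, $Z$ a coarsely connected metric space, and $f:Z\to\tilde X$ a coarse embedding. Then either $f(Z)$ is coarsely separated by the family of edge-spaces of $\tilde X$, or $f(Z)$ is contained in a bounded neighbourhood of a single vertex-space. 2. Let $G=\pi_1(\Gamma,\mathcal A)$ be the fundamental group of a finite graph of groups. Assume that $G$ is finitely generated, with the word metric of some finite generating set, and that all edge-groups have subexponential relative growth in $G$. Then the image of every coarse embedding from a space in $\mathfrak M_{exp}$ to $G$ (in particular from a connected bounded degree graph in $\mathfrak M_{exp}$) lies in a bounded neighbourhood of a left coset of some vertex-group. 3. Let $G$ be as in 2, and let $d\ge 0$ be such that all edge-groups have relative growth at most $r^d$ in $G$ (instead of subexponential relative growth). Then the image of every coarse embedding from a space in $\mathfrak M_{d+1}$ to $G$ lies in a bounded neighbourhood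 of a left coset of some vertex-group. -/

import Mathlib

open Set Filter Topology
open scoped NNReal ENNReal

universe u v w

/-! ## Coarse notions

A distance is passed explicitly, as a function with values in `[0, ∞]`. -/

section Coarse

variable {M : Type*} (d : M → M → ℝ≥0∞)

/-- The distance from a point to a subset (infinite if the subset is empty). -/
noncomputable def setDist (x : M) (A : Set M) : ℝ≥0∞ := ⨅ a ∈ A, d x a

/-- The neighbourhood `A^{+L}`: the points at distance at most `L` from `A`. -/
def nbhd (A : Set M) (L : ℝ≥0) : Set M := {x | setDist d x A ≤ L}

/-- The points `a` and `b` of `Y` are connected by a `k`-path that stays in `Y`. -/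
def KJoinedIn (k : ℝ≥0) (Y : Set M) (a b : M) : Prop :=
  a ∈ Y ∧ b ∈ Y ∧ Relation.ReflTransGen (fun x y => x ∈ Y ∧ y ∈ Y ∧ d x y ≤ k) a b

/-- Any two points of `Y` are connected by a `k`-path in `Y`. -/
def IsKConnected (k : ℝ≥0) (Y : Set M) : Prop :=
  ∀ a ∈ Y, ∀ b ∈ Y, KJoinedIn d k Y a b

/-- The subspace `Y` is `k`-coarsely connected for some `k > 0`. -/
def IsCoarselyConnected (Y : Set M) : Prop :=
  ∃ k : ℝ≥0, 0 < k ∧ IsKConnected d k Y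

/-- `Y` is coarsely separated by the family `𝒮`: there are `k, L ≥ 0` such that `Y` is `k`-coarsely
connected and, for every `D ≥ 0`, there is `S ∈ 𝒮` such that at least two distinct `k`-coarsely
connected components of `Y \ S^{+L}` contain points at distance at least `D` from `S`. -/
def CoarselySeparates (𝒮 : Set (Set M)) (Y : Set M) : Prop :=
  ∃ k L : ℝ≥0, IsKConnected d k Y ∧ ∀ D : ℝ≥0, ∃ S ∈ 𝒮,
    ∃ a ∈ Y \ nbhd d S L, ∃ b ∈ Y \ nbhd d S L,
      (D : ℝ≥0∞) ≤ setDist d a S ∧ (D : ℝ≥0∞) ≤ setDist d b S ∧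
        ¬ KJoinedIn d k (Y \ nbhd d S L) a b

/-- A coarse embedding of a metric space `Z` into `(M, d)`. -/
def IsCoarseEmbedding {Z : Type*} [MetricSpace Z] (f : Z → M) : Prop :=
  ∃ ρ₁ ρ₂ : ℝ≥0 → ℝ≥0, Monotone ρ₁ ∧ Monotone ρ₂ ∧ Tendsto ρ₁ atTop atTop ∧
    ∀ x y : Z, (ρ₁ (nndist x y) : ℝ≥0∞) ≤ d (f x) (f y) ∧ d (f x) (f y) ≤ ρ₂ (nndist x y)

/-- The volume growth `V_𝒮(r)`: the supremum of `|B(s, r) ∩ S|` over `S ∈ 𝒮` and `s ∈ S`, where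
the volume is the number of points. -/
noncomputable def volumeGrowth (𝒮 : Set (Set M)) (r : ℝ≥0) : ℕ∞ :=
  ⨆ S ∈ 𝒮, ⨆ s ∈ S, {y | y ∈ S ∧ d s y ≤ r}.encard

end Coarse

/-- The relation `f ≳ g`: there is `C > 0` with `f(t) ≥ C g(Ct + C) + C` for all `t ≥ 0`. -/
def GrowsAtLeast (f : ℝ≥0 → ℝ≥0∞) (g : ℝ → ℝ) : Prop :=
  ∃ C : ℝ, 0 < C ∧ ∀ t : ℝ≥0, ENNReal.ofReal (C * g (C * t + C) + C) ≤ f t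

/-- The shortest path metric on the vertices of a connected graph. -/
noncomputable def graphDist {W : Type*} (H : SimpleGraph W) (x y : W) : ℝ≥0∞ :=
  ((H.dist x y : ℕ) : ℝ≥0∞)

/-- The class of bounded degree connected graphs in which every coarsely separating family of sets
of vertices has volume growth `≳ g`. -/
def GraphSeparationGrowth (g : ℝ → ℝ) {W : Type*} (H : SimpleGraph W) : Prop :=
  H.Connected ∧ (∃ N : ℕ, ∀ x, (H.neighborSet x).encard ≤ N) ∧
    ∀ 𝒮 : Set (Set W), CoarselySeparates (graphDist H) 𝒮 Set.univ →
      GrowsAtLeast (fun r => ((volumeGrowth (graphDist H) 𝒮 r : ℕ∞) : ℝ≥0∞)) g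

/-- A quasi-isometry from the vertex set of a connected graph to a metric space. -/
def IsGraphQuasiIsometry {W Z : Type*} [MetricSpace Z] (H : SimpleGraph W) (φ : W → Z) : Prop :=
  ∃ l c : ℝ, 1 ≤ l ∧ 0 ≤ c ∧
    (∀ x y, l⁻¹ * (H.dist x y : ℝ) - c ≤ dist (φ x) (φ y) ∧
      dist (φ x) (φ y) ≤ l * (H.dist x y : ℝ) + c) ∧
    ∀ z, ∃ x, dist z (φ x) ≤ c

/-- The class `𝔐_exp`: metric spaces quasi-isometric to a bounded degree connected graph in which
every coarsely separating family has exponential growth. (A bounded degree connected graph with that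
property is itself such a space, through the identity.) -/
def MemMExp (Z : Type u) [MetricSpace Z] : Prop :=
  ∃ (W : Type u) (H : SimpleGraph W), GraphSeparationGrowth Real.exp H ∧
    ∃ φ : W → Z, IsGraphQuasiIsometry H φ

/-- The class `𝔐_d`: metric spaces quasi-isometric to a bounded degree connected graph in which
every coarsely separating family has growth at least `r ^ d`. -/
def MemMPoly (d : ℝ) (Z : Type u) [MetricSpace Z] : Prop :=
  ∃ (W : Type u) (H : SimpleGraph W), GraphSeparationGrowth (fun r => r ^ d) H ∧
    ∃ φ : W → Z, IsGraphQuasiIsometry H φ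

/-! ## Word metrics and relative growth -/

section Word

variable {G : Type*} [Group G]

/-- The word length of `g` with respect to `S` (used only when `S` generates the group). -/
noncomputable def wordLength (S : Finset G) (g : G) : ℕ :=
  sInf {n | ∃ l : List G, l.length = n ∧ (∀ x ∈ l, x ∈ S ∨ x⁻¹ ∈ S) ∧ l.prod = g}

/-- The left-invariant word metric. -/
noncomputable def wordDist (S : Finset G) (g h : G) : ℝ≥0∞ :=
  ((wordLength S (g⁻¹ * h) : ℕ) : ℝ≥0∞)

/-- The relative growth of a subgroup: the number of its elements of word length at most `n`. -/
noncomputable def relativeGrowth (S : Finset G) (A : Subgroup G) (n : ℕ) : ℕ :=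
  {h | h ∈ A ∧ wordLength S h ≤ n}.ncard

/-- Subexponential relative growth. -/
def HasSubexpRelativeGrowth (S : Finset G) (A : Subgroup G) : Prop :=
  Tendsto (fun n : ℕ => Real.log (relativeGrowth S A n) / n) atTop (𝓝 0)

/-- Relative growth at most `r ^ d`, up to a multiplicative constant. -/
def HasRelativeGrowthAtMost (d : ℝ) (S : Finset G) (A : Subgroup G) : Prop :=
  ∃ C : ℝ, ∀ n : ℕ, 1 ≤ n → (relativeGrowth S A n : ℝ) ≤ C * (n : ℝ) ^ d

end Word

/-! ## Graphs of groups and their fundamental groups -/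

/-- A graph of groups over an oriented connected graph with vertex set `V` and edge set `E` (loops
and multiple edges are allowed). -/
structure GraphOfGroups (V : Type u) (E : Type v) where
  /-- the initial vertex of an edge -/
  ori : E → V
  /-- the terminal vertex of an edge -/
  ter : E → V
  nonempty : Nonempty V
  connected : ∀ x y : V, Relation.EqvGen (fun a b => ∃ e, ori e = a ∧ ter e = b) x y
  /-- the vertex-groups -/
  A : V → Type w
  /-- the edge-groups -/
  B : E → Type w
  [groupA : ∀ v, Group (A v)]
  [groupB : ∀ e, Group (B e)]
  /-- the injection of an edge-group into the group of the initial vertex -/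
  i₀ : ∀ e, B e →* A (ori e)
  /-- the injection of an edge-group into the group of the terminal vertex -/
  i₁ : ∀ e, B e →* A (ter e)
  i₀_injective : ∀ e, Function.Injective (i₀ e)
  i₁_injective : ∀ e, Function.Injective (i₁ e)

attribute [instance] GraphOfGroups.groupA GraphOfGroups.groupB

namespace GraphOfGroups

variable {V : Type u} {E : Type v} (𝒢 : GraphOfGroups.{u, v, w} V E)

/-- A set `T` of edges is a spanning (maximal) tree of the underlying graph: it has no loops and no
two edges with the same endpoints, and the simple graph that it spans on `V` is a tree. -/
def IsSpanningTree (T : Set E) : Prop :=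
  (∀ e ∈ T, 𝒢.ori e ≠ 𝒢.ter e) ∧
  (∀ e ∈ T, ∀ e' ∈ T, s(𝒢.ori e, 𝒢.ter e) = s(𝒢.ori e', 𝒢.ter e') → e = e') ∧
  (SimpleGraph.fromEdgeSet {p : Sym2 V | ∃ e ∈ T, p = s(𝒢.ori e, 𝒢.ter e)}).IsTree

/-- The generators of the fundamental group: the elements of the vertex-groups, and a stable letter
for each edge. -/
abbrev Gen : Type (max u v w) := (Σ v, 𝒢.A v) ⊕ E

/-- The generator given by an element of a vertex-group. -/
def genA (v : V) (a : 𝒢.A v) : FreeGroup 𝒢.Gen := FreeGroup.of (Sum.inl ⟨v, a⟩)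

/-- The stable letter of an edge. -/
def genT (e : E) : FreeGroup 𝒢.Gen := FreeGroup.of (Sum.inr e)

/-- The relations of the fundamental group, relative to a maximal tree `T`: the multiplication
tables of the vertex-groups, `t_e i₁(b) t_e⁻¹ = i₀(b)`, and `t_e = 1` for `e ∈ T`. -/
inductive Rel (T : Set E) : FreeGroup 𝒢.Gen → Prop
  | vertex (v : V) (a b : 𝒢.A v) : Rel T (𝒢.genA v a * 𝒢.genA v b * (𝒢.genA v (a * b))⁻¹)
  | edge (e : E) (b : 𝒢.B e) :
      Rel T (𝒢.genT e * 𝒢.genA _ (𝒢.i₁ e b) * (𝒢.genT e)⁻¹ * (𝒢.genA _ (𝒢.i₀ e b))⁻¹)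
  | tree (e : E) : e ∈ T → Rel T (𝒢.genT e)

/-- The fundamental group `π₁(Γ, 𝒜, T)` of a graph of groups, relative to a maximal tree `T`. -/
abbrev FundGroup (T : Set E) : Type (max u v w) :=
  PresentedGroup {r : FreeGroup 𝒢.Gen | 𝒢.Rel T r}

/-- The canonical homomorphism from a vertex-group to the fundamental group. -/
def vertexHom (T : Set E) (v : V) : 𝒢.A v →* 𝒢.FundGroup T :=
  MonoidHom.mk' (fun a => PresentedGroup.of (Sum.inl ⟨v, a⟩)) (by
    intro a b
    have h : PresentedGroup.mk {r : FreeGroup 𝒢.Gen | 𝒢.Rel T r}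
        (𝒢.genA v a * 𝒢.genA v b * (𝒢.genA v (a * b))⁻¹) = 1 :=
      PresentedGroup.one_of_mem (rels := {r : FreeGroup 𝒢.Gen | 𝒢.Rel T r}) (Rel.vertex v a b)
    rw [map_mul, map_mul, map_inv, mul_inv_eq_one] at h
    exact h.symm)

/-- A vertex-group, as a subgroup of the fundamental group. -/
def vertexSubgroup (T : Set E) (v : V) : Subgroup (𝒢.FundGroup T) := (𝒢.vertexHom T v).range

/-- An edge-group, as a subgroup of the fundamental group (through the group of its initial
vertex; the other embedding gives a conjugate subgroup). -/
def edgeSubgroup (T : Set E) (e : E) : Subgroup (𝒢.FundGroup T) :=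
  ((𝒢.vertexHom T (𝒢.ori e)).comp (𝒢.i₀ e)).range

end GraphOfGroups

/-! ## Geometric realizations of finite simplicial complexes -/

section Realization

/-- The geometric realization of a finite simplicial complex, in barycentric coordinates. -/
def Realization {ι : Type*} [Fintype ι] (K : AbstractSimplicialComplex ι) : Type _ :=
  {x : ι → ℝ // (∀ i, 0 ≤ x i) ∧ ∑ i, x i = 1 ∧ ∃ s ∈ K.faces, ∀ i ∉ s, x i = 0}

instance {ι : Type*} [Fintype ι] (K : AbstractSimplicialComplex ι) :
    TopologicalSpace (Realization K) :=
  instTopologicalSpaceSubtype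

/-- The closed simplex of the realization spanned by a set of vertices. -/
def Realization.simplex {ι : Type*} [Fintype ι] {K : AbstractSimplicialComplex ι}
    (s : Finset ι) : Set (Realization K) := {x | ∀ i ∉ s, x.1 i = 0}

/-- The square of the Euclidean distance between two points of a common simplex, scaled so that
every edge has length one. -/
noncomputable def Realization.sqDist {ι : Type*} [Fintype ι] {K : AbstractSimplicialComplex ι}
    (x y : Realization K) : ℝ := (∑ i, (x.1 i - y.1 i) ^ 2) / 2

open Classical in
/-- A simplicial map between simplicial complexes. -/
structure SimplicialMap {ι κ : Type*} (K : AbstractSimplicialComplex ι)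
    (L : AbstractSimplicialComplex κ) where
  /-- the map on vertices -/
  toFun : ι → κ
  map_faces : ∀ s ∈ K.faces, s.image toFun ∈ L.faces

open Classical in
/-- The affine extension of a simplicial map to the realizations. -/
noncomputable def SimplicialMap.realize {ι κ : Type*} [Fintype ι] [Fintype κ]
    {K : AbstractSimplicialComplex ι} {L : AbstractSimplicialComplex κ} (f : SimplicialMap K L) :
    C(Realization K, Realization L) where
  toFun x := ⟨fun j => ∑ i, if f.toFun i = j then x.1 i else 0, by
    refine ⟨fun j => Finset.sum_nonneg fun i _ => ?_, ?_, ?_⟩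
    · split_ifs
      · exact x.2.1 i
      · exact le_rfl
    · rw [Finset.sum_comm]
      simpa using x.2.2.1
    · obtain ⟨s, hs, hx⟩ := x.2.2.2
      refine ⟨s.image f.toFun, f.map_faces s hs, fun j hj => Finset.sum_eq_zero fun i _ => ?_⟩
      split_ifs with h
      · refine hx i fun hi => hj ?_
        rw [← h]
        exact Finset.mem_image_of_mem _ hi
      · rfl⟩
  continuous_toFun := by
    have hc : ∀ i, Continuous fun x : Realization K => x.1 i := fun i =>
      (continuous_apply i).comp continuous_subtype_val
    refine Continuous.subtype_mk (continuous_pi fun j => continuous_finsetSum _ fun i _ => ?_) _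
    split_ifs
    · exact hc i
    · exact continuous_const

end Realization

/-! ## Graphs of spaces -/

/-- The data of a graph of spaces associated to a graph of groups: finite connected simplicial
complexes `X_v`, `X_e` with identifications of their fundamental groups with the vertex-groups and
the edge-groups, and simplicial maps from `X_e` to `X_{ori e}` and `X_{ter e}` that induce the given
homomorphisms (after transport of the base point along some path). -/
structure GraphOfSpaces {V : Type u} {E : Type v} (𝒢 : GraphOfGroups.{u, v, w} V E) where
  /-- the vertices of `X_v` -/
  ιV : V → Type w
  /-- the vertices of `X_e` -/
  ιE : E → Type w
  [fintypeV : ∀ v, Fintype (ιV v)]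
  [fintypeE : ∀ e, Fintype (ιE e)]
  /-- the complex `X_v` -/
  KV : ∀ v, AbstractSimplicialComplex (ιV v)
  /-- the complex `X_e` -/
  KE : ∀ e, AbstractSimplicialComplex (ιE e)
  pathConnectedV : ∀ v, PathConnectedSpace (Realization (KV v))
  pathConnectedE : ∀ e, PathConnectedSpace (Realization (KE e))
  /-- the base point of `X_v` -/
  baseV : ∀ v, Realization (KV v)
  /-- the base point of `X_e` -/
  baseE : ∀ e, Realization (KE e)
  /-- the identification `π₁(X_v) = A_v` -/
  isoV : ∀ v, FundamentalGroup (Realization (KV v)) (baseV v) ≃* 𝒢.A v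
  /-- the identification `π₁(X_e) = A_e` -/
  isoE : ∀ e, FundamentalGroup (Realization (KE e)) (baseE e) ≃* 𝒢.B e
  /-- the attaching map `X_e → X_{ori e}` -/
  f₀ : ∀ e, SimplicialMap (KE e) (KV (𝒢.ori e))
  /-- the attaching map `X_e → X_{ter e}` -/
  f₁ : ∀ e, SimplicialMap (KE e) (KV (𝒢.ter e))
  induces₀ : ∀ e, ∃ γ : Path ((f₀ e).realize (baseE e)) (baseV (𝒢.ori e)),
    ∀ α, isoV _ (FundamentalGroup.fundamentalGroupMulEquivOfPath γ
      (FundamentalGroup.map (f₀ e).realize (baseE e) α)) = 𝒢.i₀ e (isoE e α)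
  induces₁ : ∀ e, ∃ γ : Path ((f₁ e).realize (baseE e)) (baseV (𝒢.ter e)),
    ∀ α, isoV _ (FundamentalGroup.fundamentalGroupMulEquivOfPath γ
      (FundamentalGroup.map (f₁ e).realize (baseE e) α)) = 𝒢.i₁ e (isoE e α)

attribute [instance] GraphOfSpaces.fintypeV GraphOfSpaces.fintypeE

namespace GraphOfSpaces

variable {V : Type u} {E : Type v} {𝒢 : GraphOfGroups.{u, v, w} V E} (𝒳 : GraphOfSpaces 𝒢)

/-- The disjoint union of the complexes `X_v` and of the products `X_e × [0, 1]`. -/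
abbrev Pieces : Type (max u v w) :=
  (Σ v, Realization (𝒳.KV v)) ⊕ (Σ e, Realization (𝒳.KE e) × unitInterval)

/-- The gluing: `(x, 0) ∼ f₀(x)` and `(x, 1) ∼ f₁(x)` for `x ∈ X_e`. -/
inductive Glue : 𝒳.Pieces → 𝒳.Pieces → Prop
  | ori (e : E) (x : Realization (𝒳.KE e)) :
      Glue (Sum.inr ⟨e, (x, 0)⟩) (Sum.inl ⟨𝒢.ori e, (𝒳.f₀ e).realize x⟩)
  | ter (e : E) (x : Realization (𝒳.KE e)) :
      Glue (Sum.inr ⟨e, (x, 1)⟩) (Sum.inl ⟨𝒢.ter e, (𝒳.f₁ e).realize x⟩)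

/-- The graph of spaces `X`, with the quotient topology. -/
def Total : Type (max u v w) := Quot 𝒳.Glue

instance : TopologicalSpace 𝒳.Total := inferInstanceAs (TopologicalSpace (Quot 𝒳.Glue))

/-- The inclusion of `X_v` in `X`. -/
def vertexMap (v : V) (x : Realization (𝒳.KV v)) : 𝒳.Total :=
  Quot.mk _ (Sum.inl ⟨v, x⟩)

/-- The canonical map from `X_e × [0, 1]` to `X`. -/
def edgeMap (e : E) (p : Realization (𝒳.KE e) × unitInterval) : 𝒳.Total :=
  Quot.mk _ (Sum.inr ⟨e, p⟩)

variable {Xt : Type*} [TopologicalSpace Xt] (q : Xt → 𝒳.Total)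

/-- The points `x, y` lie in a common lift to `Xt` of a simplex of some `X_v`, in which they are at
Euclidean distance `l`. -/
def VertexCellStep (x y : Xt) (l : ℝ) : Prop :=
  ∃ (v : V) (s : Finset (𝒳.ιV v)) (_ : s ∈ (𝒳.KV v).faces) (c : Realization (𝒳.KV v) → Xt),
    ContinuousOn c (Realization.simplex s) ∧
    (∀ a ∈ Realization.simplex s, q (c a) = 𝒳.vertexMap v a) ∧
    ∃ a ∈ Realization.simplex s, ∃ b ∈ Realization.simplex s,
      c a = x ∧ c b = y ∧ l = Real.sqrt (Realization.sqDist a b)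

/-- The points `x, y` lie in a common lift to `Xt` of the product of a simplex of some `X_e` with
`[0, 1]`, in which they are at Euclidean distance `l`. -/
def EdgeCellStep (x y : Xt) (l : ℝ) : Prop :=
  ∃ (e : E) (s : Finset (𝒳.ιE e)) (_ : s ∈ (𝒳.KE e).faces)
    (c : Realization (𝒳.KE e) × unitInterval → Xt),
    ContinuousOn c (Realization.simplex s ×ˢ univ) ∧
    (∀ a ∈ Realization.simplex s ×ˢ univ, q (c a) = 𝒳.edgeMap e a) ∧
    ∃ a ∈ Realization.simplex s ×ˢ univ, ∃ b ∈ Realization.simplex s ×ˢ univ,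
      c a = x ∧ c b = y ∧
        l = Real.sqrt (Realization.sqDist a.1 b.1 + ((a.2 : ℝ) - (b.2 : ℝ)) ^ 2)

/-- The least distance of `x` and `y` inside a common cell (infinite if there is none). -/
noncomputable def stepCost (x y : Xt) : ℝ≥0∞ :=
  ⨅ (l : ℝ) (_ : 𝒳.VertexCellStep q x y l ∨ 𝒳.EdgeCellStep q x y l), ENNReal.ofReal l

/-- The piecewise Euclidean path metric on a covering space `q : Xt → X`, with every edge of length
one: the infimum of the lengths of the strings `x = c₀, …, cₙ = y` in which any two consecutive
points lie in a common cell. -/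
noncomputable def pathDist (x y : Xt) : ℝ≥0∞ :=
  ⨅ (n : ℕ) (c : ℕ → Xt) (_ : c 0 = x) (_ : c n = y),
    ∑ i ∈ Finset.range n, stepCost 𝒳 q (c i) (c (i + 1))

/-- The vertex-spaces of `Xt`: the path components of the preimages of the `X_v`. For the universal
cover they are the copies of the universal covers of the `X_v`, i.e. the preimages of the vertices
under the projection to the Bass-Serre tree. -/
def vertexSpaces : Set (Set Xt) :=
  {P | ∃ v, ∃ x ∈ q ⁻¹' range (𝒳.vertexMap v), P = pathComponentIn (q ⁻¹' range (𝒳.vertexMap v)) x}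

/-- The slice `X_e × {1/2}` of `X`. -/
def midSlice (e : E) : Set 𝒳.Total :=
  {y | ∃ p : Realization (𝒳.KE e) × unitInterval, (p.2 : ℝ) = 1 / 2 ∧ 𝒳.edgeMap e p = y}

/-- The edge-spaces of `Xt`: the path components of the preimages of the slices `X_e × {1/2}`. For
the universal cover they are the preimages of the midpoints of the edges under the projection to the
Bass-Serre tree. -/
def edgeSpaces : Set (Set Xt) :=
  {P | ∃ e, ∃ x ∈ q ⁻¹' 𝒳.midSlice e, P = pathComponentIn (q ⁻¹' 𝒳.midSlice e) x}

end GraphOfSpaces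

/-! ### Coarse trees and the dichotomy -/

section CoarseTree

variable {M : Type*} {d : M → M → ℝ≥0∞}

/-! Both settings, the universal cover and the group, map to a Bass–Serre tree in which every edge
`S` cuts the vertices into two sides. A `k`-jump that changes side takes place within some `L` of
the subset of `S`. Let `Y` be `k`-connected and not coarsely separated by the edge subsets. Then
there is a uniform `D` such that, for every `S`, the points of `Y` on one of the two sides all lie
within `D` of `S`: deep points on both sides could not be joined outside the `L`-neighbourhood.
Orient each edge towards its other, deep side. Starting from the image of a point `p` of `Y`, follow
oriented edges. The last edge of such a path has `p` on its shallow side, hence `D`-close, so the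
length of the path is bounded. A longest path ends at a vertex `v` to which all its edges point, and
then every point of `Y` is close to the subset of `v`, because the first edge from `v` towards it
has it on the shallow side. This is `CoarseTree.subset_nbhd_or_separates`.

The tree enters only through the two sides of each edge, so each setting needs functions that change
across one edge and across no other. For the fundamental group they come from an affine action on
`ZMod 2`-valued functions on the edges (`GraphOfGroups.vertexCochain_treeBd`). For the universal
cover, the coordinate across the strip of one edge-space is a circle-valued function; simple
connectedness lifts it to a real-valued signed crossing number
(`GraphOfSpaces.exists_crossing_number`). Local finiteness of separation comes from finiteness of
balls and of the set of edges in the group, and from a Lipschitz estimate for sums of crossing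
numbers in the cover.

For the statements on groups, a coarse embedding restricts to a map from a bounded degree graph. If
cosets of edge-groups separated the image, the preimages of their neighbourhoods would separate the
graph (`coarselySeparates_preimage`) while growing no faster than the edge-groups
(`encard_preimage_nbhd_le`), against the lower bound on separating families. -/

theorem setDist_le_of_mem {x a : M} {A : Set M} (ha : a ∈ A) : setDist d x A ≤ d x a :=
  iInf₂_le a ha

theorem exists_of_setDist_lt {x : M} {A : Set M} {r : ℝ≥0∞} (h : setDist d x A < r) :
    ∃ a ∈ A, d x a < r := by
  simpa only [setDist, iInf_lt_iff, exists_prop] using h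

theorem le_setDist {x : M} {A : Set M} {r : ℝ≥0∞} (h : ∀ a ∈ A, r ≤ d x a) : r ≤ setDist d x A :=
  le_iInf₂ h

theorem setDist_le_add (tri : ∀ x y z, d x z ≤ d x y + d y z) (x y : M) (A : Set M) :
    setDist d x A ≤ d x y + setDist d y A := by
  rw [setDist, setDist, ENNReal.add_iInf]
  refine le_iInf fun a => ?_
  rw [ENNReal.add_iInf]
  exact le_iInf fun ha => (iInf₂_le a ha).trans (tri x y a)

variable (d) in
/-- A space `(M, d)` that maps to a tree with vertex set `𝒱` and edge set `ℰ`. Every edge `S` divides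
the vertices into two sides, and only the edge `S` itself joins the two sides. To the vertices and
edges correspond subsets of `M`, and the map `proj` to the vertices is coarsely compatible with
these subsets. -/
structure CoarseTree (𝒱 ℰ : Type*) where
  /-- the two endpoints of an edge -/
  bd : Bool → ℰ → 𝒱
  /-- one of the two sides of an edge -/
  side : ℰ → 𝒱 → Prop
  -- This condition carries the tree structure: traversing an edge flips its own side and no other,
  -- so the removal of an edge disconnects its endpoints.
  side_bd : ∀ S S', (side S (bd false S') ↔ side S (bd true S')) ↔ S' ≠ S
  /-- the subset corresponding to a vertex -/
  vs : 𝒱 → Set M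
  /-- the subset corresponding to an edge -/
  es : ℰ → Set M
  /-- the map to the tree -/
  proj : M → 𝒱
  setDist_vs_proj : ∃ C : ℝ≥0, ∀ x, setDist d x (vs (proj x)) ≤ C
  setDist_vs_bd : ∃ C : ℝ≥0, ∀ S, ∀ s ∈ es S, ∀ i, setDist d s (vs (bd i S)) ≤ C
  crossing : ∀ k : ℝ≥0, ∃ L : ℝ≥0, ∀ x y S, d x y ≤ k → ¬ (side S (proj x) ↔ side S (proj y)) →
    setDist d x (es S) ≤ L
  encard_separating_le : ∀ k : ℝ≥0, ∃ N : ℕ, ∀ x y, d x y ≤ k →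
    {S | ¬ (side S (proj x) ↔ side S (proj y))}.encard ≤ N
  encard_separating_bd_le : ∃ N : ℕ, ∀ S, ∀ s ∈ es S, ∀ i,
    {S' | ¬ (side S' (proj s) ↔ side S' (bd i S))}.encard ≤ N
  -- Only finite distances count, since `d` takes values in `[0, ∞]`.
  joined : ∀ x y, d x y < ⊤ → Relation.ReflTransGen
    (fun v w => ∃ S i, bd i S = v ∧ bd (!i) S = w) (proj x) (proj y)

namespace CoarseTree

variable {𝒱 ℰ : Type*} (X : CoarseTree d 𝒱 ℰ)

/-- The edges that separate two vertices. -/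
def sep (v w : 𝒱) : Set ℰ := {S | ¬ (X.side S v ↔ X.side S w)}

/-- Adjacency of vertices. -/
def Adj (v w : 𝒱) : Prop := ∃ S i, X.bd i S = v ∧ X.bd (!i) S = w

theorem sep_bd (i : Bool) (S : ℰ) : X.sep (X.bd i S) (X.bd (!i) S) = {S} := by
  ext S'
  have h := X.side_bd S' S
  simp only [sep, mem_ofPred_eq, mem_singleton_iff]
  cases i <;> simp only [Bool.not_false, Bool.not_true] <;> grind

theorem sep_subset (u v w : 𝒱) : X.sep u w ⊆ X.sep u v ∪ X.sep v w := by
  intro S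
  simp only [sep, mem_ofPred_eq, mem_union]
  tauto

/-- Supplies the first edge of the geodesic from `v` to `w`. Along a walk, each new edge flips only
its own side, so the separating edge `S` at `v` persists until it is traversed again, and then the
walk is back at `v`. -/
theorem eq_or_exists_sep {v w : 𝒱} (h : Relation.ReflTransGen X.Adj v w) :
    w = v ∨ ∃ S i, X.bd i S = v ∧ S ∈ X.sep v w := by
  induction h with
  | refl => exact Or.inl rfl
  | @tail w w' _ hw ih =>
    obtain ⟨S', j, rfl, rfl⟩ := hw
    have hs := X.sep_bd j S'
    rcases ih with rfl | ⟨S, i, rfl, hS⟩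
    · exact Or.inr ⟨S', j, rfl, by rw [hs]; rfl⟩
    · by_cases hSS : S = S'
      · subst hSS
        left
        have : j ≠ i := by
          rintro rfl
          simp [sep] at hS
        congr 1
        cases i <;> cases j <;> simp_all
      · right
        refine ⟨S, i, rfl, ?_⟩
        have : S ∉ X.sep (X.bd j S') (X.bd (!j) S') := by rw [hs]; exact hSS
        simp only [sep, mem_ofPred_eq] at this hS ⊢
        tauto

/-- If `Y` is not contained in a neighbourhood of one of the subsets `vs v`, then the subsets `es S`
coarsely separate it, at every scale at which it is connected. -/
theorem subset_nbhd_or_separates (tri : ∀ x y z, d x z ≤ d x y + d y z) {Y : Set M} {k : ℝ≥0}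
    (hY : IsKConnected d k Y) {p : M} (hp : p ∈ Y) :
    (∃ v, ∃ R : ℝ≥0, Y ⊆ nbhd d (X.vs v) R) ∨
    ∃ L : ℝ≥0, ∀ D : ℝ≥0, ∃ S, ∃ a ∈ Y \ nbhd d (X.es S) L, ∃ b ∈ Y \ nbhd d (X.es S) L,
      (D : ℝ≥0∞) ≤ setDist d a (X.es S) ∧ (D : ℝ≥0∞) ≤ setDist d b (X.es S) ∧
        ¬ KJoinedIn d k (Y \ nbhd d (X.es S) L) a b := by
  obtain ⟨L, hL⟩ := X.crossing k
  rw [or_iff_not_imp_right]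
  intro hsep
  push Not at hsep
  obtain ⟨D₀, hD₀⟩ := hsep L
  -- one side of each edge is shallow
  obtain ⟨D, hD⟩ : ∃ D : ℝ≥0, ∀ S, ∃ σ : Prop, ∀ y ∈ Y, ¬ (X.side S (X.proj y) ↔ σ) →
      setDist d y (X.es S) < D := by
    -- `L + 1` puts deep points outside the `L`-neighbourhood; `D₀` is a depth at which no edge
    -- separates.
    refine ⟨max D₀ (L + 1), fun S => ?_⟩
    by_contra! hcon
    obtain ⟨a, ha, hat, had⟩ := hcon True
    obtain ⟨b, hb, hbt, hbd⟩ := hcon False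
    have hfar : ∀ y, ((max D₀ (L + 1) : ℝ≥0) : ℝ≥0∞) ≤ setDist d y (X.es S) →
        y ∉ nbhd d (X.es S) L := by
      intro y hy hy'
      have : ((L + 1 : ℝ≥0) : ℝ≥0∞) ≤ L :=
        (ENNReal.coe_le_coe.2 (le_max_right _ _)).trans (hy.trans hy')
      rw [ENNReal.coe_le_coe] at this
      exact absurd this (not_le.2 (lt_add_one L))
    have hle : ((D₀ : ℝ≥0) : ℝ≥0∞) ≤ ((max D₀ (L + 1) : ℝ≥0) : ℝ≥0∞) :=
      ENNReal.coe_le_coe.2 (le_max_left _ _)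
    obtain ⟨-, -, hjoin⟩ := hD₀ S a ⟨ha, hfar a had⟩ b ⟨hb, hfar b hbd⟩ (hle.trans had)
      (hle.trans hbd)
    -- A step of the path that changed side would start within `L` of `es S`, which the path avoids.
    have key : X.side S (X.proj a) ↔ X.side S (X.proj b) := by
      clear hbt hbd hb
      induction hjoin with
      | refl => rfl
      | tail _ hstep ih =>
        refine ih.trans ?_
        by_contra hne
        exact hstep.1.2 (hL _ _ S hstep.2.2 hne)
    tauto
  -- `σ S` is the deep side of `S`: every point of `Y` on the other side is at distance less than
  -- `D` from `es S`.
  choose σ hσ using hD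
  -- the vertices that are reached from `proj p` by crossing edges towards their deep sides
  let U : Set 𝒱 := {v | Relation.ReflTransGen X.Adj (X.proj p) v ∧
    ∀ S ∈ X.sep (X.proj p) v, X.side S v ↔ σ S}
  obtain ⟨N₁, hN₁⟩ := X.encard_separating_le D
  obtain ⟨N₂, hN₂⟩ := X.encard_separating_bd_le
  have hadjsymm : ∀ v w, X.Adj v w → X.Adj w v := by
    rintro v w ⟨S, i, rfl, rfl⟩
    exact ⟨S, !i, rfl, by simp⟩
  have hrev : ∀ v w, Relation.ReflTransGen X.Adj v w → Relation.ReflTransGen X.Adj w v :=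
    fun v w h => by
      induction h with
      | refl => exact Relation.ReflTransGen.refl
      | tail _ hs ih => exact Relation.ReflTransGen.head (hadjsymm _ _ hs) ih
  -- The edge at `v` on the way back to `proj p` has `p` on its shallow side, so `p` is `D`-close to
  -- some `s` of its subset. At most `N₁` edges separate the images of `p` and `s`, and at most `N₂`
  -- separate the image of `s` from the endpoint `v`.
  have hbound : ∀ v ∈ U, (X.sep (X.proj p) v).encard ≤ (N₁ + N₂ : ℕ) := by
    rintro v ⟨hpv, hv⟩
    rcases X.eq_or_exists_sep (hrev _ _ hpv) with h | ⟨S, i, rfl, hS⟩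
    · rw [h]; simp [sep]
    · have hS' : S ∈ X.sep (X.proj p) (X.bd i S) := by
        simp only [sep, mem_ofPred_eq] at hS ⊢; tauto
      have hpS : ¬ (X.side S (X.proj p) ↔ σ S) := by
        have := hv S hS'
        simp only [sep, mem_ofPred_eq] at hS; tauto
      obtain ⟨s, hs, hps⟩ := exists_of_setDist_lt (hσ S p hp hpS)
      calc (X.sep (X.proj p) (X.bd i S)).encard
          ≤ (X.sep (X.proj p) (X.proj s) ∪ X.sep (X.proj s) (X.bd i S)).encard :=
            encard_le_encard (X.sep_subset _ _ _)
        _ ≤ (X.sep (X.proj p) (X.proj s)).encard + (X.sep (X.proj s) (X.bd i S)).encard :=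
            encard_union_le _ _
        _ ≤ N₁ + N₂ := add_le_add (hN₁ _ _ hps.le) (hN₂ S s hs i)
        _ = (N₁ + N₂ : ℕ) := by push_cast; rfl
  have hfin : ∀ v ∈ U, (X.sep (X.proj p) v).Finite := fun v hv =>
    finite_of_encard_le_coe (hbound v hv)
  -- a vertex of this set which is farthest from `proj p` is adjacent to shallow sides only
  obtain ⟨v, hvU, hvmax⟩ : ∃ v ∈ U, ∀ w ∈ U,
      (X.sep (X.proj p) w).ncard ≤ (X.sep (X.proj p) v).ncard := by
    have hne : ∃ n, ∃ v ∈ U, (X.sep (X.proj p) v).ncard = n :=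
      ⟨_, X.proj p, ⟨Relation.ReflTransGen.refl, fun S hS => by simp [sep] at hS⟩, rfl⟩
    have hle : ∀ n, (∃ v ∈ U, (X.sep (X.proj p) v).ncard = n) → n ≤ N₁ + N₂ := by
      rintro n ⟨v, hv, rfl⟩
      have := hbound v hv
      rw [← (hfin v hv).cast_ncard_eq] at this
      exact_mod_cast this
    classical
    obtain ⟨n₀, hn₀⟩ := hne
    obtain ⟨v, hv, hvn⟩ := Nat.findGreatest_spec
      (P := fun n => ∃ v ∈ U, (X.sep (X.proj p) v).ncard = n) (hle n₀ hn₀) hn₀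
    refine ⟨v, hv, fun w hw => ?_⟩
    rw [hvn]
    exact Nat.le_findGreatest (hle _ ⟨w, hw, rfl⟩) ⟨w, hw, rfl⟩
  -- An edge at `v` that points away cannot separate `v` from `proj p`; its other endpoint would
  -- then lie in `U`, one edge farther.
  have hsink : ∀ S i, X.bd i S = v → (X.side S v ↔ σ S) := by
    rintro S i rfl
    by_contra hcon
    have hs := X.sep_bd i S
    set w := X.bd (!i) S with hw
    have hSp : S ∉ X.sep (X.proj p) (X.bd i S) := fun h => hcon (hvU.2 S h)
    have hSw : S ∈ X.sep (X.bd i S) w := by rw [hs]; rfl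
    have hother : ∀ S', S' ≠ S → (X.side S' (X.bd i S) ↔ X.side S' w) := by
      intro S' hS'
      have : S' ∉ X.sep (X.bd i S) w := by rw [hs]; exact hS'
      simpa only [sep, mem_ofPred_eq, not_not] using this
    have hset : X.sep (X.proj p) w = insert S (X.sep (X.proj p) (X.bd i S)) := by
      ext S'
      by_cases h : S' = S
      · subst h
        simp only [sep, mem_ofPred_eq, mem_insert_iff, true_or, iff_true] at hSp hSw ⊢
        tauto
      · have := hother S' h
        simp only [sep, mem_ofPred_eq, mem_insert_iff, h, false_or]
        tauto
    have hwU : w ∈ U := by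
      refine ⟨hvU.1.tail ⟨S, i, rfl, rfl⟩, fun S' hS' => ?_⟩
      rw [hset] at hS'
      by_cases h : S' = S
      · subst h
        simp only [sep, mem_ofPred_eq] at hSw
        tauto
      · rw [← hother S' h]
        exact hvU.2 S' (hS'.resolve_left h)
    have := hvmax w hwU
    rw [hset, ncard_insert_of_notMem hSp (hfin _ hvU)] at this
    omega
  obtain ⟨C₁, hC₁⟩ := X.setDist_vs_proj
  obtain ⟨C₂, hC₂⟩ := X.setDist_vs_bd
  -- `C₁` serves when `proj y = v`. Otherwise an edge at `v` has `y` on its shallow side: `y` is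
  -- within `D` of the edge subset, itself within `C₂` of `vs v`.
  refine ⟨v, max C₁ (D + C₂), fun y hy => ?_⟩
  have hpy : Relation.ReflTransGen X.Adj (X.proj p) (X.proj y) := by
    obtain ⟨-, -, hj⟩ := hY p hp y hy
    induction hj with
    | refl => exact Relation.ReflTransGen.refl
    | tail _ hstep ih =>
      exact (ih hstep.1).trans (X.joined _ _ (hstep.2.2.trans_lt ENNReal.coe_lt_top))
  rcases X.eq_or_exists_sep ((hrev _ _ hvU.1).trans hpy) with h | ⟨S, i, hSv, hS⟩
  · have := hC₁ y
    rw [h] at this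
    exact this.trans (ENNReal.coe_le_coe.2 (le_max_left _ _))
  · have h1 := hsink S i hSv
    have hys : ¬ (X.side S (X.proj y) ↔ σ S) := by
      simp only [sep, mem_ofPred_eq] at hS; tauto
    obtain ⟨s, hs, hd⟩ := exists_of_setDist_lt (hσ S y hy hys)
    have h2 := hC₂ S s hs i
    rw [hSv] at h2
    refine (setDist_le_add tri y s _).trans ?_
    refine le_trans (add_le_add hd.le h2) ?_
    rw [← ENNReal.coe_add]
    exact ENNReal.coe_le_coe.2 (le_max_right _ _)

end CoarseTree

end CoarseTree

/-! ### Word metrics -/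

section WordMetric

variable {G : Type*} [Group G] {S : Finset G}

theorem exists_list_of_wordLength (hS : Subgroup.closure (S : Set G) = ⊤) (g : G) :
    ∃ l : List G, l.length = wordLength S g ∧ (∀ x ∈ l, x ∈ S ∨ x⁻¹ ∈ S) ∧ l.prod = g := by
  have hg : g ∈ Subgroup.closure (S : Set G) := by rw [hS]; trivial
  rw [← Subgroup.mem_toSubmonoid, Subgroup.closure_toSubmonoid] at hg
  obtain ⟨l, hl, hp⟩ := Submonoid.exists_list_of_mem_closure hg
  exact Nat.sInf_mem (s := {n | ∃ l : List G, l.length = n ∧ (∀ x ∈ l, x ∈ S ∨ x⁻¹ ∈ S) ∧ l.prod = g})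
    ⟨l.length, l, rfl, hl, hp⟩

theorem wordLength_prod_le {l : List G} (hl : ∀ x ∈ l, x ∈ S ∨ x⁻¹ ∈ S) :
    wordLength S l.prod ≤ l.length :=
  Nat.sInf_le ⟨l, rfl, hl, rfl⟩

theorem wordLength_one : wordLength S 1 = 0 :=
  Nat.le_zero.1 (wordLength_prod_le (S := S) (l := []) (by simp))

theorem wordLength_mul_le (hS : Subgroup.closure (S : Set G) = ⊤) (g h : G) :
    wordLength S (g * h) ≤ wordLength S g + wordLength S h := by
  obtain ⟨l, hl, hl', rfl⟩ := exists_list_of_wordLength hS g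
  obtain ⟨m, hm, hm', rfl⟩ := exists_list_of_wordLength hS h
  rw [← hl, ← hm, ← List.prod_append, ← List.length_append]
  refine wordLength_prod_le fun x hx => ?_
  rcases List.mem_append.1 hx with h | h
  exacts [hl' x h, hm' x h]

theorem wordLength_inv_le (hS : Subgroup.closure (S : Set G) = ⊤) (g : G) :
    wordLength S g⁻¹ ≤ wordLength S g := by
  obtain ⟨l, hl, hl', rfl⟩ := exists_list_of_wordLength hS g
  rw [← hl, List.prod_inv_reverse]
  refine (wordLength_prod_le fun x hx => ?_).trans (by simp)
  simp only [List.mem_reverse, List.mem_map] at hx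
  obtain ⟨y, hy, rfl⟩ := hx
  rw [inv_inv]
  exact (hl' y hy).symm

theorem finite_wordLength_le (hS : Subgroup.closure (S : Set G) = ⊤) (n : ℕ) :
    {g : G | wordLength S g ≤ n}.Finite := by
  let A : Set G := {x | x ∈ S ∨ x⁻¹ ∈ S}
  have hA : A.Finite := by
    refine (S.finite_toSet.union (S.finite_toSet.preimage inv_injective.injOn)).subset ?_
    rintro x (hx | hx)
    exacts [Or.inl hx, Or.inr hx]
  have : Finite A := hA
  refine ((List.finite_length_le A n).image fun l => (l.map Subtype.val).prod).subset ?_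
  intro g hg
  obtain ⟨l, hl, hl', rfl⟩ := exists_list_of_wordLength hS g
  lift l to List A using hl'
  refine ⟨l, ?_, rfl⟩
  rw [mem_ofPred_eq, ← hl, List.length_map] at hg
  exact hg

theorem wordDist_triangle (hS : Subgroup.closure (S : Set G) = ⊤) (x y z : G) :
    wordDist S x z ≤ wordDist S x y + wordDist S y z := by
  have h := wordLength_mul_le hS (x⁻¹ * y) (y⁻¹ * z)
  rw [mul_assoc, mul_inv_cancel_left] at h
  simp only [wordDist]
  exact_mod_cast h

theorem wordDist_le_iff {x y : G} {n : ℕ} :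
    wordDist S x y ≤ (n : ℝ≥0) ↔ wordLength S (x⁻¹ * y) ≤ n := by
  rw [wordDist]
  exact_mod_cast Iff.rfl

theorem wordLength_le_of_wordDist_le {x y : G} {k : ℝ≥0} (h : wordDist S x y ≤ k) :
    wordLength S (x⁻¹ * y) ≤ ⌊k⌋₊ := by
  rw [wordDist] at h
  exact Nat.le_floor (by exact_mod_cast h)

end WordMetric

/-! ### The Bass–Serre tree and the sides of its edges -/

namespace GraphOfGroups

variable {V : Type u} {E : Type v} (𝒢 : GraphOfGroups.{u, v, w} V E) (T : Set E)

/-- The stable letter of an edge, in the fundamental group. -/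
def stable (e : E) : 𝒢.FundGroup T := PresentedGroup.of (Sum.inr e)

/-- The vertices of the Bass-Serre tree. -/
abbrev TreeVertex : Type _ := Σ v, 𝒢.FundGroup T ⧸ 𝒢.vertexSubgroup T v

/-- The edges of the Bass-Serre tree. -/
abbrev TreeEdge : Type _ := Σ e, 𝒢.FundGroup T ⧸ 𝒢.edgeSubgroup T e

/-- The functions on the edges of the Bass-Serre tree with values in `ℤ / 2`. -/
abbrev Cochain : Type _ := 𝒢.TreeEdge T → ZMod 2

variable {𝒢 T}

theorem stable_conj (e : E) (b : 𝒢.B e) :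
    𝒢.stable T e * 𝒢.vertexHom T _ (𝒢.i₁ e b) * (𝒢.stable T e)⁻¹ = 𝒢.vertexHom T _ (𝒢.i₀ e b) := by
  have h : PresentedGroup.mk {r : FreeGroup 𝒢.Gen | 𝒢.Rel T r}
      (𝒢.genT e * 𝒢.genA _ (𝒢.i₁ e b) * (𝒢.genT e)⁻¹ * (𝒢.genA _ (𝒢.i₀ e b))⁻¹) = 1 :=
    PresentedGroup.one_of_mem (rels := {r : FreeGroup 𝒢.Gen | 𝒢.Rel T r}) (Rel.edge e b)
  rw [map_mul, map_mul, map_mul, map_inv, map_inv, mul_inv_eq_one] at h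
  exact h

theorem stable_eq_one {e : E} (he : e ∈ T) : 𝒢.stable T e = 1 :=
  PresentedGroup.one_of_mem (rels := {r : FreeGroup 𝒢.Gen | 𝒢.Rel T r}) (Rel.tree e he)

variable (𝒢 T) in
/-- The simple graph spanned by the edges in `T`. -/
def treeGraph : SimpleGraph V :=
  SimpleGraph.fromEdgeSet {p : Sym2 V | ∃ e ∈ T, p = s(𝒢.ori e, 𝒢.ter e)}

open Classical in
variable (𝒢 T) in
/-- The side of the vertex `v` with respect to the edge `e` of the tree. -/
noncomputable def treeSide (e : E) (v : V) : ZMod 2 :=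
  if e ∈ T ∧ ¬ ((𝒢.treeGraph T).deleteEdges {s(𝒢.ori e, 𝒢.ter e)}).Reachable (𝒢.ori e) v then 1 else 0

open Classical in
-- An edge of a tree is a bridge, so its removal parts its own endpoints; any other edge of `T`
-- survives the removal and keeps its endpoints together. For `e'` outside `T` all values are zero.
theorem treeSide_ter (hT : 𝒢.IsSpanningTree T) {e : E} (he : e ∈ T) (e' : E) :
    𝒢.treeSide T e' (𝒢.ter e) = 𝒢.treeSide T e' (𝒢.ori e) + if e' = e then 1 else 0 := by
  have hadj : (𝒢.treeGraph T).Adj (𝒢.ori e) (𝒢.ter e) := by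
    rw [treeGraph, SimpleGraph.fromEdgeSet_adj]
    exact ⟨⟨e, he, rfl⟩, hT.1 e he⟩
  by_cases h : e' = e
  · subst h
    have hb : (𝒢.treeGraph T).IsBridge s(𝒢.ori e', 𝒢.ter e') :=
      SimpleGraph.isAcyclic_iff_forall_isBridge.1 hT.2.2.isAcyclic hadj
    rw [SimpleGraph.isBridge_iff] at hb
    have h1 : ¬ ((𝒢.treeGraph T).deleteEdges {s(𝒢.ori e', 𝒢.ter e')}).Reachable
        (𝒢.ori e') (𝒢.ter e') := by
      exact hb
    simp [treeSide, he, h1]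
  · rw [if_neg h, add_zero, treeSide, treeSide]
    by_cases h' : e' ∈ T
    · have hne : s(𝒢.ori e, 𝒢.ter e) ≠ s(𝒢.ori e', 𝒢.ter e') := fun hs =>
        h (hT.2.1 e' h' e he hs.symm)
      have hadj' : ((𝒢.treeGraph T).deleteEdges {s(𝒢.ori e', 𝒢.ter e')}).Adj
          (𝒢.ori e) (𝒢.ter e) := by
        rw [SimpleGraph.deleteEdges_adj]
        exact ⟨hadj, hne⟩
      have : ∀ x, ((𝒢.treeGraph T).deleteEdges {s(𝒢.ori e', 𝒢.ter e')}).Reachable x (𝒢.ter e) ↔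
          ((𝒢.treeGraph T).deleteEdges {s(𝒢.ori e', 𝒢.ter e')}).Reachable x (𝒢.ori e) := fun x =>
        ⟨fun hx => hx.trans hadj'.reachable.symm, fun hx => hx.trans hadj'.reachable⟩
      simp only [this]
    · simp [h']

open Classical in
variable (𝒢 T) in
/-- The sides of the lift of a vertex to the Bass-Serre tree. -/
noncomputable def baseCochain (v : V) : 𝒢.Cochain T :=
  fun S => if S.2 = ((1 : 𝒢.FundGroup T) : 𝒢.FundGroup T ⧸ 𝒢.edgeSubgroup T S.1) then
    𝒢.treeSide T S.1 v else 0

open Classical in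
variable (𝒢 T) in
/-- The indicator function of the lift of an edge to the Bass-Serre tree. -/
noncomputable def edgeCochain (e : E) : 𝒢.Cochain T :=
  Pi.single ⟨e, ((1 : 𝒢.FundGroup T) : 𝒢.FundGroup T ⧸ 𝒢.edgeSubgroup T e)⟩ 1

theorem baseCochain_ter (hT : 𝒢.IsSpanningTree T) {e : E} (he : e ∈ T) :
    𝒢.baseCochain T (𝒢.ter e) = 𝒢.baseCochain T (𝒢.ori e) + 𝒢.edgeCochain T e := by
  classical
  funext ⟨e', x⟩
  simp only [baseCochain, edgeCochain, Pi.add_apply]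
  by_cases hx : x = ((1 : 𝒢.FundGroup T) : 𝒢.FundGroup T ⧸ 𝒢.edgeSubgroup T e')
  · subst hx
    rw [if_pos rfl, if_pos rfl, treeSide_ter hT he]
    by_cases h : e' = e
    · subst h; simp
    · rw [if_neg h, Pi.single_eq_of_ne]
      intro h'
      exact h (congrArg Sigma.fst h')
  · rw [if_neg hx, if_neg hx, Pi.single_eq_of_ne, add_zero]
    rintro h'
    obtain ⟨rfl, h''⟩ := Sigma.mk.inj_iff.1 h'
    exact hx (eq_of_heq h'')

variable (𝒢 T) in
/-- The action of the fundamental group on the cochains by translations. -/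
def translation : 𝒢.FundGroup T →* Equiv.Perm (𝒢.Cochain T) where
  toFun g := (MulAction.toPerm g : Equiv.Perm (𝒢.TreeEdge T)).arrowCongr (Equiv.refl _)
  map_one' := by
    ext ω S
    simp
  map_mul' g h := by
    ext ω S
    simp [mul_smul]

theorem translation_apply (g : 𝒢.FundGroup T) (ω : 𝒢.Cochain T) (S : 𝒢.TreeEdge T) :
    𝒢.translation T g ω S = ω (g⁻¹ • S) := rfl

theorem translation_add (g : 𝒢.FundGroup T) (ω η : 𝒢.Cochain T) :
    𝒢.translation T g (ω + η) = 𝒢.translation T g ω + 𝒢.translation T g η := rfl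

theorem translation_single [DecidableEq (𝒢.TreeEdge T)] (g : 𝒢.FundGroup T) (S : 𝒢.TreeEdge T)
    (a : ZMod 2) :
    𝒢.translation T g (Pi.single S a : 𝒢.Cochain T) = (Pi.single (g • S) a : 𝒢.Cochain T) := by
  funext S'
  rw [translation_apply]
  simp only [Pi.single_apply, inv_smul_eq_iff]

/-- The edge-group stabilizes the base lift of its edge. This is what makes the edge relations hold
for the affine action. -/
theorem translation_edgeCochain (e : E) (b : 𝒢.B e) :
    𝒢.translation T (𝒢.vertexHom T _ (𝒢.i₀ e b)) (𝒢.edgeCochain T e) = 𝒢.edgeCochain T e := by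
  classical
  rw [edgeCochain, translation_single]
  congr 1
  refine Sigma.ext rfl (heq_of_eq ?_)
  change ((_ * 1 : 𝒢.FundGroup T) : 𝒢.FundGroup T ⧸ 𝒢.edgeSubgroup T e) = _
  rw [QuotientGroup.eq]
  have h0 : 𝒢.vertexHom T _ (𝒢.i₀ e b) ∈ 𝒢.edgeSubgroup T e := ⟨b, rfl⟩
  have h := inv_mem h0
  convert h using 1
  simp

variable (𝒢 T) in
/-- The affine action on the cochains: the images of the generators. -/
noncomputable def affineGen : 𝒢.Gen → Equiv.Perm (𝒢.Cochain T)
  -- The conjugate of the translation that fixes `baseCochain v`, as `a` fixes the lift of `v`.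
  | Sum.inl ⟨v, a⟩ => Equiv.addLeft (𝒢.baseCochain T v) * 𝒢.translation T (𝒢.vertexHom T v a) *
      (Equiv.addLeft (𝒢.baseCochain T v))⁻¹
  -- Sends `baseCochain (ter e)` to `baseCochain (ori e) + edgeCochain e`: the stable letter takes
  -- the lift of `ter e` to the far end of the base lift of `e`.
  | Sum.inr e => Equiv.addLeft (𝒢.baseCochain T (𝒢.ori e)) * Equiv.addLeft (𝒢.edgeCochain T e) *
      𝒢.translation T (𝒢.stable T e) * (Equiv.addLeft (𝒢.baseCochain T (𝒢.ter e)))⁻¹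

/-- Vertex relations hold because conjugation is multiplicative. For the edge relations, translation
by an element of the edge-group commutes with adding `edgeCochain e`. For an edge of `T` the stable
letter is trivial, and the two shifts cancel by `baseCochain_ter`. -/
theorem lift_affineGen (hT : 𝒢.IsSpanningTree T) :
    ∀ r ∈ {r : FreeGroup 𝒢.Gen | 𝒢.Rel T r}, FreeGroup.lift (𝒢.affineGen T) r = 1 := by
  rintro r (⟨v, a, b⟩ | ⟨e, b⟩ | ⟨e, he⟩)
  · simp only [genA, map_mul, map_inv, FreeGroup.lift_apply_of, affineGen]
    group
  · have hcomm : 𝒢.translation T (𝒢.vertexHom T _ (𝒢.i₀ e b)) * Equiv.addLeft (𝒢.edgeCochain T e) =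
        Equiv.addLeft (𝒢.edgeCochain T e) * 𝒢.translation T (𝒢.vertexHom T _ (𝒢.i₀ e b)) := by
      refine Equiv.ext fun ω => ?_
      simp only [Equiv.Perm.mul_apply, Equiv.coe_addLeft]
      rw [translation_add, translation_edgeCochain]
    simp only [genA, genT, map_mul, map_inv, FreeGroup.lift_apply_of, affineGen]
    rw [← stable_conj, map_mul, map_mul, map_inv] at hcomm ⊢
    generalize 𝒢.translation T (𝒢.stable T e) = t at *
    generalize 𝒢.translation T _ = s at *
    generalize Equiv.addLeft (𝒢.edgeCochain T e) = x at *
    generalize Equiv.addLeft (𝒢.baseCochain T (𝒢.ori e)) = o at *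
    have : x * (t * s * t⁻¹) * x⁻¹ * (t * s * t⁻¹)⁻¹ = 1 := by
      rw [← hcomm]; group
    calc _ = o * (x * (t * s * t⁻¹) * x⁻¹ * (t * s * t⁻¹)⁻¹) * o⁻¹ := by group
      _ = 1 := by rw [this]; group
  · simp only [genT, FreeGroup.lift_apply_of, affineGen]
    rw [stable_eq_one he, baseCochain_ter hT he, map_one]
    refine Equiv.ext fun ω => ?_
    simp only [Equiv.Perm.mul_apply, Equiv.coe_addLeft, Equiv.Perm.one_apply, mul_one]
    rw [← add_assoc]
    exact Equiv.apply_symm_apply (Equiv.addLeft _) ω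

/-- The affine action of the fundamental group on the cochains. -/
noncomputable def affine (hT : 𝒢.IsSpanningTree T) :
    𝒢.FundGroup T →* Equiv.Perm (𝒢.Cochain T) :=
  PresentedGroup.toGroup (lift_affineGen hT)

theorem affine_vertexHom (hT : 𝒢.IsSpanningTree T) (v : V) (a : 𝒢.A v) :
    affine hT (𝒢.vertexHom T v a) = Equiv.addLeft (𝒢.baseCochain T v) *
      𝒢.translation T (𝒢.vertexHom T v a) * (Equiv.addLeft (𝒢.baseCochain T v))⁻¹ :=
  PresentedGroup.toGroup.of (lift_affineGen hT)

theorem affine_stable (hT : 𝒢.IsSpanningTree T) (e : E) :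
    affine hT (𝒢.stable T e) =
      Equiv.addLeft (𝒢.baseCochain T (𝒢.ori e)) * Equiv.addLeft (𝒢.edgeCochain T e) *
      𝒢.translation T (𝒢.stable T e) * (Equiv.addLeft (𝒢.baseCochain T (𝒢.ter e)))⁻¹ :=
  PresentedGroup.toGroup.of (lift_affineGen hT)

theorem mem_of_vertexHom_mem_of_stable_mem (K : Subgroup (𝒢.FundGroup T))
    (hA : ∀ v a, 𝒢.vertexHom T v a ∈ K) (ht : ∀ e, 𝒢.stable T e ∈ K) (g : 𝒢.FundGroup T) :
    g ∈ K := by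
  refine PresentedGroup.generated_by _ K ?_ g
  rintro (⟨v, a⟩ | e)
  exacts [hA v a, ht e]

theorem addLeft_inv_add {A : Type*} [AddCommGroup A] (c ω η : A) :
    (Equiv.addLeft c)⁻¹ (ω + η) = (Equiv.addLeft c)⁻¹ ω + η := by
  rw [Equiv.Perm.inv_eq_iff_eq]
  simp only [Equiv.coe_addLeft]
  rw [← add_assoc]
  congr 1
  exact (Equiv.apply_symm_apply (Equiv.addLeft c) ω).symm

/-- The linear part of the affine action is translation, so differences of cochains are moved by
plain translation. The property defines a subgroup, hence it is checked on generators. -/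
theorem affine_add (hT : 𝒢.IsSpanningTree T) (g : 𝒢.FundGroup T) (ω η : 𝒢.Cochain T) :
    affine hT g (ω + η) = affine hT g ω + 𝒢.translation T g η := by
  let K : Subgroup (𝒢.FundGroup T) :=
    { carrier := {g | ∀ ω η, affine hT g (ω + η) = affine hT g ω + 𝒢.translation T g η}
      one_mem' := fun ω η => by simp
      mul_mem' := fun {g h} hg hh ω η => by
        simp only [map_mul, Equiv.Perm.mul_apply]
        rw [hh, hg]
      inv_mem' := fun {g} hg ω η => by
        rw [map_inv, Equiv.Perm.inv_eq_iff_eq, hg, map_inv]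
        simp }
  refine mem_of_vertexHom_mem_of_stable_mem K (fun v a => ?_) (fun e => ?_) g ω η
  · intro ω η
    rw [affine_vertexHom]
    simp only [Equiv.Perm.mul_apply, Equiv.coe_addLeft, addLeft_inv_add, translation_add, add_assoc]
  · intro ω η
    rw [affine_stable]
    simp only [Equiv.Perm.mul_apply, Equiv.coe_addLeft, addLeft_inv_add, translation_add, add_assoc]

/-- The sides of a vertex of the Bass-Serre tree. -/
noncomputable def vertexCochain (hT : 𝒢.IsSpanningTree T) (x : 𝒢.TreeVertex T) : 𝒢.Cochain T :=
  affine hT x.2.out (𝒢.baseCochain T x.1)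

/-- The choice of representative is harmless, because the vertex-group fixes `baseCochain T v` under
the affine action. -/
theorem vertexCochain_mk (hT : 𝒢.IsSpanningTree T) (v : V) (g : 𝒢.FundGroup T) :
    vertexCochain hT ⟨v, (g : 𝒢.FundGroup T ⧸ 𝒢.vertexSubgroup T v)⟩ =
      affine hT g (𝒢.baseCochain T v) := by
  obtain ⟨⟨_, a, rfl⟩, hh⟩ := QuotientGroup.mk_out_eq_mul (𝒢.vertexSubgroup T v) g
  simp only [vertexCochain]
  rw [hh, map_mul, Equiv.Perm.mul_apply, affine_vertexHom]
  congr 1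
  simp only [Equiv.Perm.mul_apply, Equiv.coe_addLeft]
  have h0 : (Equiv.addLeft (𝒢.baseCochain T v))⁻¹ (𝒢.baseCochain T v) = 0 := by
    rw [Equiv.Perm.inv_eq_iff_eq]; simp
  rw [h0]
  exact add_zero _

/-- The endpoints of an edge of the Bass-Serre tree. -/
noncomputable def treeBd : Bool → 𝒢.TreeEdge T → 𝒢.TreeVertex T
  | false, S => ⟨𝒢.ori S.1, (S.2.out : 𝒢.FundGroup T ⧸ 𝒢.vertexSubgroup T _)⟩
  | true, S => ⟨𝒢.ter S.1, (S.2.out * 𝒢.stable T S.1 : 𝒢.FundGroup T)⟩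

theorem treeBd_false (e : E) (g : 𝒢.FundGroup T) :
    treeBd false ⟨e, (g : 𝒢.FundGroup T ⧸ 𝒢.edgeSubgroup T e)⟩ =
      (⟨𝒢.ori e, (g : 𝒢.FundGroup T ⧸ 𝒢.vertexSubgroup T _)⟩ : 𝒢.TreeVertex T) := by
  obtain ⟨⟨_, b, rfl⟩, hh⟩ := QuotientGroup.mk_out_eq_mul (𝒢.edgeSubgroup T e) g
  simp only [treeBd]
  refine Sigma.ext rfl (heq_of_eq ?_)
  rw [hh, QuotientGroup.eq]
  have h0 : 𝒢.vertexHom T _ (𝒢.i₀ e b) ∈ 𝒢.vertexSubgroup T (𝒢.ori e) := ⟨_, rfl⟩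
  have h := inv_mem h0
  convert h using 1
  simp

theorem treeBd_true (e : E) (g : 𝒢.FundGroup T) :
    treeBd true ⟨e, (g : 𝒢.FundGroup T ⧸ 𝒢.edgeSubgroup T e)⟩ =
      (⟨𝒢.ter e, (g * 𝒢.stable T e : 𝒢.FundGroup T)⟩ : 𝒢.TreeVertex T) := by
  obtain ⟨⟨_, b, rfl⟩, hh⟩ := QuotientGroup.mk_out_eq_mul (𝒢.edgeSubgroup T e) g
  simp only [treeBd]
  refine Sigma.ext rfl (heq_of_eq ?_)
  rw [hh, QuotientGroup.eq]
  have h0 : 𝒢.vertexHom T _ (𝒢.i₁ e b) ∈ 𝒢.vertexSubgroup T (𝒢.ter e) := ⟨_, rfl⟩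
  have h := inv_mem h0
  convert h using 1
  have := stable_conj (T := T) e b
  rw [mul_inv_eq_iff_eq_mul] at this
  simp only [MonoidHom.comp_apply]
  rw [mul_assoc g, ← this]
  group

/-- The reason the coset graph is a tree: the coordinate of `S` changes across `S` and across no
other edge. It holds for the base lift by the choice of the image of the stable letter, and
everywhere by `affine_add`. -/
theorem vertexCochain_treeBd [DecidableEq (𝒢.TreeEdge T)] (hT : 𝒢.IsSpanningTree T)
    (S : 𝒢.TreeEdge T) :
    vertexCochain hT (treeBd true S) = vertexCochain hT (treeBd false S) + Pi.single S 1 := by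
  obtain ⟨e, x⟩ := S
  obtain ⟨g, rfl⟩ := QuotientGroup.mk_surjective x
  rw [treeBd_true, treeBd_false, vertexCochain_mk, vertexCochain_mk, map_mul, Equiv.Perm.mul_apply,
    affine_stable]
  simp only [Equiv.Perm.mul_apply, Equiv.coe_addLeft]
  have h0 : (Equiv.addLeft (𝒢.baseCochain T (𝒢.ter e)))⁻¹ (𝒢.baseCochain T (𝒢.ter e)) = 0 := by
    rw [Equiv.Perm.inv_eq_iff_eq]; simp
  have h1 : 𝒢.translation T (𝒢.stable T e) 0 = 0 := rfl
  rw [h0, h1, add_zero, affine_add, edgeCochain]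
  congr 1
  have := translation_single g
    ⟨e, ((1 : 𝒢.FundGroup T) : 𝒢.FundGroup T ⧸ 𝒢.edgeSubgroup T e)⟩ (1 : ZMod 2)
  have h2 : g • (⟨e, ((1 : 𝒢.FundGroup T) : 𝒢.FundGroup T ⧸ 𝒢.edgeSubgroup T e)⟩ : 𝒢.TreeEdge T) =
      ⟨e, (g : 𝒢.FundGroup T ⧸ 𝒢.edgeSubgroup T e)⟩ := by
    refine Sigma.ext rfl (heq_of_eq ?_)
    change ((g * 1 : 𝒢.FundGroup T) : 𝒢.FundGroup T ⧸ 𝒢.edgeSubgroup T e) = _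
    rw [mul_one]
  rw [h2] at this
  convert this

/-- The edges that separate two vertices of the Bass-Serre tree. -/
def treeSep (hT : 𝒢.IsSpanningTree T) (x y : 𝒢.TreeVertex T) : Set (𝒢.TreeEdge T) :=
  {S | ¬ (vertexCochain hT x S = 0 ↔ vertexCochain hT y S = 0)}

theorem mem_treeSep {hT : 𝒢.IsSpanningTree T} {x y : 𝒢.TreeVertex T} {S : 𝒢.TreeEdge T} :
    S ∈ treeSep hT x y ↔ vertexCochain hT x S ≠ vertexCochain hT y S := by
  have : ∀ a b : ZMod 2, (¬ (a = 0 ↔ b = 0)) ↔ a ≠ b := by decide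
  exact this _ _

theorem vertexCochain_smul (hT : 𝒢.IsSpanningTree T) (g : 𝒢.FundGroup T) (x : 𝒢.TreeVertex T) :
    vertexCochain hT (g • x) = affine hT g (vertexCochain hT x) := by
  obtain ⟨v, x⟩ := x
  obtain ⟨h, rfl⟩ := QuotientGroup.mk_surjective x
  have : g • (⟨v, (h : 𝒢.FundGroup T ⧸ 𝒢.vertexSubgroup T v)⟩ : 𝒢.TreeVertex T) =
      ⟨v, ((g * h : 𝒢.FundGroup T) : 𝒢.FundGroup T ⧸ 𝒢.vertexSubgroup T v)⟩ := rfl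
  rw [this, vertexCochain_mk, vertexCochain_mk, map_mul, Equiv.Perm.mul_apply]

/-- Separation depends only on the difference of two cochains, in which the translation part of the
affine action cancels. -/
theorem smul_mem_treeSep (hT : 𝒢.IsSpanningTree T) (g : 𝒢.FundGroup T) (x y : 𝒢.TreeVertex T)
    (S : 𝒢.TreeEdge T) : g • S ∈ treeSep hT (g • x) (g • y) ↔ S ∈ treeSep hT x y := by
  rw [mem_treeSep, mem_treeSep, vertexCochain_smul, vertexCochain_smul]
  have h : vertexCochain hT y = vertexCochain hT x + (vertexCochain hT y - vertexCochain hT x) := by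
    abel
  rw [h, affine_add]
  simp only [Pi.add_apply, translation_apply, inv_smul_smul, ne_eq, left_eq_add]

theorem encard_treeSep_smul (hT : 𝒢.IsSpanningTree T) (g : 𝒢.FundGroup T)
    (x y : 𝒢.TreeVertex T) :
    (treeSep hT (g • x) (g • y)).encard = (treeSep hT x y).encard := by
  have : treeSep hT (g • x) (g • y) = (fun S => g • S) '' treeSep hT x y := by
    ext S
    constructor
    · intro hS
      refine ⟨g⁻¹ • S, ?_, smul_inv_smul g S⟩
      rw [← smul_mem_treeSep hT g, smul_inv_smul]
      exact hS
    · rintro ⟨S, hS, rfl⟩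
      exact (smul_mem_treeSep hT g x y S).2 hS
  rw [this, (MulAction.injective g).encard_image]

/-- Adjacency in the Bass-Serre tree. -/
def TreeAdj (x y : 𝒢.TreeVertex T) : Prop :=
  ∃ S : 𝒢.TreeEdge T, ∃ i, treeBd i S = x ∧ treeBd (!i) S = y

theorem smul_treeBd (g : 𝒢.FundGroup T) (i : Bool) (S : 𝒢.TreeEdge T) :
    g • treeBd i S = treeBd i (g • S) := by
  obtain ⟨e, x⟩ := S
  obtain ⟨h, rfl⟩ := QuotientGroup.mk_surjective x
  have : g • (⟨e, (h : 𝒢.FundGroup T ⧸ 𝒢.edgeSubgroup T e)⟩ : 𝒢.TreeEdge T) =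
      ⟨e, ((g * h : 𝒢.FundGroup T) : 𝒢.FundGroup T ⧸ 𝒢.edgeSubgroup T e)⟩ := rfl
  rw [this]
  cases i
  · rw [treeBd_false, treeBd_false]; rfl
  · rw [treeBd_true, treeBd_true, mul_assoc]; rfl

theorem TreeAdj.symm {x y : 𝒢.TreeVertex T} (h : TreeAdj x y) : TreeAdj y x := by
  obtain ⟨S, i, rfl, rfl⟩ := h
  exact ⟨S, !i, rfl, by simp⟩

theorem reflTransGen_treeAdj_symm {x y : 𝒢.TreeVertex T}
    (h : Relation.ReflTransGen TreeAdj x y) : Relation.ReflTransGen TreeAdj y x := by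
  induction h with
  | refl => exact Relation.ReflTransGen.refl
  | tail _ hs ih => exact Relation.ReflTransGen.head hs.symm ih

theorem reflTransGen_treeAdj_smul (g : 𝒢.FundGroup T) {x y : 𝒢.TreeVertex T}
    (h : Relation.ReflTransGen TreeAdj x y) : Relation.ReflTransGen TreeAdj (g • x) (g • y) := by
  induction h with
  | refl => exact Relation.ReflTransGen.refl
  | tail _ hs ih =>
    obtain ⟨S, i, rfl, rfl⟩ := hs
    exact ih.tail ⟨g • S, i, (smul_treeBd _ _ _).symm, (smul_treeBd _ _ _).symm⟩

variable (𝒢 T) in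
/-- The lift of a vertex to the Bass-Serre tree. -/
def baseVertex (v : V) : 𝒢.TreeVertex T :=
  ⟨v, ((1 : 𝒢.FundGroup T) : 𝒢.FundGroup T ⧸ 𝒢.vertexSubgroup T v)⟩

theorem smul_baseVertex (g : 𝒢.FundGroup T) (v : V) :
    g • 𝒢.baseVertex T v = ⟨v, (g : 𝒢.FundGroup T ⧸ 𝒢.vertexSubgroup T v)⟩ := by
  refine Sigma.ext rfl (heq_of_eq ?_)
  change ((g * 1 : 𝒢.FundGroup T) : 𝒢.FundGroup T ⧸ 𝒢.vertexSubgroup T v) = _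
  rw [mul_one]

theorem vertexHom_smul_baseVertex (v : V) (a : 𝒢.A v) :
    𝒢.vertexHom T v a • 𝒢.baseVertex T v = 𝒢.baseVertex T v := by
  rw [smul_baseVertex]
  refine Sigma.ext rfl (heq_of_eq ?_)
  simp only [baseVertex]
  rw [QuotientGroup.eq, mul_one]
  exact inv_mem ⟨a, rfl⟩

theorem treeAdj_stable (e : E) :
    TreeAdj (𝒢.baseVertex T (𝒢.ori e)) (𝒢.stable T e • 𝒢.baseVertex T (𝒢.ter e)) := by
  refine ⟨⟨e, ((1 : 𝒢.FundGroup T) : 𝒢.FundGroup T ⧸ 𝒢.edgeSubgroup T e)⟩, false, ?_, ?_⟩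
  · rw [treeBd_false]; rfl
  · rw [Bool.not_false, treeBd_true, one_mul, smul_baseVertex]

/-- Stable letters of edges in `T` are trivial, so paths in `T` lift unchanged. -/
theorem reflTransGen_baseVertex (hT : 𝒢.IsSpanningTree T) (v v' : V) :
    Relation.ReflTransGen TreeAdj (𝒢.baseVertex T v) (𝒢.baseVertex T v') := by
  obtain ⟨p⟩ := hT.2.2.1.preconnected v v'
  induction p with
  | nil => exact Relation.ReflTransGen.refl
  | cons h p ih =>
    refine Relation.ReflTransGen.head ?_ ih
    rw [SimpleGraph.fromEdgeSet_adj] at h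
    obtain ⟨⟨e, he, hs⟩, -⟩ := h
    have := treeAdj_stable (𝒢 := 𝒢) (T := T) e
    rw [stable_eq_one he, one_smul] at this
    rcases Sym2.eq_iff.1 hs with ⟨rfl, rfl⟩ | ⟨rfl, rfl⟩
    exacts [this, this.symm]

/-- The elements that move the lift of `v` to a vertex joined to it form a subgroup; it contains the
vertex-groups, which fix a lift, and the stable letters, which move along an edge. -/
theorem reflTransGen_smul_baseVertex (hT : 𝒢.IsSpanningTree T) (v : V) (g : 𝒢.FundGroup T) :
    Relation.ReflTransGen TreeAdj (𝒢.baseVertex T v) (g • 𝒢.baseVertex T v) := by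
  let K : Subgroup (𝒢.FundGroup T) :=
    { carrier := {g | Relation.ReflTransGen TreeAdj (𝒢.baseVertex T v) (g • 𝒢.baseVertex T v)}
      one_mem' := by
        simp only [mem_ofPred_eq, one_smul]
        exact Relation.ReflTransGen.refl
      mul_mem' := fun {g h} hg hh => by
        simp only [mem_ofPred_eq, mul_smul] at *
        exact hg.trans (reflTransGen_treeAdj_smul g hh)
      inv_mem' := fun {g} hg => by
        simp only [mem_ofPred_eq] at *
        simpa using reflTransGen_treeAdj_symm (reflTransGen_treeAdj_smul g⁻¹ hg) }
  refine mem_of_vertexHom_mem_of_stable_mem K (fun u a => ?_) (fun e => ?_) g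
  · have h := reflTransGen_baseVertex hT v u
    refine h.trans ?_
    have h' := reflTransGen_treeAdj_smul (𝒢.vertexHom T u a) (reflTransGen_treeAdj_symm h)
    rwa [vertexHom_smul_baseVertex] at h'
  · exact ((reflTransGen_baseVertex hT v _).tail (treeAdj_stable e)).trans
      (reflTransGen_treeAdj_smul _ (reflTransGen_baseVertex hT _ v))

theorem reflTransGen_treeAdj (hT : 𝒢.IsSpanningTree T) (x y : 𝒢.TreeVertex T) :
    Relation.ReflTransGen TreeAdj x y := by
  have hbase : ∀ v (x : 𝒢.TreeVertex T), Relation.ReflTransGen TreeAdj (𝒢.baseVertex T v) x := by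
    rintro v ⟨u, x⟩
    obtain ⟨g, rfl⟩ := QuotientGroup.mk_surjective x
    rw [← smul_baseVertex]
    exact (reflTransGen_baseVertex hT v u).trans (reflTransGen_smul_baseVertex hT u g)
  exact (reflTransGen_treeAdj_symm (hbase x.1 x)).trans (hbase x.1 y)

theorem finite_treeSep (hT : 𝒢.IsSpanningTree T) (x y : 𝒢.TreeVertex T) :
    (treeSep hT x y).Finite := by
  classical
  induction reflTransGen_treeAdj hT x y with
  | refl =>
    refine Set.finite_empty.subset fun S hS => ?_
    exact absurd rfl (mem_treeSep.1 hS)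
  | tail _ hs ih =>
    obtain ⟨S, i, rfl, rfl⟩ := hs
    refine (ih.union (finite_singleton S)).subset fun S' hS' => ?_
    by_contra hcon
    simp only [mem_union, mem_singleton_iff, not_or, mem_treeSep, not_not] at hcon hS'
    have := congrFun (vertexCochain_treeBd hT S) S'
    rw [Pi.add_apply, Pi.single_eq_of_ne hcon.2, add_zero] at this
    apply hS'
    rw [hcon.1]
    cases i
    exacts [this.symm, this]

end GraphOfGroups

/-! ### The fundamental group as a coarse tree -/

namespace GraphOfGroups

variable {V : Type u} {E : Type v} {𝒢 : GraphOfGroups.{u, v, w} V E} {T : Set E}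

/-- The elements of a coset, for the vertices of the Bass-Serre tree. -/
def vertexCoset (x : 𝒢.TreeVertex T) : Set (𝒢.FundGroup T) :=
  {g | (g : 𝒢.FundGroup T ⧸ 𝒢.vertexSubgroup T x.1) = x.2}

/-- The elements of a coset, for the edges of the Bass-Serre tree. -/
def edgeCoset (S : 𝒢.TreeEdge T) : Set (𝒢.FundGroup T) :=
  {g | (g : 𝒢.FundGroup T ⧸ 𝒢.edgeSubgroup T S.1) = S.2}

theorem eq_mk_of_mem_edgeCoset {S : 𝒢.TreeEdge T} {g : 𝒢.FundGroup T} (hg : g ∈ edgeCoset S) :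
    S = ⟨S.1, (g : 𝒢.FundGroup T ⧸ 𝒢.edgeSubgroup T S.1)⟩ :=
  Sigma.ext rfl (heq_of_eq hg.symm)

theorem out_mem_edgeCoset (S : 𝒢.TreeEdge T) : S.2.out ∈ edgeCoset S :=
  QuotientGroup.out_eq' S.2

theorem mul_mem_edgeCoset (g : 𝒢.FundGroup T) {S : 𝒢.TreeEdge T} {h : 𝒢.FundGroup T}
    (hh : h ∈ edgeCoset S) : g * h ∈ edgeCoset (g • S) := by
  rw [eq_mk_of_mem_edgeCoset hh]
  rfl

theorem setDist_eq_zero_of_mem {A : Set (𝒢.FundGroup T)} {S : Finset (𝒢.FundGroup T)}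
    {g : 𝒢.FundGroup T} (hg : g ∈ A) : setDist (wordDist S) g A = 0 := by
  refine le_antisymm ((setDist_le_of_mem hg).trans ?_) bot_le
  simp [wordDist, wordLength_one]

theorem wordDist_self_mul (S : Finset (𝒢.FundGroup T)) (g h : 𝒢.FundGroup T) :
    wordDist S g (g * h) = (wordLength S h : ℝ≥0∞) := by
  rw [wordDist, inv_mul_cancel_left]

/-- The fundamental group of a finite graph of groups, with its map to the Bass-Serre tree. -/
noncomputable def coarseTree [Finite E] (hT : 𝒢.IsSpanningTree T) {S : Finset (𝒢.FundGroup T)}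
    (hS : Subgroup.closure (S : Set (𝒢.FundGroup T)) = ⊤) (v₀ : V) :
    CoarseTree (wordDist S) (𝒢.TreeVertex T) (𝒢.TreeEdge T) where
  bd := treeBd
  side S x := vertexCochain hT x S = 0
  side_bd S S' := by
    classical
    rw [vertexCochain_treeBd hT, Pi.add_apply]
    by_cases h : S' = S
    · subst h
      have : ∀ a : ZMod 2, ¬ (a = 0 ↔ a + 1 = 0) := by decide
      simp [this]
    · rw [Pi.single_eq_of_ne (Ne.symm h), add_zero]
      simp [h]
  vs := vertexCoset
  es := edgeCoset
  proj g := g • 𝒢.baseVertex T v₀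
  setDist_vs_proj := by
    refine ⟨0, fun x => ?_⟩
    rw [smul_baseVertex, setDist_eq_zero_of_mem]
    · exact bot_le
    · rfl
  setDist_vs_bd := by
    -- Only the terminal endpoint costs anything: `s` reaches its coset after the stable letter, and
    -- there are finitely many stable letters.
    obtain ⟨C, hC⟩ := (finite_range fun e => wordLength S (𝒢.stable T e)).bddAbove
    refine ⟨C, fun S' s hs i => ?_⟩
    rw [eq_mk_of_mem_edgeCoset hs]
    cases i
    · rw [treeBd_false, setDist_eq_zero_of_mem]
      · exact bot_le
      · rfl
    · rw [treeBd_true]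
      have hmem : s * 𝒢.stable T S'.1 ∈
          vertexCoset (⟨𝒢.ter S'.1, (s * 𝒢.stable T S'.1 : 𝒢.FundGroup T)⟩ : 𝒢.TreeVertex T) := rfl
      refine (setDist_le_of_mem hmem).trans ?_
      rw [wordDist_self_mul]
      exact_mod_cast hC (mem_range_self S'.1)
  crossing k := by
    -- By translation one may take `x = 1`. Finitely many elements have length at most `k`, and each
    -- moves the base vertex across finitely many edges; `L` bounds the lengths of representatives
    -- of these edges.
    have hfin : (⋃ g ∈ {g : 𝒢.FundGroup T | wordLength S g ≤ ⌊k⌋₊},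
        treeSep hT (𝒢.baseVertex T v₀) (g • 𝒢.baseVertex T v₀)).Finite :=
      (finite_wordLength_le hS _).biUnion fun g _ => finite_treeSep hT _ _
    obtain ⟨L, hL⟩ := (hfin.image fun S' => wordLength S S'.2.out).bddAbove
    refine ⟨L, fun x y S' hxy hsep => ?_⟩
    have hmem : x⁻¹ • S' ∈ treeSep hT (𝒢.baseVertex T v₀) ((x⁻¹ * y) • 𝒢.baseVertex T v₀) := by
      rw [← smul_mem_treeSep hT x, smul_inv_smul, smul_smul, mul_inv_cancel_left]
      exact hsep
    have h1 := hL (mem_image_of_mem _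
      (mem_biUnion (wordLength_le_of_wordDist_le hxy) hmem))
    have h2 := mul_mem_edgeCoset x (out_mem_edgeCoset (x⁻¹ • S'))
    rw [smul_inv_smul] at h2
    refine (setDist_le_of_mem h2).trans ?_
    rw [wordDist_self_mul]
    exact_mod_cast h1
  encard_separating_le k := by
    obtain ⟨N, hN⟩ := ((finite_wordLength_le hS ⌊k⌋₊).image fun g =>
      (treeSep hT (𝒢.baseVertex T v₀) (g • 𝒢.baseVertex T v₀)).ncard).bddAbove
    refine ⟨N, fun x y hxy => ?_⟩
    have h1 := hN (mem_image_of_mem _ (wordLength_le_of_wordDist_le hxy))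
    change (treeSep hT (x • 𝒢.baseVertex T v₀) (y • 𝒢.baseVertex T v₀)).encard ≤ N
    have : y = x * (x⁻¹ * y) := by group
    rw [this, mul_smul, encard_treeSep_smul, ← (finite_treeSep hT _ _).cast_ncard_eq]
    exact_mod_cast h1
  encard_separating_bd_le := by
    obtain ⟨N, hN⟩ := (finite_range fun p : E × Bool => (treeSep hT (𝒢.baseVertex T v₀)
      (treeBd p.2 ⟨p.1, ((1 : 𝒢.FundGroup T) : 𝒢.FundGroup T ⧸ 𝒢.edgeSubgroup T p.1)⟩)).ncard).bddAbove
    refine ⟨N, fun S' s hs i => ?_⟩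
    have h1 := hN (mem_range_self (S'.1, i))
    have h2 : S' = s •
        ⟨S'.1, ((1 : 𝒢.FundGroup T) : 𝒢.FundGroup T ⧸ 𝒢.edgeSubgroup T S'.1)⟩ := by
      rw [eq_mk_of_mem_edgeCoset hs]
      refine Sigma.ext rfl (heq_of_eq ?_)
      change _ = ((s * 1 : 𝒢.FundGroup T) : 𝒢.FundGroup T ⧸ 𝒢.edgeSubgroup T S'.1)
      rw [mul_one]
    change (treeSep hT (s • 𝒢.baseVertex T v₀) (treeBd i S')).encard ≤ N
    rw [h2, ← smul_treeBd, encard_treeSep_smul, ← (finite_treeSep hT _ _).cast_ncard_eq]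
    exact_mod_cast h1
  joined x y _ := reflTransGen_treeAdj hT _ _

end GraphOfGroups

/-! ### Bounded degree graphs -/

section BoundedDegree

variable {W : Type*} {H : SimpleGraph W}

theorem exists_finset_of_dist_le (hH : H.Connected) {N : ℕ}
    (hN : ∀ x, (H.neighborSet x).encard ≤ N) (n : ℕ) :
    ∃ K : ℕ, ∀ x, ∃ s : Finset W, s.card ≤ K ∧ ∀ y, H.dist x y ≤ n → y ∈ s := by
  classical
  induction n with
  | zero =>
    refine ⟨1, fun x => ⟨{x}, by simp, fun y hy => ?_⟩⟩
    have := (hH.preconnected x y).dist_eq_zero_iff.1 (Nat.le_zero.1 hy)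
    simp [this]
  | succ n ih =>
    obtain ⟨K, hK⟩ := ih
    have hfin : ∀ x, (H.neighborSet x).Finite := fun x => finite_of_encard_le_coe (hN x)
    have hcard : ∀ x, (hfin x).toFinset.card ≤ N := by
      intro x
      have := hN x
      rw [(hfin x).encard_eq_coe_toFinset_card] at this
      exact_mod_cast this
    refine ⟨K * (N + 1), fun x => ?_⟩
    obtain ⟨s, hs, hs'⟩ := hK x
    refine ⟨s.biUnion fun z => insert z (hfin z).toFinset, ?_, fun y hy => ?_⟩
    · refine (Finset.card_biUnion_le_card_mul _ _ (N + 1) fun z _ => ?_).trans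
        (Nat.mul_le_mul_right _ hs)
      exact (Finset.card_insert_le _ _).trans (Nat.add_le_add_right (hcard z) 1)
    · obtain ⟨p, hp⟩ := (hH.preconnected y x).exists_walk_length_eq_dist
      rw [Finset.mem_biUnion]
      cases p with
      | nil => exact ⟨_, hs' _ (by simp), Finset.mem_insert_self _ _⟩
      | @cons _ z _ hyz p =>
        refine ⟨z, hs' z ?_, Finset.mem_insert_of_mem ?_⟩
        · rw [SimpleGraph.dist_comm] at hp hy ⊢
          have := SimpleGraph.dist_le p
          rw [SimpleGraph.Walk.length_cons] at hp
          rw [SimpleGraph.dist_comm] at hp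
          omega
        · simpa using hyz.symm

theorem dist_lipschitz {G : Type*} [Group G] {S : Finset G}
    (hS : Subgroup.closure (S : Set G) = ⊤) (hH : H.Connected) {F : W → G} {l : ℕ}
    (hF : ∀ x y, H.Adj x y → wordLength S ((F x)⁻¹ * F y) ≤ l) (x y : W) :
    wordLength S ((F x)⁻¹ * F y) ≤ l * H.dist x y := by
  obtain ⟨p, hp⟩ := (hH.preconnected x y).exists_walk_length_eq_dist
  rw [← hp]
  clear hp
  induction p with
  | nil => simp [wordLength_one]
  | @cons x z y hxz p ih =>
    have h := wordLength_mul_le hS ((F x)⁻¹ * F z) ((F z)⁻¹ * F y)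
    rw [mul_assoc, mul_inv_cancel_left] at h
    rw [SimpleGraph.Walk.length_cons, mul_add, mul_one]
    have := hF x z hxz
    omega

end BoundedDegree

/-! ### Pulling separating families back to a graph -/

section Pullback

variable {W : Type*} {H : SimpleGraph W} {G : Type*} [Group G] {S : Finset G}

/-- The number of points in a ball of the preimage of a neighbourhood of a coset `A`, in terms of
the relative growth of the subgroup. -/
theorem encard_preimage_nbhd_le (hS : Subgroup.closure (S : Set G) = ⊤) (hH : H.Connected)
    {N : ℕ} (hN : ∀ x, (H.neighborSet x).encard ≤ N) {F : W → G} {l : ℕ}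
    (hF : ∀ x y, H.Adj x y → wordLength S ((F x)⁻¹ * F y) ≤ l)
    (hF' : ∀ m, ∃ R, ∀ x y, wordLength S ((F x)⁻¹ * F y) ≤ m → H.dist x y ≤ R) (L : ℝ≥0) :
    ∃ K L' : ℕ, ∀ (B : Subgroup G) (A : Set G), (∀ a ∈ A, ∀ b ∈ A, a⁻¹ * b ∈ B) →
      ∀ s ∈ F ⁻¹' nbhd (wordDist S) A L, ∀ n : ℕ,
        {y | y ∈ F ⁻¹' nbhd (wordDist S) A L ∧ H.dist s y ≤ n}.encard ≤
          (K * relativeGrowth S B (l * n + L') : ℕ) := by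
  classical
  obtain ⟨m, hm⟩ := exists_nat_gt L
  obtain ⟨R, hR⟩ := hF' (m + m)
  obtain ⟨K, hK⟩ := exists_finset_of_dist_le hH hN R
  -- With `b y ∈ A` chosen within `m` of `F y`, the map `y ↦ (b s)⁻¹ * b y` takes values in `B`, of
  -- length at most `m + l * n + m`. Points of one fibre have images within `m + m`, so they lie in
  -- a ball of radius `R`, which has at most `K` points.
  refine ⟨K, m + m, fun B A hA s hs n => ?_⟩
  have hnear : ∀ y ∈ F ⁻¹' nbhd (wordDist S) A L, ∃ b ∈ A, wordLength S ((F y)⁻¹ * b) ≤ m := by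
    intro y hy
    have h1 : setDist (wordDist S) (F y) A < (m : ℝ≥0) :=
      lt_of_le_of_lt hy (ENNReal.coe_lt_coe.2 hm)
    obtain ⟨b, hb, hlt⟩ := exists_of_setDist_lt h1
    exact ⟨b, hb, wordDist_le_iff.1 hlt.le⟩
  choose! b hbA hb using hnear
  have hb' : ∀ y ∈ F ⁻¹' nbhd (wordDist S) A L, wordLength S ((b y)⁻¹ * F y) ≤ m := by
    intro y hy
    refine le_trans ?_ (hb y hy)
    have := wordLength_inv_le hS ((F y)⁻¹ * b y)
    simpa using this
  have htri : ∀ x y z : G, wordLength S (x⁻¹ * z) ≤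
      wordLength S (x⁻¹ * y) + wordLength S (y⁻¹ * z) := by
    intro x y z
    have h := wordLength_mul_le hS (x⁻¹ * y) (y⁻¹ * z)
    rwa [mul_assoc, mul_inv_cancel_left] at h
  set P := {y | y ∈ F ⁻¹' nbhd (wordDist S) A L ∧ H.dist s y ≤ n} with hP
  obtain ⟨_, hKn⟩ := exists_finset_of_dist_le hH hN n
  obtain ⟨t, -, ht⟩ := hKn s
  have hPfin : P.Finite := t.finite_toSet.subset fun y hy => ht y hy.2
  rw [hPfin.encard_eq_coe_toFinset_card]
  norm_cast
  refine (Finset.card_le_mul_card_image (f := fun y => (b s)⁻¹ * b y) hPfin.toFinset K ?_).trans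
    (Nat.mul_le_mul_left _ ?_)
  · intro c hc
    obtain ⟨y, hy, rfl⟩ := Finset.mem_image.1 hc
    rw [Finite.mem_toFinset] at hy
    obtain ⟨t, ht, ht'⟩ := hK y
    refine (Finset.card_le_card fun z hz => ht' z (hR y z ?_)).trans ht
    rw [Finset.mem_filter, Finite.mem_toFinset] at hz
    have hbz : b z = b y := mul_left_cancel hz.2
    refine (htri _ (b y) _).trans (add_le_add (hb y hy.1) ?_)
    rw [← hbz]
    exact hb' z hz.1.1
  · rw [relativeGrowth, ← ncard_coe_finset]
    refine ncard_le_ncard ?_ ((finite_wordLength_le hS _).subset fun h hh => hh.2)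
    rintro _ hc
    obtain ⟨y, hy, rfl⟩ := Finset.mem_image.1 (Finset.mem_coe.1 hc)
    rw [Finite.mem_toFinset] at hy
    refine ⟨hA _ (hbA s hs) _ (hbA y hy.1), ?_⟩
    have h1 := htri (b s) (F s) (b y)
    have h2 := htri (F s) (F y) (b y)
    have h3 := hb' s hs
    have h4 := hb y hy.1
    have h5 := (dist_lipschitz hS hH hF s y).trans (Nat.mul_le_mul_left l hy.2)
    omega

/-- The coarse separation of the image of a graph pulls back to the graph. -/
theorem coarselySeparates_preimage (hH : H.Connected) {F : W → G} {ρ : ℕ → ℕ}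
    (hρ : ∀ x y n, H.dist x y ≤ n → wordLength S ((F x)⁻¹ * F y) ≤ ρ n)
    (hS : Subgroup.closure (S : Set G) = ⊤) {𝒮 : Set (Set G)} {k L : ℝ≥0} (hk : (ρ 1 : ℝ≥0) ≤ k)
    (hsep : ∀ D : ℝ≥0, ∃ A ∈ 𝒮, ∃ a ∈ range F \ nbhd (wordDist S) A L,
      ∃ b ∈ range F \ nbhd (wordDist S) A L,
      (D : ℝ≥0∞) ≤ setDist (wordDist S) a A ∧ (D : ℝ≥0∞) ≤ setDist (wordDist S) b A ∧
        ¬ KJoinedIn (wordDist S) k (range F \ nbhd (wordDist S) A L) a b) :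
    CoarselySeparates (graphDist H) ((fun A => F ⁻¹' nbhd (wordDist S) A L) '' 𝒮) univ := by
  have hzero : ∀ (x : W) (B : Set W), x ∈ nbhd (graphDist H) B 0 → x ∈ B := by
    intro x B hx
    have h1 : setDist (graphDist H) x B < 1 := lt_of_le_of_lt hx (by simp)
    obtain ⟨b, hb, hlt⟩ := exists_of_setDist_lt h1
    have h2 : H.dist x b = 0 := by
      rw [graphDist] at hlt
      have : H.dist x b < 1 := by exact_mod_cast hlt
      omega
    rwa [(hH.preconnected x b).dist_eq_zero_iff.1 h2]
  -- The sets are already preimages of `L`-neighbourhoods, so no thickening is needed in the graph,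
  -- where a `0`-neighbourhood adds nothing.
  refine ⟨1, 0, ?_, fun D => ?_⟩
  · intro x _ y _
    refine ⟨trivial, trivial, ?_⟩
    obtain ⟨p⟩ := hH.preconnected x y
    induction p with
    | nil => exact Relation.ReflTransGen.refl
    | cons h p ih =>
      refine Relation.ReflTransGen.head ⟨trivial, trivial, ?_⟩ (ih trivial trivial)
      rw [graphDist, SimpleGraph.dist_eq_one_iff_adj.2 h]
      simp
  · obtain ⟨A, hA, _, ⟨⟨a, rfl⟩, ha⟩, _, ⟨⟨b, rfl⟩, hb⟩, had, hbd, hab⟩ :=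
      -- A vertex at distance less than `D` from the preimage would have its image within `ρ ⌈D⌉₊ +
      -- L` of `A`.
      hsep (ρ ⌈D⌉₊ + L + 1)
    have hfar : ∀ a, ((ρ ⌈D⌉₊ + L + 1 : ℝ≥0) : ℝ≥0∞) ≤ setDist (wordDist S) (F a) A →
        (D : ℝ≥0∞) ≤ setDist (graphDist H) a (F ⁻¹' nbhd (wordDist S) A L) := by
      intro a ha
      refine le_setDist fun y hy => ?_
      by_contra! hlt
      have h1 : H.dist a y ≤ ⌈D⌉₊ := by
        rw [graphDist] at hlt
        have : (H.dist a y : ℝ≥0) < D := by exact_mod_cast hlt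
        exact_mod_cast this.le.trans (Nat.le_ceil D)
      have h2 := setDist_le_add (wordDist_triangle hS) (F a) (F y) A
      have h3 : wordDist S (F a) (F y) ≤ (ρ ⌈D⌉₊ : ℝ≥0) := wordDist_le_iff.2 (hρ _ _ _ h1)
      have h4 := ha.trans (h2.trans (add_le_add h3 hy))
      rw [← ENNReal.coe_add, ENNReal.coe_le_coe] at h4
      exact absurd h4 (not_le.2 (lt_add_one _))
    refine ⟨_, ⟨A, hA, rfl⟩, a, ⟨trivial, fun h => ha (hzero _ _ h)⟩, b,
      ⟨trivial, fun h => hb (hzero _ _ h)⟩, hfar a had, hfar b hbd, ?_⟩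
    rintro ⟨-, -, hj⟩
    refine hab ⟨⟨⟨a, rfl⟩, ha⟩, ⟨⟨b, rfl⟩, hb⟩, ?_⟩
    have hsub : ∀ x, x ∈ univ \ nbhd (graphDist H) (F ⁻¹' nbhd (wordDist S) A L) 0 →
        F x ∈ range F \ nbhd (wordDist S) A L := by
      rintro x ⟨-, hx⟩
      refine ⟨⟨x, rfl⟩, fun h => hx ?_⟩
      refine (setDist_le_of_mem (a := x) h).trans ?_
      simp [graphDist]
    refine hj.lift F fun x y hxy => ⟨hsub x hxy.1, hsub y hxy.2.1, ?_⟩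
    have h1 : H.dist x y ≤ 1 := by
      have := hxy.2.2
      rw [graphDist] at this
      exact_mod_cast this
    refine (wordDist_le_iff.2 (hρ _ _ _ h1)).trans ?_
    exact ENNReal.coe_le_coe.2 hk

end Pullback

/-! ### Coarse embeddings and growth bounds for cosets -/

section CoarseEmbedding

variable {Z : Type*} [MetricSpace Z] {W : Type*} {H : SimpleGraph W} {G : Type*} [Group G]
  {S : Finset G}

/-- Extracts what the graph argument needs from `f ∘ φ`: a bound on edges, from `ρ₂` at `l + c`;
properness, because `ρ₁` is unbounded; and coarse density of its image in that of `f`. -/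
theorem IsCoarseEmbedding.comp_graph {f : Z → G} (hf : IsCoarseEmbedding (wordDist S) f)
    {φ : W → Z} (hφ : IsGraphQuasiIsometry H φ) :
    (∃ l : ℕ, ∀ x y, H.Adj x y → wordLength S ((f (φ x))⁻¹ * f (φ y)) ≤ l) ∧
    (∀ m, ∃ R, ∀ x y, wordLength S ((f (φ x))⁻¹ * f (φ y)) ≤ m → H.dist x y ≤ R) ∧
    ∃ r : ℝ≥0, ∀ z, ∃ x, wordDist S (f z) (f (φ x)) ≤ r := by
  obtain ⟨ρ₁, ρ₂, hm₁, hm₂, ht, hρ⟩ := hf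
  obtain ⟨l, c, hl, hc, hd, hs⟩ := hφ
  have hup : ∀ (x y : Z) (r : ℝ≥0), dist x y ≤ r → wordDist S (f x) (f y) ≤ ρ₂ r := by
    intro x y r h
    refine (hρ x y).2.trans (ENNReal.coe_le_coe.2 (hm₂ ?_))
    rw [← NNReal.coe_le_coe, coe_nndist]
    exact h
  refine ⟨⟨⌊ρ₂ (l + c).toNNReal⌋₊, fun x y hxy => ?_⟩, fun m => ?_, ρ₂ c.toNNReal, fun z => ?_⟩
  · refine wordLength_le_of_wordDist_le (hup _ _ _ ?_)
    rw [Real.coe_toNNReal _ (by linarith)]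
    have := (hd x y).2
    rwa [SimpleGraph.dist_eq_one_iff_adj.2 hxy, Nat.cast_one, mul_one] at this
  · obtain ⟨t, ht⟩ := (ht.eventually (eventually_gt_atTop (m : ℝ≥0))).exists_forall_of_atTop
    refine ⟨⌈l * (t + c)⌉₊, fun x y hxy => ?_⟩
    have h1 : (ρ₁ (nndist (φ x) (φ y)) : ℝ≥0∞) ≤ (m : ℝ≥0) :=
      (hρ _ _).1.trans (wordDist_le_iff.2 hxy)
    rw [ENNReal.coe_le_coe] at h1
    have h2 : nndist (φ x) (φ y) ≤ t := by
      by_contra! h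
      exact absurd (ht _ h.le) (not_lt.2 h1)
    rw [← NNReal.coe_le_coe, coe_nndist] at h2
    have h3 := (hd x y).1
    have h4 : (H.dist x y : ℝ) ≤ l * (t + c) := by
      have hl0 : 0 < l := by linarith
      have h5 : l⁻¹ * (H.dist x y : ℝ) ≤ t + c := by linarith
      rwa [inv_mul_le_iff₀ hl0] at h5
    exact_mod_cast h4.trans (Nat.le_ceil _)
  · obtain ⟨x, hx⟩ := hs z
    refine ⟨x, hup _ _ _ ?_⟩
    rwa [Real.coe_toNNReal _ hc]

end CoarseEmbedding

namespace GraphOfGroups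

variable {V : Type u} {E : Type v} {𝒢 : GraphOfGroups.{u, v, w} V E} {T : Set E}

theorem vertexCoset_eq (x : 𝒢.TreeVertex T) :
    vertexCoset x = (fun h => x.2.out * h) '' (𝒢.vertexSubgroup T x.1 : Set (𝒢.FundGroup T)) := by
  ext g
  constructor
  · intro hg
    refine ⟨x.2.out⁻¹ * g, ?_, by simp⟩
    rw [SetLike.mem_coe, ← QuotientGroup.eq, QuotientGroup.out_eq']
    exact hg.symm
  · rintro ⟨h, hh, rfl⟩
    rw [vertexCoset, mem_ofPred_eq]
    conv_rhs => rw [← QuotientGroup.out_eq' x.2]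
    rw [eq_comm, QuotientGroup.eq, inv_mul_cancel_left]
    exact hh

/-- The image of a graph with large separating sets lies in a neighbourhood of a coset of a
vertex-group, unless the growth of the separating sets is bounded by the relative growth of the
edge-groups. -/
theorem subset_coset_or_growth_le [Fintype E] (hT : 𝒢.IsSpanningTree T)
    {S : Finset (𝒢.FundGroup T)} (hS : Subgroup.closure (S : Set (𝒢.FundGroup T)) = ⊤)
    {W : Type*} {H : SimpleGraph W} {g : ℝ → ℝ} (hH : GraphSeparationGrowth g H)
    {F : W → 𝒢.FundGroup T} {l : ℕ}
    (hF : ∀ x y, H.Adj x y → wordLength S ((F x)⁻¹ * F y) ≤ l)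
    (hF' : ∀ m, ∃ R, ∀ x y, wordLength S ((F x)⁻¹ * F y) ≤ m → H.dist x y ≤ R) :
    (∃ (v : V) (g : 𝒢.FundGroup T) (R : ℝ≥0), range F ⊆
      nbhd (wordDist S) ((fun h => g * h) '' (𝒢.vertexSubgroup T v : Set _)) R) ∨
    ∃ C : ℝ, 0 < C ∧ ∃ K L : ℕ, ∀ n : ℕ, C * g (C * n + C) + C ≤
      K * ∑ e, (relativeGrowth S (𝒢.edgeSubgroup T e) (l * n + L) : ℝ) := by
  obtain ⟨hconn, ⟨N, hN⟩, hgrowth⟩ := hH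
  obtain ⟨v₀⟩ := 𝒢.nonempty
  obtain ⟨x₀⟩ := hconn.nonempty
  have hk : IsKConnected (wordDist S) (l : ℝ≥0) (range F) := by
    rintro _ ⟨x, rfl⟩ _ ⟨y, rfl⟩
    refine ⟨⟨x, rfl⟩, ⟨y, rfl⟩, ?_⟩
    obtain ⟨p⟩ := hconn.preconnected x y
    induction p with
    | nil => exact Relation.ReflTransGen.refl
    | cons h p ih =>
      exact Relation.ReflTransGen.head ⟨⟨_, rfl⟩, ⟨_, rfl⟩, wordDist_le_iff.2 (hF _ _ h)⟩ ih
  rcases (coarseTree hT hS v₀).subset_nbhd_or_separates (wordDist_triangle hS) hk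
    (mem_range_self x₀) with ⟨x, R, h⟩ | ⟨L, hL⟩
  · left
    refine ⟨x.1, x.2.out, R, ?_⟩
    rw [← vertexCoset_eq]
    exact h
  · right
    have hsep := coarselySeparates_preimage hconn (ρ := fun n => l * n) (F := F)
      (fun x y n hxy => (dist_lipschitz hS hconn hF x y).trans (Nat.mul_le_mul_left l hxy)) hS
      (𝒮 := range (edgeCoset : 𝒢.TreeEdge T → _)) (k := l) (L := L) (by simp) (by
        intro D
        obtain ⟨S', h⟩ := hL D
        exact ⟨_, ⟨S', rfl⟩, h⟩)
    obtain ⟨C, hC, hgr⟩ := hgrowth _ hsep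
    obtain ⟨K, L', hK⟩ := encard_preimage_nbhd_le hS hconn hN hF hF' L
    refine ⟨C, hC, K, L', fun n => ?_⟩
    have h1 := hgr n
    -- The family mixes cosets of all edge-groups; the sum over the finitely many edges bounds each
    -- of them.
    have h2 : volumeGrowth (graphDist H) ((fun A => F ⁻¹' nbhd (wordDist S) A L) ''
        range (edgeCoset : 𝒢.TreeEdge T → _)) n ≤
        ((K * ∑ e, relativeGrowth S (𝒢.edgeSubgroup T e) (l * n + L') : ℕ) : ℕ∞) := by
      refine iSup₂_le ?_
      rintro _ ⟨_, ⟨S', rfl⟩, rfl⟩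
      refine iSup₂_le fun s hs => ?_
      have h3 := hK (𝒢.edgeSubgroup T S'.1) (edgeCoset S') (fun a ha b hb => by
        rw [← QuotientGroup.eq]
        exact ha.trans hb.symm) s hs n
      have h4 : {y | y ∈ F ⁻¹' nbhd (wordDist S) (edgeCoset S') L ∧
          graphDist H s y ≤ ((n : ℝ≥0) : ℝ≥0∞)} ⊆
          {y | y ∈ F ⁻¹' nbhd (wordDist S) (edgeCoset S') L ∧ H.dist s y ≤ n} := by
        rintro y ⟨hy, hy'⟩
        refine ⟨hy, ?_⟩
        rw [graphDist] at hy'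
        exact_mod_cast hy'
      refine (encard_le_encard h4).trans (h3.trans ?_)
      · norm_cast
        exact Nat.mul_le_mul_left K (Finset.single_le_sum (f := fun e =>
          relativeGrowth S (𝒢.edgeSubgroup T e) (l * n + L')) (fun _ _ => Nat.zero_le _)
          (Finset.mem_univ S'.1))
    have h4 := h1.trans (ENat.toENNReal_le.2 h2)
    rw [ENat.toENNReal_coe, ENNReal.ofReal_le_natCast] at h4
    exact_mod_cast h4

/-- The growth gap `hg` is required for all constants, because those produced by the pullback are
out of control; failure at a single `n` suffices. -/
theorem subset_coset_of_not_growth_le [Fintype E] (hT : 𝒢.IsSpanningTree T)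
    {S : Finset (𝒢.FundGroup T)} (hS : Subgroup.closure (S : Set (𝒢.FundGroup T)) = ⊤)
    {W Z : Type*} [MetricSpace Z] {H : SimpleGraph W} {g : ℝ → ℝ}
    (hH : GraphSeparationGrowth g H) {φ : W → Z} (hφ : IsGraphQuasiIsometry H φ)
    {f : Z → 𝒢.FundGroup T} (hf : IsCoarseEmbedding (wordDist S) f)
    (hg : ∀ C : ℝ, 0 < C → ∀ K l L : ℕ, 0 < l → ∃ n : ℕ,
      K * ∑ e, (relativeGrowth S (𝒢.edgeSubgroup T e) (l * n + L) : ℝ) < C * g (C * n + C) + C) :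
    ∃ (v : V) (g : 𝒢.FundGroup T) (R : ℝ≥0), range f ⊆
      nbhd (wordDist S) ((fun h => g * h) '' (𝒢.vertexSubgroup T v : Set _)) R := by
  obtain ⟨⟨l, hl⟩, hm, r, hr⟩ := hf.comp_graph hφ
  -- The Lipschitz constant is enlarged to `l + 1`, since `hg` asks for a positive one.
  rcases subset_coset_or_growth_le hT hS hH (F := f ∘ φ)
      (fun x y h => (hl x y h).trans l.le_succ) hm with
    ⟨v, g, R, h⟩ | ⟨C, hC, K, L, h⟩
  · refine ⟨v, g, r + R, ?_⟩
    rintro _ ⟨z, rfl⟩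
    obtain ⟨x, hx⟩ := hr z
    have h1 := h (mem_range_self x)
    refine (setDist_le_add (wordDist_triangle hS) (f z) (f (φ x)) _).trans ?_
    rw [ENNReal.coe_add]
    exact add_le_add hx h1
  · obtain ⟨n, hn⟩ := hg C hC K (l + 1) L l.succ_pos
    exact absurd (h n) (not_le.2 hn)

end GraphOfGroups

/-! ### Comparison of growth rates -/

section Growth

variable {G : Type*} [Group G] {S : Finset G} {E : Type*} [Fintype E] {B : E → Subgroup G}

theorem exists_sum_relativeGrowth_lt_exp (hB : ∀ e, HasSubexpRelativeGrowth S (B e)) {C : ℝ}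
    (hC : 0 < C) (K l L : ℕ) (hl : 0 < l) :
    ∃ n : ℕ, K * ∑ e, (relativeGrowth S (B e) (l * n + L) : ℝ) < C * Real.exp (C * n + C) + C := by
  have hl' : (0 : ℝ) < l := by exact_mod_cast hl
  -- At `l * n + L`, a growth rate `ε` gives a constant times `exp (C / 2 * n)`, only half of the
  -- exponent `C * n`; the other half absorbs the constant `Q`.
  set ε : ℝ := C / (2 * l) with hε
  have hε0 : 0 < ε := by positivity
  have hεl : ε * l = C / 2 := by rw [hε]; field_simp
  have h1 : ∀ᶠ m : ℕ in atTop, ∀ e, (relativeGrowth S (B e) m : ℝ) ≤ Real.exp (ε * m) := by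
    rw [eventually_all]
    intro e
    filter_upwards [(hB e).eventually (gt_mem_nhds hε0), eventually_gt_atTop 0] with m hm hm0
    have hm' : (0 : ℝ) < m := by exact_mod_cast hm0
    rw [div_lt_iff₀ hm'] at hm
    exact (Real.le_exp_log _).trans (Real.exp_le_exp.2 hm.le)
  obtain ⟨m₀, hm₀⟩ := h1.exists_forall_of_atTop
  set Q : ℝ := K * (Fintype.card E * Real.exp (ε * L)) with hQ
  have h2 : ∀ᶠ n : ℕ in atTop, Q < C * Real.exp (C / 2 * n) := by
    have : Tendsto (fun n : ℕ => C * Real.exp (C / 2 * n)) atTop atTop := by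
      refine Tendsto.const_mul_atTop hC (Real.tendsto_exp_atTop.comp ?_)
      exact Tendsto.const_mul_atTop (by positivity) tendsto_natCast_atTop_atTop
    exact this.eventually (eventually_gt_atTop Q)
  obtain ⟨n, hnQ, hn⟩ := (h2.and (eventually_ge_atTop m₀)).exists
  refine ⟨n, ?_⟩
  have h3 : m₀ ≤ l * n + L := hn.trans ((Nat.le_mul_of_pos_left n hl).trans (Nat.le_add_right _ _))
  have h4 : ∑ e, (relativeGrowth S (B e) (l * n + L) : ℝ) ≤
      Fintype.card E * (Real.exp (ε * L) * Real.exp (C / 2 * n)) := by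
    refine (Finset.sum_le_card_nsmul _ _ _ fun e _ => hm₀ _ h3 e).trans (le_of_eq ?_)
    rw [nsmul_eq_mul, Finset.card_univ, ← Real.exp_add, ← hεl]
    congr 2
    push_cast
    ring
  calc _ ≤ K * (Fintype.card E * (Real.exp (ε * L) * Real.exp (C / 2 * n))) :=
        mul_le_mul_of_nonneg_left h4 (Nat.cast_nonneg K)
    _ = Q * Real.exp (C / 2 * n) := by rw [hQ]; ring
    _ ≤ C * Real.exp (C / 2 * n) * Real.exp (C / 2 * n) :=
        mul_le_mul_of_nonneg_right hnQ.le (Real.exp_pos _).le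
    _ = C * Real.exp (C * n) := by rw [mul_assoc, ← Real.exp_add]; ring_nf
    _ ≤ C * Real.exp (C * n + C) :=
        mul_le_mul_of_nonneg_left (Real.exp_le_exp.2 (by linarith)) hC.le
    _ < _ := by linarith

theorem exists_sum_relativeGrowth_lt_rpow {d : ℝ} (hd : 0 ≤ d)
    (hB : ∀ e, HasRelativeGrowthAtMost d S (B e)) {C : ℝ} (hC : 0 < C) (K l L : ℕ)
    (hl : 0 < l) :
    ∃ n : ℕ, K * ∑ e, (relativeGrowth S (B e) (l * n + L) : ℝ) <
      C * (C * n + C) ^ (d + 1) + C := by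
  choose c hc using hB
  have hl' : (0 : ℝ) < l := by exact_mod_cast hl
  set Q : ℝ := K * ((∑ e, |c e|) * ((l : ℝ) + L) ^ d) with hQ
  have hC' : 0 < C * C ^ (d + 1) := by positivity
  -- The sum is at most `Q * n ^ d` once `n ≥ 1` allows `L ≤ L * n`, and the other side exceeds `C *
  -- C ^ (d + 1) * n ^ (d + 1)`.
  obtain ⟨n, hn⟩ := exists_nat_gt (max 1 (Q / (C * C ^ (d + 1))))
  have hn1 : (1 : ℝ) ≤ n := (le_max_left _ _).trans hn.le
  have hn0 : (0 : ℝ) < n := by linarith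
  have hnQ : Q ≤ C * C ^ (d + 1) * n := by
    have := (le_max_right _ _).trans hn.le
    rwa [div_le_iff₀' hC'] at this
  refine ⟨n, ?_⟩
  have hm1 : 1 ≤ l * n + L := by
    have : 1 ≤ n := by exact_mod_cast hn1
    nlinarith
  have hm : ((l * n + L : ℕ) : ℝ) ≤ ((l : ℝ) + L) * n := by
    push_cast
    have : (L : ℝ) ≤ L * n := le_mul_of_one_le_right (Nat.cast_nonneg L) hn1
    linarith
  have h4 : ∑ e, (relativeGrowth S (B e) (l * n + L) : ℝ) ≤
      (∑ e, |c e|) * (((l : ℝ) + L) ^ d * (n : ℝ) ^ d) := by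
    rw [Finset.sum_mul]
    refine Finset.sum_le_sum fun e _ => (hc e _ hm1).trans ?_
    rw [← Real.mul_rpow (by positivity) hn0.le]
    exact mul_le_mul (le_abs_self _) (Real.rpow_le_rpow (Nat.cast_nonneg _) hm hd)
      (by positivity) (abs_nonneg _)
  calc _ ≤ K * ((∑ e, |c e|) * (((l : ℝ) + L) ^ d * (n : ℝ) ^ d)) :=
        mul_le_mul_of_nonneg_left h4 (Nat.cast_nonneg K)
    _ = Q * (n : ℝ) ^ d := by rw [hQ]; ring
    _ ≤ C * C ^ (d + 1) * n * (n : ℝ) ^ d :=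
        mul_le_mul_of_nonneg_right hnQ (by positivity)
    _ = C * (C * n) ^ (d + 1) := by
        rw [Real.mul_rpow hC.le hn0.le, Real.rpow_add_one hn0.ne']; ring
    _ ≤ C * (C * n + C) ^ (d + 1) :=
        mul_le_mul_of_nonneg_left (Real.rpow_le_rpow (by positivity) (by linarith) (by linarith))
          hC.le
    _ < _ := by linarith

end Growth

/-! ### Lifting circle-valued functions -/

section Potential

instance unitInterval.locallyPathConnectedSpace : LocallyPathConnectedSpace unitInterval := by
  have h : IsQuotientMap (projIcc (0 : ℝ) 1 zero_le_one) :=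
    IsQuotientMap.of_inverse continuous_subtype_val continuous_projIcc
      (fun x => projIcc_val zero_le_one x)
  exact h.locallyPathConnectedSpace

/-- On a simply connected space, a circle-valued function that is continuous along squares has a
real-valued lift which is compatible with the lifts along paths. -/
theorem exists_potential {X : Type*} [TopologicalSpace X] [SimplyConnectedSpace X]
    (c : X → AddCircle (1 : ℝ))
    (hc : ∀ H : C(unitInterval × unitInterval, X), Continuous fun p => c (H p)) :
    ∃ h : X → ℝ, (∀ x, (h x : AddCircle (1 : ℝ)) = c x) ∧
      ∀ (γ : C(unitInterval, X)) (ℓ : C(unitInterval, ℝ)),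
        (∀ t, (ℓ t : AddCircle (1 : ℝ)) = c (γ t)) → h (γ 1) - h (γ 0) = ℓ 1 - ℓ 0 := by
  have cov := AddCircle.isCoveringMap_coe (1 : ℝ)
  have hc' : ∀ γ : C(unitInterval, X), Continuous fun t => c (γ t) := by
    intro γ
    have h1 := hc (γ.comp ⟨Prod.fst, continuous_fst⟩)
    exact h1.comp (Continuous.prodMk_left (0 : unitInterval))
  obtain ⟨x₀⟩ : Nonempty X := inferInstance
  obtain ⟨r₀, hr₀⟩ := QuotientAddGroup.mk_surjective (c x₀)
  have hlift : ∀ x, ∃ ℓ : C(unitInterval, ℝ),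
      (∀ t, (ℓ t : AddCircle (1 : ℝ)) = c (PathConnectedSpace.somePath x₀ x t)) ∧ ℓ 0 = r₀ := by
    intro x
    let γ : C(unitInterval, AddCircle (1 : ℝ)) :=
      ⟨fun t => c (PathConnectedSpace.somePath x₀ x t),
        hc' (PathConnectedSpace.somePath x₀ x).toContinuousMap⟩
    have h0 : γ 0 = (r₀ : AddCircle (1 : ℝ)) := by
      change c (PathConnectedSpace.somePath x₀ x 0) = _
      rw [Path.source]
      exact hr₀.symm
    obtain ⟨Γ, hΓ, hΓ0⟩ := cov.exists_path_lifts γ r₀ h0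
    exact ⟨Γ, fun t => congrFun hΓ t, hΓ0⟩
  choose lift hl hl0 using hlift
  refine ⟨fun x => lift x 1, fun x => ?_, fun γ ℓ hℓ => ?_⟩
  · rw [hl, Path.target]
  let p : Path x₀ (γ 0) := PathConnectedSpace.somePath x₀ (γ 0)
  let p' : Path x₀ (γ 1) := PathConnectedSpace.somePath x₀ (γ 1)
  let δ : Path (γ 0) (γ 1) := ⟨γ, rfl, rfl⟩
  -- Simple connectedness: the chosen path to `γ 0` followed by `γ` is homotopic to the chosen path
  -- to `γ 1`, so the lifts of their images under `c` end at the same point.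
  obtain ⟨F⟩ : (p.trans δ).Homotopic p' := SimplyConnectedSpace.paths_homotopic _ _
  let ζ₀ : C(unitInterval, AddCircle (1 : ℝ)) := ⟨fun t => c ((p.trans δ) t),
    hc' (p.trans δ).toContinuousMap⟩
  let ζ₁ : C(unitInterval, AddCircle (1 : ℝ)) := ⟨fun t => c (p' t), hc' p'.toContinuousMap⟩
  have hhom : ζ₀.HomotopicRel ζ₁ {0, 1} := by
    refine ⟨⟨⟨⟨fun s => c (F s), hc ⟨F, F.continuous⟩⟩, fun t => ?_, fun t => ?_⟩, ?_⟩⟩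
    · exact congrArg c (F.apply_zero t)
    · exact congrArg c (F.apply_one t)
    · intro t x hx
      exact congrArg c (F.eq_fst t hx)
  have h0 : ζ₀ 0 = (r₀ : AddCircle (1 : ℝ)) := by
    change c ((p.trans δ) 0) = _
    rw [Path.source]; exact hr₀.symm
  have h1 : ζ₁ 0 = (r₀ : AddCircle (1 : ℝ)) := by
    change c (p' 0) = _
    rw [Path.source]; exact hr₀.symm
  have hend := cov.liftPath_apply_one_eq_of_homotopicRel hhom r₀ h0 h1
  have e1 : lift (γ 1) = cov.liftPath ζ₁ r₀ h1 :=
    (cov.eq_liftPath_iff' h1).2 ⟨funext fun t => hl (γ 1) t, hl0 _⟩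
  let m₁ : Path r₀ (lift (γ 0) 1) := ⟨lift (γ 0), hl0 _, rfl⟩
  -- `ℓ` shifted by an integer, so as to start where the lift to `γ 0` ends.
  let m₂ : Path (lift (γ 0) 1) (ℓ 1 + (lift (γ 0) 1 - ℓ 0)) :=
    ⟨⟨fun t => ℓ t + (lift (γ 0) 1 - ℓ 0), by fun_prop⟩, by simp, rfl⟩
  have hdiff : ((lift (γ 0) 1 - ℓ 0 : ℝ) : AddCircle (1 : ℝ)) = 0 := by
    rw [AddCircle.coe_sub, hl, hℓ, Path.target, sub_self]
  have e2 : (m₁.trans m₂).toContinuousMap = cov.liftPath ζ₀ r₀ h0 := by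
    refine (cov.eq_liftPath_iff' h0).2 ⟨funext fun t => ?_, Path.source _⟩
    change (((m₁.trans m₂) t : ℝ) : AddCircle (1 : ℝ)) = c ((p.trans δ) t)
    rw [Path.trans_apply, Path.trans_apply]
    split_ifs with ht
    · exact hl (γ 0) _
    · change ((ℓ _ + (lift (γ 0) 1 - ℓ 0) : ℝ) : AddCircle (1 : ℝ)) = _
      rw [AddCircle.coe_add, hdiff, add_zero]
      exact hℓ _
  rw [← e1, ← e2] at hend
  have : (m₁.trans m₂).toContinuousMap 1 = ℓ 1 + (lift (γ 0) 1 - ℓ 0) := Path.target _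
  rw [this] at hend
  change lift (γ 1) 1 - lift (γ 0) 1 = _
  rw [← hend]
  ring

end Potential

/-! ### Coordinates on a graph of spaces -/

namespace GraphOfSpaces

variable {V : Type u} {E : Type v} {𝒢 : GraphOfGroups.{u, v, w} V E} (𝒳 : GraphOfSpaces 𝒢)

theorem edgeMap_zero (e : E) (a : Realization (𝒳.KE e)) :
    𝒳.edgeMap e (a, 0) = 𝒳.vertexMap (𝒢.ori e) ((𝒳.f₀ e).realize a) :=
  Quot.sound (Glue.ori e a)

theorem edgeMap_one (e : E) (a : Realization (𝒳.KE e)) :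
    𝒳.edgeMap e (a, 1) = 𝒳.vertexMap (𝒢.ter e) ((𝒳.f₁ e).realize a) :=
  Quot.sound (Glue.ter e a)

/-- The quotient map onto the graph of spaces. -/
def toTotal (p : 𝒳.Pieces) : 𝒳.Total := Quot.mk _ p

theorem isQuotientMap_toTotal : IsQuotientMap 𝒳.toTotal :=
  isQuotientMap_quot_mk

theorem continuous_edgeMap (e : E) : Continuous (𝒳.edgeMap e) :=
  continuous_quot_mk.comp (continuous_inr.comp continuous_sigmaMk)

/-- The coordinate of a point along its edge, modulo one. -/
noncomputable def height : 𝒳.Total → AddCircle (1 : ℝ) :=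
  Quot.lift (Sum.elim (fun _ => 0) fun p => ((p.2.2 : ℝ) : AddCircle (1 : ℝ))) (by
    rintro _ _ (⟨e, x⟩ | ⟨e, x⟩)
    · simp
    · simp [AddCircle.coe_period])

theorem continuous_height : Continuous 𝒳.height := by
  refine continuous_quot_lift _ (continuous_const.sumElim ?_)
  refine continuous_sigma fun e => ?_
  exact (AddCircle.continuous_mk' 1).comp (continuous_subtype_val.comp continuous_snd)

theorem height_edgeMap (e : E) (p : Realization (𝒳.KE e) × unitInterval) :
    𝒳.height (𝒳.edgeMap e p) = ((p.2 : ℝ) : AddCircle (1 : ℝ)) := rfl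

theorem height_vertexMap (v : V) (a : Realization (𝒳.KV v)) : 𝒳.height (𝒳.vertexMap v a) = 0 := rfl

open Classical in
/-- The vertex of a point of a vertex-space, or the edge and the coordinates of a point in the
interior of an edge. -/
noncomputable def code : 𝒳.Total → V ⊕ (Σ e, Realization (𝒳.KE e) × unitInterval) :=
  Quot.lift (Sum.elim (fun p => Sum.inl p.1) fun p =>
    if p.2.2 = 0 then Sum.inl (𝒢.ori p.1) else
      if p.2.2 = 1 then Sum.inl (𝒢.ter p.1) else Sum.inr p) (by
    rintro _ _ (⟨e, x⟩ | ⟨e, x⟩) <;> simp)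

theorem code_vertexMap (v : V) (a : Realization (𝒳.KV v)) :
    𝒳.code (𝒳.vertexMap v a) = Sum.inl v := rfl

theorem code_edgeMap {e : E} {p : Realization (𝒳.KE e) × unitInterval} (h0 : p.2 ≠ 0)
    (h1 : p.2 ≠ 1) : 𝒳.code (𝒳.edgeMap e p) = Sum.inr ⟨e, p⟩ := by
  change (if p.2 = 0 then _ else if p.2 = 1 then _ else _) = _
  rw [if_neg h0, if_neg h1]

theorem code_cases (y : 𝒳.Total) : (∃ v a, y = 𝒳.vertexMap v a) ∨
    ∃ e p, p.2 ≠ 0 ∧ p.2 ≠ 1 ∧ y = 𝒳.edgeMap e p := by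
  induction y using Quot.ind with
  | mk y =>
    rcases y with ⟨v, a⟩ | ⟨e, a, t⟩
    · exact Or.inl ⟨v, a, rfl⟩
    · by_cases h0 : t = 0
      · subst h0
        exact Or.inl ⟨_, _, 𝒳.edgeMap_zero e a⟩
      · by_cases h1 : t = 1
        · subst h1
          exact Or.inl ⟨_, _, 𝒳.edgeMap_one e a⟩
        · exact Or.inr ⟨e, (a, t), h0, h1, rfl⟩

theorem code_eq_inr {y : 𝒳.Total} {e : E} {p : Realization (𝒳.KE e) × unitInterval}
    (h : 𝒳.code y = Sum.inr ⟨e, p⟩) : y = 𝒳.edgeMap e p ∧ p.2 ≠ 0 ∧ p.2 ≠ 1 := by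
  rcases 𝒳.code_cases y with ⟨v, a, rfl⟩ | ⟨e', p', h0, h1, rfl⟩
  · cases h
  · rw [code_edgeMap 𝒳 h0 h1] at h
    obtain ⟨rfl, h⟩ := Sigma.mk.inj_iff.1 (Sum.inr_injective h)
    obtain rfl := eq_of_heq h
    exact ⟨rfl, h0, h1⟩

theorem coe_ne_zero_of_mem {t : unitInterval} (h0 : t ≠ 0) (h1 : t ≠ 1) :
    ((t : ℝ) : AddCircle (1 : ℝ)) ≠ 0 := by
  rw [Ne, AddCircle.coe_eq_zero_iff]
  rintro ⟨n, hn⟩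
  have ht0 : (0 : ℝ) < t := lt_of_le_of_ne t.2.1 fun h => h0 (Subtype.ext h.symm)
  have ht1 : (t : ℝ) < 1 := lt_of_le_of_ne t.2.2 fun h => h1 (Subtype.ext h)
  rw [zsmul_eq_mul, mul_one] at hn
  rw [← hn] at ht0 ht1
  have h2 : (0 : ℤ) < n := by exact_mod_cast ht0
  have h3 : n < (1 : ℤ) := by exact_mod_cast ht1
  omega

theorem height_ne_zero_iff (y : 𝒳.Total) : 𝒳.height y ≠ 0 ↔ ∃ p, 𝒳.code y = Sum.inr p := by
  rcases 𝒳.code_cases y with ⟨v, a, rfl⟩ | ⟨e, p, h0, h1, rfl⟩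
  · simp [height_vertexMap, code_vertexMap]
  · rw [code_edgeMap 𝒳 h0 h1, height_edgeMap]
    exact ⟨fun _ => ⟨_, rfl⟩, fun _ => coe_ne_zero_of_mem h0 h1⟩

/-- The coordinates in the interiors of the edges are continuous. -/
theorem continuous_of_code {Y : Type*} [TopologicalSpace Y] {g : Y → 𝒳.Total} (hg : Continuous g)
    {c : Y → Σ e, Realization (𝒳.KE e) × unitInterval} (hc : ∀ y, 𝒳.code (g y) = Sum.inr (c y)) :
    Continuous c := by
  rw [continuous_def]
  intro U hU
  -- Nothing is glued in the interiors of the edges, so an open set of interior coordinates is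
  -- saturated and stays open in the quotient.
  have hopen : IsOpen {y : 𝒳.Total | ∃ p ∈ U, 𝒳.code y = Sum.inr p} := by
    rw [← 𝒳.isQuotientMap_toTotal.isOpen_preimage]
    have hpre : 𝒳.toTotal ⁻¹' {y : 𝒳.Total | ∃ p ∈ U, 𝒳.code y = Sum.inr p} =
        Sum.inr '' (U ∩ {p | p.2.2 ≠ 0 ∧ p.2.2 ≠ 1}) := by
      ext y
      constructor
      · rintro ⟨p, hp, hy⟩
        rcases y with ⟨v, a⟩ | ⟨e, p'⟩
        · cases hy
        · have h := 𝒳.code_eq_inr (y := 𝒳.edgeMap e p') (e := p.1) (p := p.2) hy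
          by_cases h0 : p'.2 = 0
          · have : 𝒳.code (𝒳.edgeMap e p') = Sum.inl (𝒢.ori e) := by
              rw [show p' = (p'.1, 0) from Prod.ext rfl h0, edgeMap_zero]; rfl
            rw [show 𝒳.toTotal (Sum.inr ⟨e, p'⟩) = 𝒳.edgeMap e p' from rfl, this] at hy
            cases hy
          · by_cases h1 : p'.2 = 1
            · have : 𝒳.code (𝒳.edgeMap e p') = Sum.inl (𝒢.ter e) := by
                rw [show p' = (p'.1, 1) from Prod.ext rfl h1, edgeMap_one]; rfl
              rw [show 𝒳.toTotal (Sum.inr ⟨e, p'⟩) = 𝒳.edgeMap e p' from rfl, this] at hy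
              cases hy
            · rw [show 𝒳.toTotal (Sum.inr ⟨e, p'⟩) = 𝒳.edgeMap e p' from rfl,
                code_edgeMap 𝒳 h0 h1] at hy
              obtain rfl := Sum.inr_injective hy
              exact ⟨_, ⟨hp, h0, h1⟩, rfl⟩
      · rintro ⟨⟨e, p⟩, ⟨hp, h0, h1⟩, rfl⟩
        exact ⟨_, hp, 𝒳.code_edgeMap h0 h1⟩
    rw [hpre]
    refine isOpenMap_inr _ (hU.inter ?_)
    have hcont : Continuous fun p : Σ e, Realization (𝒳.KE e) × unitInterval => p.2.2 :=
      continuous_sigma fun e => continuous_snd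
    exact (isOpen_ne.preimage hcont).inter (isOpen_ne.preimage hcont)
  convert hopen.preimage hg using 1
  ext y
  constructor
  · exact fun hy => ⟨c y, hy, hc y⟩
  · rintro ⟨p, hp, hy⟩
    rw [hc] at hy
    obtain rfl := Sum.inr_injective hy
    exact hp

end GraphOfSpaces

/-- The point `1/2` of the unit interval. -/
noncomputable def unitInterval.mid : unitInterval := ⟨1 / 2, by norm_num, by norm_num⟩

theorem unitInterval.mid_ne_zero : unitInterval.mid ≠ 0 := fun h => by
  have := congrArg Subtype.val h
  norm_num [unitInterval.mid] at this

theorem unitInterval.mid_ne_one : unitInterval.mid ≠ 1 := fun h => by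
  have := congrArg Subtype.val h
  norm_num [unitInterval.mid] at this

/-- The point that divides the segment from `s` to `t` in the ratio `r`. -/
noncomputable def unitInterval.interp (r s t : unitInterval) : unitInterval :=
  projIcc 0 1 zero_le_one ((1 - (r : ℝ)) * s + r * t)

theorem unitInterval.interp_zero (s t : unitInterval) : unitInterval.interp 0 s t = s := by
  simp [unitInterval.interp]

theorem unitInterval.interp_one (s t : unitInterval) : unitInterval.interp 1 s t = t := by
  simp [unitInterval.interp]

theorem unitInterval.interp_self (r s : unitInterval) : unitInterval.interp r s s = s := by
  have : (1 - (r : ℝ)) * s + r * s = s := by ring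
  rw [unitInterval.interp, this, projIcc_val]

theorem unitInterval.continuous_interp :
    Continuous fun p : unitInterval × unitInterval × unitInterval =>
      unitInterval.interp p.1 p.2.1 p.2.2 := by
  unfold unitInterval.interp
  refine continuous_projIcc.comp ?_
  fun_prop

/-! ### Vertical paths, edge-spaces and strips in a covering -/

namespace GraphOfSpaces

open unitInterval (mid interp)

variable {V : Type u} {E : Type v} {𝒢 : GraphOfGroups.{u, v, w} V E} {𝒳 : GraphOfSpaces 𝒢}
  {Xt : Type*} [TopologicalSpace Xt] {q : Xt → 𝒳.Total}

theorem exists_lift_homotopy (hq : IsCoveringMap q) {A : Type*} [TopologicalSpace A]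
    (H : C(unitInterval × A, 𝒳.Total)) (g : C(A, Xt)) (h : ∀ a, H (0, a) = q (g a)) :
    ∃ Γ : C(unitInterval × A, Xt), (∀ p, q (Γ p) = H p) ∧ ∀ a, Γ (0, a) = g a :=
  ⟨hq.liftHomotopy H g h, fun p => congrFun (hq.liftHomotopy_lifts H g h) p,
    hq.liftHomotopy_zero H g h⟩

theorem lift_unique (hq : IsCoveringMap q) {A : Type*} [TopologicalSpace A] [PreconnectedSpace A]
    {g₁ g₂ : A → Xt} (h₁ : Continuous g₁) (h₂ : Continuous g₂) (h : ∀ a, q (g₁ a) = q (g₂ a))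
    {a : A} (ha : g₁ a = g₂ a) : g₁ = g₂ :=
  hq.eq_of_comp_eq h₁ h₂ (funext h) a ha

/-- The lifts of the segments `{a} × [0, 1]` through a continuous family of points. -/
theorem exists_vertical (hq : IsCoveringMap q) {Y : Type*} [TopologicalSpace Y] {e : E}
    (a : C(Y, Realization (𝒳.KE e))) (t : C(Y, unitInterval)) (g : C(Y, Xt))
    (h : ∀ y, q (g y) = 𝒳.edgeMap e (a y, t y)) :
    ∃ Γ : C(Y × unitInterval, Xt), (∀ y s, q (Γ (y, s)) = 𝒳.edgeMap e (a y, s)) ∧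
      ∀ y, Γ (y, t y) = g y := by
  -- The homotopy slides from height `t y` to height `s`, so its lift can start at `g`. At `s = t y`
  -- it is constant, and hence so is its lift.
  let H : C(unitInterval × (Y × unitInterval), 𝒳.Total) :=
    ⟨fun p => 𝒳.edgeMap e (a p.2.1, interp p.1 (t p.2.1) p.2.2), by
      refine (𝒳.continuous_edgeMap e).comp (Continuous.prodMk (by fun_prop) ?_)
      exact unitInterval.continuous_interp.comp
        (Continuous.prodMk continuous_fst (Continuous.prodMk (by fun_prop) (by fun_prop)))⟩
  obtain ⟨Γ, hΓ, hΓ0⟩ := exists_lift_homotopy hq H (g.comp ⟨Prod.fst, continuous_fst⟩) (by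
    rintro ⟨y, s⟩
    change 𝒳.edgeMap e (a y, interp 0 (t y) s) = q (g y)
    rw [unitInterval.interp_zero, h])
  refine ⟨Γ.comp ⟨fun p => (1, p), by fun_prop⟩, fun y s => ?_, fun y => ?_⟩
  · change q (Γ (1, (y, s))) = _
    rw [hΓ]
    change 𝒳.edgeMap e (a y, interp 1 (t y) s) = _
    rw [unitInterval.interp_one]
  · change Γ (1, (y, t y)) = g y
    have h1 : (fun r : unitInterval => Γ (r, (y, t y))) = fun _ => g y := by
      refine lift_unique hq (by fun_prop) continuous_const (fun r => ?_) (a := 0) (hΓ0 _)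
      rw [hΓ, h]
      change 𝒳.edgeMap e (a y, interp r (t y) (t y)) = _
      rw [unitInterval.interp_self]
    exact congrFun h1 1

variable (q) in
/-- The path `γ` is a lift of the segment `{a} × [0, 1]` of `X_e × [0, 1]`. -/
def IsVertical (e : E) (a : Realization (𝒳.KE e)) (γ : C(unitInterval, Xt)) : Prop :=
  ∀ s, q (γ s) = 𝒳.edgeMap e (a, s)

theorem exists_isVertical (hq : IsCoveringMap q) {x : Xt} {e : E}
    {p : Realization (𝒳.KE e) × unitInterval} (h : q x = 𝒳.edgeMap e p) :
    ∃ γ, IsVertical q e p.1 γ ∧ γ p.2 = x := by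
  obtain ⟨Γ, hΓ, hΓ'⟩ := exists_vertical hq (Y := Unit) (.const _ p.1) (.const _ p.2) (.const _ x)
    (fun _ => h)
  exact ⟨Γ.comp ⟨fun s => ((), s), by fun_prop⟩, fun s => hΓ () s, hΓ' ()⟩

theorem IsVertical.eq (hq : IsCoveringMap q) {e : E} {a : Realization (𝒳.KE e)}
    {γ γ' : C(unitInterval, Xt)} (h : IsVertical q e a γ) (h' : IsVertical q e a γ')
    {s : unitInterval} (hs : γ s = γ' s) : γ = γ' :=
  DFunLike.coe_injective (lift_unique hq γ.continuous γ'.continuous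
    (fun t => (h t).trans (h' t).symm) hs)

theorem IsVertical.code_eq {e : E} {a : Realization (𝒳.KE e)} {γ : C(unitInterval, Xt)}
    (h : IsVertical q e a γ) {s : unitInterval} (h0 : s ≠ 0) (h1 : s ≠ 1) :
    𝒳.code (q (γ s)) = Sum.inr ⟨e, (a, s)⟩ := by
  rw [h s, code_edgeMap 𝒳 h0 h1]

/-- Two vertical paths that meet in an interior point coincide. -/
theorem IsVertical.eq_of_interior (hq : IsCoveringMap q) {e e' : E} {a : Realization (𝒳.KE e)}
    {a' : Realization (𝒳.KE e')} {γ γ' : C(unitInterval, Xt)} (h : IsVertical q e a γ)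
    (h' : IsVertical q e' a' γ') {s s' : unitInterval} (h0 : s ≠ 0) (h1 : s ≠ 1) (h0' : s' ≠ 0)
    (h1' : s' ≠ 1) (hs : γ s = γ' s') : γ = γ' ∧ s = s' := by
  have h2 := h.code_eq h0 h1
  rw [hs, h'.code_eq h0' h1'] at h2
  obtain ⟨rfl, h3⟩ := Sigma.mk.inj_iff.1 (Sum.inr_injective h2)
  obtain ⟨rfl, rfl⟩ := Prod.mk_inj.1 (eq_of_heq h3)
  exact ⟨h.eq hq h' hs, rfl⟩

variable (q) in
/-- The edge-space of a point over the middle of an edge. -/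
def edgeSpace (x : Xt) : Set Xt := {y | ∃ e, JoinedIn (q ⁻¹' 𝒳.midSlice e) x y}

variable (q) in
/-- The vertex-space of a point over a vertex. -/
def vertexSpace (x : Xt) : Set Xt := {y | ∃ v, JoinedIn (q ⁻¹' range (𝒳.vertexMap v)) x y}

theorem mem_midSlice {e : E} {y : 𝒳.Total} :
    y ∈ 𝒳.midSlice e ↔ ∃ a, 𝒳.code y = Sum.inr ⟨e, (a, mid)⟩ := by
  constructor
  · rintro ⟨⟨a, t⟩, ht, rfl⟩
    obtain rfl : t = mid := Subtype.ext ht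
    exact ⟨a, code_edgeMap 𝒳 unitInterval.mid_ne_zero unitInterval.mid_ne_one⟩
  · rintro ⟨a, ha⟩
    obtain ⟨rfl, -⟩ := 𝒳.code_eq_inr ha
    exact ⟨(a, mid), rfl, rfl⟩

theorem mem_range_vertexMap {v : V} {y : 𝒳.Total} :
    y ∈ range (𝒳.vertexMap v) ↔ 𝒳.code y = Sum.inl v := by
  constructor
  · rintro ⟨a, rfl⟩
    rfl
  · intro h
    rcases 𝒳.code_cases y with ⟨v', a, rfl⟩ | ⟨e, p, h0, h1, rfl⟩
    · rw [code_vertexMap] at h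
      obtain rfl := Sum.inl_injective h
      exact ⟨a, rfl⟩
    · rw [code_edgeMap 𝒳 h0 h1] at h
      cases h

/-- The edge `e` is determined by `x`, because `code` records it. -/
theorem edgeSpace_eq {x : Xt} {e : E} (hx : q x ∈ 𝒳.midSlice e) :
    edgeSpace q x = pathComponentIn (q ⁻¹' 𝒳.midSlice e) x := by
  ext y
  constructor
  · rintro ⟨e', h⟩
    obtain ⟨a, ha⟩ := mem_midSlice.1 hx
    obtain ⟨a', ha'⟩ := mem_midSlice.1 h.source_mem
    rw [ha] at ha'
    obtain ⟨rfl, -⟩ := Sigma.mk.inj_iff.1 (Sum.inr_injective ha')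
    exact h
  · exact fun h => ⟨e, h⟩

theorem vertexSpace_eq {x : Xt} {v : V} (hx : q x ∈ range (𝒳.vertexMap v)) :
    vertexSpace q x = pathComponentIn (q ⁻¹' range (𝒳.vertexMap v)) x := by
  ext y
  constructor
  · rintro ⟨v', h⟩
    have h1 := mem_range_vertexMap.1 hx
    rw [mem_range_vertexMap.1 h.source_mem] at h1
    obtain rfl := Sum.inl_injective h1
    exact h
  · exact fun h => ⟨v, h⟩

theorem edgeSpace_mem {x : Xt} {e : E} (hx : q x ∈ 𝒳.midSlice e) :
    edgeSpace q x ∈ 𝒳.edgeSpaces q := ⟨e, x, hx, edgeSpace_eq hx⟩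

theorem vertexSpace_mem {x : Xt} {v : V} (hx : q x ∈ range (𝒳.vertexMap v)) :
    vertexSpace q x ∈ 𝒳.vertexSpaces q := ⟨v, x, hx, vertexSpace_eq hx⟩

theorem edgeSpace_congr {x y : Xt} {e : E} (h : JoinedIn (q ⁻¹' 𝒳.midSlice e) x y) :
    edgeSpace q x = edgeSpace q y := by
  rw [edgeSpace_eq h.source_mem, edgeSpace_eq h.target_mem]
  exact (pathComponentIn_congr h).symm

theorem vertexSpace_congr {x y : Xt} {v : V}
    (h : JoinedIn (q ⁻¹' range (𝒳.vertexMap v)) x y) : vertexSpace q x = vertexSpace q y := by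
  rw [vertexSpace_eq h.source_mem, vertexSpace_eq h.target_mem]
  exact (pathComponentIn_congr h).symm

theorem IsVertical.mid_mem {e : E} {a : Realization (𝒳.KE e)} {γ : C(unitInterval, Xt)}
    (h : IsVertical q e a γ) : q (γ mid) ∈ 𝒳.midSlice e := by
  rw [h]
  exact ⟨(a, mid), rfl, rfl⟩

theorem IsVertical.zero_mem {e : E} {a : Realization (𝒳.KE e)} {γ : C(unitInterval, Xt)}
    (h : IsVertical q e a γ) : q (γ 0) ∈ range (𝒳.vertexMap (𝒢.ori e)) := by
  rw [h, edgeMap_zero]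
  exact ⟨_, rfl⟩

theorem IsVertical.one_mem {e : E} {a : Realization (𝒳.KE e)} {γ : C(unitInterval, Xt)}
    (h : IsVertical q e a γ) : q (γ 1) ∈ range (𝒳.vertexMap (𝒢.ter e)) := by
  rw [h, edgeMap_one]
  exact ⟨_, rfl⟩

/-- The vertical paths through the points of a path in the interior of the edges. -/
theorem exists_vertical_of_path (hq : IsCoveringMap q) (σ : C(unitInterval, Xt))
    (hσ : ∀ τ, 𝒳.height (q (σ τ)) ≠ 0) :
    ∃ (e : E) (a : unitInterval → Realization (𝒳.KE e)) (t : unitInterval → unitInterval)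
      (Γ : C(unitInterval × unitInterval, Xt)),
      (∀ τ, 𝒳.code (q (σ τ)) = Sum.inr ⟨e, (a τ, t τ)⟩) ∧
      (∀ τ s, q (Γ (τ, s)) = 𝒳.edgeMap e (a τ, s)) ∧ ∀ τ, Γ (τ, t τ) = σ τ := by
  have hc : ∀ τ, ∃ p, 𝒳.code (q (σ τ)) = Sum.inr p := fun τ => (𝒳.height_ne_zero_iff _).1 (hσ τ)
  choose c hc using hc
  have hcont : Continuous q := hq.continuous
  -- The code is a continuous map from a connected space to a disjoint union, so the edge is
  -- constant.
  obtain ⟨e, p, hp, rfl⟩ := (𝒳.continuous_of_code (hcont.comp σ.continuous) hc).exists_lift_sigma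
  obtain ⟨Γ, hΓ, hΓ'⟩ := exists_vertical hq ⟨fun τ => (p τ).1, by fun_prop⟩
    ⟨fun τ => (p τ).2, by fun_prop⟩ σ (fun τ => (𝒳.code_eq_inr (hc τ)).1)
  exact ⟨e, _, _, Γ, hc, hΓ, hΓ'⟩

/-- Vertical paths with midpoints in the same edge-space have endpoints in the same
vertex-spaces. -/
theorem IsVertical.joinedIn (hq : IsCoveringMap q) {e : E} {a a' : Realization (𝒳.KE e)}
    {γ γ' : C(unitInterval, Xt)} (h : IsVertical q e a γ) (h' : IsVertical q e a' γ')
    (hj : JoinedIn (q ⁻¹' 𝒳.midSlice e) (γ mid) (γ' mid)) :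
    JoinedIn (q ⁻¹' range (𝒳.vertexMap (𝒢.ori e))) (γ 0) (γ' 0) ∧
    JoinedIn (q ⁻¹' range (𝒳.vertexMap (𝒢.ter e))) (γ 1) (γ' 1) := by
  obtain ⟨σ, hσ⟩ := hj
  have hcode : ∀ τ, ∃ b, 𝒳.code (q (σ τ)) = Sum.inr ⟨e, (b, mid)⟩ := fun τ => mem_midSlice.1 (hσ τ)
  obtain ⟨e', b, t, Γ, hc, hΓ, hΓ'⟩ := exists_vertical_of_path hq σ.toContinuousMap (fun τ => by
    rw [𝒳.height_ne_zero_iff]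
    obtain ⟨b, hb⟩ := hcode τ
    exact ⟨_, hb⟩)
  obtain rfl : e = e' := by
    obtain ⟨b', hb'⟩ := hcode 0
    have := hc 0
    rw [show (σ.toContinuousMap 0) = σ 0 from rfl, hb'] at this
    exact (Sigma.mk.inj_iff.1 (Sum.inr_injective this)).1
  have ht : ∀ τ, t τ = mid := by
    intro τ
    obtain ⟨b', hb'⟩ := hcode τ
    have := hc τ
    rw [show (σ.toContinuousMap τ) = σ τ from rfl, hb'] at this
    exact (Prod.mk_inj.1 (eq_of_heq (Sigma.mk.inj_iff.1 (Sum.inr_injective this)).2)).2.symm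
  -- The vertical paths through `σ` interpolate between `γ` and `γ'` by uniqueness of lifts; their
  -- endpoints trace the required paths.
  have hvert : ∀ τ, IsVertical q e (b τ) (Γ.comp ⟨fun s => (τ, s), by fun_prop⟩) := hΓ
  have e0 : Γ.comp ⟨fun s => (0, s), by fun_prop⟩ = γ := by
    refine ((hvert 0).eq_of_interior hq h unitInterval.mid_ne_zero unitInterval.mid_ne_one
      unitInterval.mid_ne_zero unitInterval.mid_ne_one ?_).1
    have := hΓ' 0
    rw [ht] at this
    exact this.trans σ.source
  have e1 : Γ.comp ⟨fun s => (1, s), by fun_prop⟩ = γ' := by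
    refine ((hvert 1).eq_of_interior hq h' unitInterval.mid_ne_zero unitInterval.mid_ne_one
      unitInterval.mid_ne_zero unitInterval.mid_ne_one ?_).1
    have := hΓ' 1
    rw [ht] at this
    exact this.trans σ.target
  refine ⟨⟨⟨⟨fun τ => Γ (τ, 0), by fun_prop⟩, DFunLike.congr_fun e0 0, DFunLike.congr_fun e1 0⟩,
    fun τ => (hvert τ).zero_mem⟩, ⟨⟨⟨fun τ => Γ (τ, 1), by fun_prop⟩, DFunLike.congr_fun e0 1,
    DFunLike.congr_fun e1 1⟩, fun τ => (hvert τ).one_mem⟩⟩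

variable (q) in
/-- The points in the interior of a strip along the edge-space `S`. -/
def strip (S : Set Xt) : Set Xt :=
  {x | ∃ e a γ s, IsVertical q e a γ ∧ γ mid ∈ S ∧ s ≠ 0 ∧ s ≠ 1 ∧ γ s = x}

theorem mem_of_joinedIn_midSlice {S : Set Xt} (hS : S ∈ 𝒳.edgeSpaces q) {x y : Xt} (hx : x ∈ S)
    {e : E} (h : JoinedIn (q ⁻¹' 𝒳.midSlice e) x y) : y ∈ S := by
  obtain ⟨e', x', hx', rfl⟩ := hS
  rw [← edgeSpace_eq hx', edgeSpace_congr hx, edgeSpace_congr h, edgeSpace_eq h.target_mem]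
  exact mem_pathComponentIn_self h.target_mem

/-- A path that avoids the vertex-spaces carries along the vertical path through its current point,
whose midpoint moves within one edge-space. So the strip is a union of path components of the locus
of nonzero height. -/
theorem mem_strip_of_path (hq : IsCoveringMap q) {S : Set Xt} (hS : S ∈ 𝒳.edgeSpaces q)
    (σ : C(unitInterval, Xt)) (hσ : ∀ τ, 𝒳.height (q (σ τ)) ≠ 0) (h : σ 0 ∈ strip q S) :
    σ 1 ∈ strip q S := by
  obtain ⟨e, a, γ, s, hγ, hS', h0, h1, hs⟩ := h
  obtain ⟨e', b, t, Γ, hc, hΓ, hΓ'⟩ := exists_vertical_of_path hq σ hσ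
  have hvert : ∀ τ, IsVertical q e' (b τ) (Γ.comp ⟨fun s => (τ, s), by fun_prop⟩) := hΓ
  have hint := fun τ => (𝒳.code_eq_inr (hc τ)).2
  obtain ⟨e0, -⟩ := (hvert 0).eq_of_interior hq hγ (hint 0).1 (hint 0).2 h0 h1
    ((hΓ' 0).trans hs.symm)
  refine ⟨e', b 1, _, t 1, hvert 1, ?_, (hint 1).1, (hint 1).2, hΓ' 1⟩
  refine mem_of_joinedIn_midSlice hS hS' (e := e') ⟨⟨⟨fun τ => Γ (τ, mid), by fun_prop⟩,
    DFunLike.congr_fun e0 mid, rfl⟩, fun τ => (hvert τ).mid_mem⟩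

open Classical in
variable (q) in
/-- The coordinate across the strip along `S`, modulo one. -/
noncomputable def stripHeight (S : Set Xt) (x : Xt) : AddCircle (1 : ℝ) :=
  if x ∈ strip q S then 𝒳.height (q x) else 0

/-- Near height zero both possible values, the height and zero, are small. Elsewhere membership in
the strip is locally constant, by `mem_strip_of_path`. Local path connectedness is required of the
source `Y` alone; squares are enough for `exists_potential`. -/
theorem continuous_stripHeight (hq : IsCoveringMap q) {S : Set Xt} (hS : S ∈ 𝒳.edgeSpaces q)
    {Y : Type*} [TopologicalSpace Y] [LocallyPathConnectedSpace Y] (g : C(Y, Xt)) :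
    Continuous fun y => stripHeight q S (g y) := by
  have hcont : Continuous fun y => 𝒳.height (q (g y)) :=
    𝒳.continuous_height.comp (hq.continuous.comp g.continuous)
  rw [continuous_iff_continuousAt]
  intro y
  by_cases hy : 𝒳.height (q (g y)) = 0
  · have h0 : stripHeight q S (g y) = 0 := by
      rw [stripHeight]; split_ifs <;> simp [hy]
    rw [ContinuousAt, h0]
    have h1 := hcont.continuousAt (x := y)
    rw [ContinuousAt, hy] at h1
    intro N hN
    have h2 : ∀ᶠ z in 𝓝 y, 𝒳.height (q (g z)) ∈ N := h1 hN
    change ∀ᶠ z in 𝓝 y, stripHeight q S (g z) ∈ N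
    filter_upwards [h2] with z hz
    rw [stripHeight]
    split_ifs
    exacts [hz, mem_of_mem_nhds hN]
  · have hU : IsOpen {z | 𝒳.height (q (g z)) ≠ 0} := isOpen_ne.preimage hcont
    have hconst : ∀ᶠ z in 𝓝 y, (g z ∈ strip q S ↔ g y ∈ strip q S) := by
      filter_upwards [(hU.pathComponentIn y).mem_nhds (mem_pathComponentIn_self hy)] with z hz
      obtain ⟨σ, hσ⟩ := hz
      constructor
      · intro h
        have := mem_strip_of_path hq hS (g.comp σ.symm.toContinuousMap) (fun τ => hσ _) (by
          simpa using h)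
        simpa using this
      · intro h
        have := mem_strip_of_path hq hS (g.comp σ.toContinuousMap) (fun τ => hσ _) (by
          simpa using h)
        simpa using this
    by_cases h : g y ∈ strip q S
    · refine (hcont.continuousAt (x := y)).congr ?_
      filter_upwards [hconst] with z hz
      rw [stripHeight, if_pos (hz.2 h)]
    · refine (continuousAt_const (y := (0 : AddCircle (1 : ℝ)))).congr ?_
      filter_upwards [hconst] with z hz
      rw [stripHeight, if_neg (fun h' => h (hz.1 h'))]

/-- The signed number of crossings of an edge-space. -/
theorem exists_crossing_number (hq : IsCoveringMap q) [SimplyConnectedSpace Xt] {S : Set Xt}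
    (hS : S ∈ 𝒳.edgeSpaces q) : ∃ h : Xt → ℝ,
      (∀ x v, q x ∈ range (𝒳.vertexMap v) → ∃ n : ℤ, h x = n) ∧
      (∀ x y v, JoinedIn (q ⁻¹' range (𝒳.vertexMap v)) x y → h x = h y) ∧
      (∀ e a γ, IsVertical q e a γ → γ mid ∈ S → ∀ s t, h (γ t) - h (γ s) = (t : ℝ) - s) ∧
      (∀ e a γ, IsVertical q e a γ → γ mid ∉ S → ∀ s t, h (γ t) = h (γ s)) := by
  obtain ⟨h, hh, hpath⟩ := exists_potential (stripHeight q S) fun H => continuous_stripHeight hq hS H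
  have hvert : ∀ x v, q x ∈ range (𝒳.vertexMap v) → stripHeight q S x = 0 := by
    rintro x v ⟨a, ha⟩
    rw [stripHeight, ← ha, height_vertexMap, ite_self]
  -- The potential controls whole paths; reparametrization extends this to the part between any two
  -- parameters.
  have hpath' : ∀ (γ : C(unitInterval, Xt)) (ℓ : C(unitInterval, ℝ)),
      (∀ t, (ℓ t : AddCircle (1 : ℝ)) = stripHeight q S (γ t)) →
      ∀ s t, h (γ t) - h (γ s) = ℓ t - ℓ s := by
    intro γ ℓ hℓ s t
    have hi : Continuous fun r : unitInterval => interp r s t :=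
      unitInterval.continuous_interp.comp
        (Continuous.prodMk continuous_id (continuous_const (y := (s, t))))
    have := hpath (γ.comp ⟨_, hi⟩) (ℓ.comp ⟨_, hi⟩) (fun r => hℓ _)
    simpa [unitInterval.interp_zero, unitInterval.interp_one] using this
  refine ⟨h, fun x v hx => ?_, fun x y v hxy => ?_, fun e a γ hγ hmid s t => ?_,
    fun e a γ hγ hmid s t => ?_⟩
  · have h1 := hh x
    rw [hvert x v hx, AddCircle.coe_eq_zero_iff] at h1
    obtain ⟨n, hn⟩ := h1
    exact ⟨n, by simpa using hn.symm⟩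
  · obtain ⟨σ, hσ⟩ := hxy
    have := hpath σ.toContinuousMap (.const _ 0) (fun t => by
      rw [show σ.toContinuousMap t = σ t from rfl, hvert _ v (hσ t)]; simp)
    simp at this
    linarith
  · refine hpath' γ ⟨fun t => (t : ℝ), continuous_subtype_val⟩ (fun r => ?_) s t
    rw [stripHeight]
    split_ifs with hr
    · rw [hγ, height_edgeMap]; rfl
    -- A point of this vertical path off the open strip has `r = 0` or `r = 1`, where `ℓ` is an
    -- integer.
    · by_contra hne
      apply hr
      refine ⟨e, a, γ, r, hγ, hmid, ?_, ?_, rfl⟩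
      · rintro rfl
        exact hne (by simp)
      · rintro rfl
        exact hne (AddCircle.coe_period 1)
  · have := hpath' γ (.const _ 0) (fun r => ?_) s t
    · simp at this
      linarith
    · rw [stripHeight]
      split_ifs with hr
      · rw [hγ, height_edgeMap]
        by_contra hne
        obtain ⟨e', a', γ', s', hγ', hmid', h0, h1, hs'⟩ := hr
        have hr0 : r ≠ 0 := by
          rintro rfl
          exact hne (by simp)
        have hr1 : r ≠ 1 := by
          rintro rfl
          exact hne (by simp [AddCircle.coe_period])
        rw [← (hγ.eq_of_interior hq hγ' hr0 hr1 h0 h1 hs'.symm).1] at hmid'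
        exact hmid hmid'
      · simp

end GraphOfSpaces

/-! ### Segments in closed simplices -/

namespace Realization

variable {ι : Type*} [Fintype ι] {K : AbstractSimplicialComplex ι} {s : Finset ι}

/-- A closed simplex of the realization, as a space. -/
abbrev Cell (K : AbstractSimplicialComplex ι) (s : Finset ι) : Type _ :=
  {x : Realization K // x ∈ simplex s}

/-- The point that divides the segment from `a` to `b` in a simplex in the ratio `r`. -/
noncomputable def interp (hs : s ∈ K.faces)
    (p : unitInterval × Cell K s × Cell K s) :
    Cell K s :=
  have h0 : ∀ i ∉ s, (1 - (p.1 : ℝ)) * p.2.1.1.1 i + p.1 * p.2.2.1.1 i = 0 := fun i hi => by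
    rw [p.2.1.2 i hi, p.2.2.2 i hi, mul_zero, mul_zero, add_zero]
  ⟨⟨fun i => (1 - (p.1 : ℝ)) * p.2.1.1.1 i + p.1 * p.2.2.1.1 i, fun i =>
      add_nonneg (mul_nonneg (sub_nonneg.2 p.1.2.2) (p.2.1.1.2.1 i))
        (mul_nonneg p.1.2.1 (p.2.2.1.2.1 i)), by
      rw [Finset.sum_add_distrib, ← Finset.mul_sum, ← Finset.mul_sum, p.2.1.1.2.2.1,
        p.2.2.1.2.2.1]
      ring, s, hs, h0⟩, h0⟩

theorem continuous_interp (hs : s ∈ K.faces) : Continuous (interp hs) := by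
  refine Continuous.subtype_mk (Continuous.subtype_mk (continuous_pi fun i => ?_) _) _
  have hc : Continuous fun x : Realization K => x.1 i :=
    (continuous_apply i).comp continuous_subtype_val
  have h1 : Continuous fun p : unitInterval × Cell K s × Cell K s => p.2.1.1.1 i :=
    hc.comp (continuous_subtype_val.comp (continuous_fst.comp continuous_snd))
  have h2 : Continuous fun p : unitInterval × Cell K s × Cell K s => p.2.2.1.1 i :=
    hc.comp (continuous_subtype_val.comp (continuous_snd.comp continuous_snd))
  fun_prop

theorem interp_zero (hs : s ∈ K.faces) (a b : Cell K s) :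
    interp hs (0, a, b) = a := by
  refine Subtype.ext (Subtype.ext (funext fun i => ?_))
  simp [interp]

theorem interp_one (hs : s ∈ K.faces) (a b : Cell K s) :
    interp hs (1, a, b) = b := by
  refine Subtype.ext (Subtype.ext (funext fun i => ?_))
  simp [interp]

theorem interp_self (hs : s ∈ K.faces) (r : unitInterval) (a : Cell K s) :
    interp hs (r, a, a) = a := by
  refine Subtype.ext (Subtype.ext (funext fun i => ?_))
  simp only [interp]
  ring

theorem sqDist_nonneg (a b : Realization K) : 0 ≤ sqDist a b :=
  div_nonneg (Finset.sum_nonneg fun _ _ => sq_nonneg _) zero_le_two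

theorem sqDist_self (a : Realization K) : sqDist a a = 0 := by
  simp [sqDist]

theorem exists_mem_simplex (a : Realization K) :
    ∃ s ∈ K.faces, a ∈ (simplex s : Set (Realization K)) := a.2.2.2

end Realization

/-! ### The path metric and the universal cover as a coarse tree -/

namespace GraphOfSpaces

open unitInterval (mid)

variable {V : Type u} {E : Type v} {𝒢 : GraphOfGroups.{u, v, w} V E} {𝒳 : GraphOfSpaces 𝒢}
  {Xt : Type*} [TopologicalSpace Xt] {q : Xt → 𝒳.Total}

theorem VertexCellStep.joinedIn {x y : Xt} {l : ℝ} (h : 𝒳.VertexCellStep q x y l) :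
    ∃ v, JoinedIn (q ⁻¹' range (𝒳.vertexMap v)) x y := by
  obtain ⟨v, s, hs, c, hc, hq, a, ha, b, hb, rfl, rfl, -⟩ := h
  have hcont : Continuous fun r : unitInterval =>
      c (Realization.interp hs (r, ⟨a, ha⟩, ⟨b, hb⟩)) :=
    (continuousOn_iff_continuous_domRestrict.1 hc).comp
      ((Realization.continuous_interp hs).comp (Continuous.prodMk_left _))
  refine ⟨v, ⟨⟨_, hcont⟩, ?_, ?_⟩, fun r => ?_⟩
  · simp only [Realization.interp_zero]
  · simp only [Realization.interp_one]
  · exact ⟨_, (hq _ (Subtype.coe_prop _)).symm⟩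

/-- The cell is a product with the interval: each point lies on a vertical path, a segment of the
middle slice joins the midpoints, and the height difference is one component of the Euclidean
distance. -/
theorem EdgeCellStep.exists_isVertical {x y : Xt} {l : ℝ} (h : 𝒳.EdgeCellStep q x y l) :
    ∃ (e : E) (a b : Realization (𝒳.KE e)) (γ δ : C(unitInterval, Xt)) (s t : unitInterval),
      IsVertical q e a γ ∧ IsVertical q e b δ ∧
      JoinedIn (q ⁻¹' 𝒳.midSlice e) (γ mid) (δ mid) ∧ γ s = x ∧ δ t = y ∧ |(s : ℝ) - t| ≤ l := by
  obtain ⟨e, f, hf, c, hc, hq, ⟨a, s⟩, ha, ⟨b, t⟩, hb, rfl, rfl, rfl⟩ := h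
  have hcr := continuousOn_iff_continuous_domRestrict.1 hc
  have hpath : ∀ a (_ : a ∈ Realization.simplex f), Continuous fun r : unitInterval => c (a, r) :=
    fun a ha => hcr.comp (Continuous.subtype_mk (Continuous.prodMk_right a)
      (fun r => ⟨ha, trivial⟩))
  refine ⟨e, a, b, ⟨_, hpath a ha.1⟩, ⟨_, hpath b hb.1⟩, s, t, fun r => hq _ ⟨ha.1, trivial⟩,
    fun r => hq _ ⟨hb.1, trivial⟩, ?_, rfl, rfl, ?_⟩
  · have hcont : Continuous fun r : unitInterval =>
        c (Realization.interp hf (r, ⟨a, ha.1⟩, ⟨b, hb.1⟩), mid) := by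
      refine hcr.comp (Continuous.subtype_mk (Continuous.prodMk ?_ continuous_const)
        fun r => ⟨Subtype.coe_prop _, trivial⟩)
      exact continuous_subtype_val.comp
        ((Realization.continuous_interp hf).comp (Continuous.prodMk_left _))
    refine ⟨⟨⟨_, hcont⟩, ?_, ?_⟩, fun r => ?_⟩
    · simp only [Realization.interp_zero]; rfl
    · simp only [Realization.interp_one]; rfl
    · exact ⟨(_, mid), rfl, (hq _ ⟨Subtype.coe_prop _, trivial⟩).symm⟩
  · refine Real.abs_le_sqrt ?_
    have := Realization.sqDist_nonneg a b
    dsimp only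
    linarith

/-- A step requires a lift of a whole cell, whereas only one segment of it has been lifted. The cell
contracts onto that segment, so the reverse homotopy can be lifted starting from `γ`. -/
theorem IsVertical.edgeCellStep (hq : IsCoveringMap q) {e : E} {a : Realization (𝒳.KE e)}
    {γ : C(unitInterval, Xt)} (h : IsVertical q e a γ) (s t : unitInterval) :
    𝒳.EdgeCellStep q (γ s) (γ t) |(s : ℝ) - t| := by
  classical
  obtain ⟨f, hf, ha⟩ := Realization.exists_mem_simplex a
  let a' : Realization.Cell (𝒳.KE e) f := ⟨a, ha⟩
  let H : C(unitInterval × (Realization.Cell (𝒳.KE e) f × unitInterval), 𝒳.Total) :=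
    ⟨fun p => 𝒳.edgeMap e (Realization.interp hf (p.1, a', p.2.1), p.2.2), by
      refine (𝒳.continuous_edgeMap e).comp (Continuous.prodMk ?_ (by fun_prop))
      exact continuous_subtype_val.comp ((Realization.continuous_interp hf).comp (by fun_prop))⟩
  obtain ⟨Γ, hΓ, hΓ0⟩ := exists_lift_homotopy hq H (γ.comp ⟨Prod.snd, continuous_snd⟩) (by
    rintro ⟨b, r⟩
    change 𝒳.edgeMap e (Realization.interp hf (0, a', b), r) = q (γ r)
    rw [Realization.interp_zero, h r])
  have hconst : ∀ r, Γ (1, (a', r)) = γ r := by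
    intro r
    have h1 : (fun τ : unitInterval => Γ (τ, (a', r))) = fun _ => γ r := by
      refine lift_unique hq (by fun_prop) continuous_const (fun τ => ?_) (a := 0) (hΓ0 _)
      rw [hΓ, h r]
      change 𝒳.edgeMap e (Realization.interp hf (τ, a', a'), r) = _
      rw [Realization.interp_self]
    exact congrFun h1 1
  refine ⟨e, f, hf, fun p => if hp : p.1 ∈ Realization.simplex f then Γ (1, (⟨p.1, hp⟩, p.2))
    else γ 0, ?_, ?_, (a, s), ⟨ha, trivial⟩, (a, t), ⟨ha, trivial⟩, ?_, ?_, ?_⟩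
  · rw [continuousOn_iff_continuous_domRestrict]
    have : Continuous fun p : ((Realization.simplex f : Set (Realization (𝒳.KE e))) ×ˢ
        (univ : Set unitInterval) : Set _) => Γ (1, (⟨p.1.1, p.2.1⟩, p.1.2)) := by
      fun_prop
    convert this using 2 with p
    simp only [domRestrict_apply]
    rw [dif_pos p.2.1]
  · rintro ⟨b, r⟩ ⟨hb, -⟩
    dsimp only at hb ⊢
    rw [dif_pos hb, hΓ]
    change 𝒳.edgeMap e (Realization.interp hf (1, a', ⟨b, hb⟩), r) = _
    rw [Realization.interp_one]
  · dsimp only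
    rw [dif_pos ha]
    exact hconst s
  · dsimp only
    rw [dif_pos ha]
    exact hconst t
  · rw [Realization.sqDist_self, zero_add, Real.sqrt_sq_eq_abs]

theorem le_stepCost_add {x y : Xt} {r r' : ℝ≥0∞}
    (h : ∀ l, 𝒳.VertexCellStep q x y l ∨ 𝒳.EdgeCellStep q x y l → r ≤ ENNReal.ofReal l + r') :
    r ≤ 𝒳.stepCost q x y + r' := by
  rw [stepCost]
  simp_rw [ENNReal.iInf_add]
  exact le_iInf₂ h

/-- A function that decreases along a step by at most the cost of the step decreases by at most the
distance. -/
theorem le_pathDist_add {ψ : Xt → ℝ≥0∞} (h : ∀ x y, ψ x ≤ 𝒳.stepCost q x y + ψ y) (x y : Xt) :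
    ψ x ≤ 𝒳.pathDist q x y + ψ y := by
  rw [pathDist]
  simp_rw [ENNReal.iInf_add]
  refine le_iInf fun n => le_iInf fun c => le_iInf fun h0 => le_iInf fun hn => ?_
  subst h0 hn
  induction n with
  | zero => simp
  | succ n ih =>
    rw [Finset.sum_range_succ, add_assoc]
    exact ih.trans (add_le_add_right (h _ _) _)

theorem pathDist_le_stepCost (x y : Xt) : 𝒳.pathDist q x y ≤ 𝒳.stepCost q x y := by
  refine (iInf_le _ 1).trans ((iInf_le _ fun i => Nat.casesOn i x fun _ => y).trans ?_)
  refine (iInf_le _ rfl).trans ((iInf_le _ rfl).trans ?_)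
  simp

theorem pathDist_self (x : Xt) : 𝒳.pathDist q x x = 0 := by
  refine le_antisymm ?_ bot_le
  refine (iInf_le _ 0).trans ((iInf_le _ fun _ => x).trans ?_)
  refine (iInf_le _ rfl).trans ((iInf_le _ rfl).trans ?_)
  simp

theorem pathDist_triangle (x y z : Xt) :
    𝒳.pathDist q x z ≤ 𝒳.pathDist q x y + 𝒳.pathDist q y z := by
  refine le_pathDist_add (ψ := fun x => 𝒳.pathDist q x z) (fun x y => ?_) x y
  conv_rhs => rw [pathDist]
  simp_rw [ENNReal.add_iInf]
  refine le_iInf fun n => le_iInf fun c => le_iInf fun h0 => le_iInf fun hn => ?_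
  subst h0 hn
  refine (iInf_le _ (n + 1)).trans ((iInf_le _ fun i => Nat.casesOn i x c).trans ?_)
  refine (iInf_le _ rfl).trans ((iInf_le _ rfl).trans ?_)
  rw [Finset.sum_range_succ', add_comm]
  exact le_rfl

theorem IsVertical.pathDist_le (hq : IsCoveringMap q) {e : E} {a : Realization (𝒳.KE e)}
    {γ : C(unitInterval, Xt)} (h : IsVertical q e a γ) (s t : unitInterval) :
    𝒳.pathDist q (γ s) (γ t) ≤ 1 := by
  refine (pathDist_le_stepCost _ _).trans ?_
  rw [stepCost]
  refine (iInf₂_le |(s : ℝ) - t| (Or.inr (h.edgeCellStep hq s t))).trans ?_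
  refine ENNReal.ofReal_le_one.2 ?_
  rw [abs_le]
  constructor <;> linarith [s.2.1, s.2.2, t.2.1, t.2.2]

/-- A nearby point over a vertex. -/
theorem exists_foot (hq : IsCoveringMap q) (x : Xt) : ∃ y, (∃ v, q y ∈ range (𝒳.vertexMap v)) ∧
    𝒳.pathDist q x y ≤ 1 ∧ 𝒳.pathDist q y x ≤ 1 ∧
    ((∃ v, q x ∈ range (𝒳.vertexMap v)) → y = x) ∧
    ∀ e a γ s, IsVertical q e a γ → s ≠ 0 → s ≠ 1 → γ s = x → y = γ 0 := by
  rcases 𝒳.code_cases (q x) with ⟨v, a, hx⟩ | ⟨e, p, h0, h1, hx⟩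
  · refine ⟨x, ⟨v, a, hx.symm⟩, by simp [pathDist_self], by simp [pathDist_self], fun _ => rfl, ?_⟩
    rintro e a' γ s hγ h0 h1 rfl
    have := hγ.code_eq h0 h1
    rw [hx, code_vertexMap] at this
    cases this
  · obtain ⟨γ, hγ, rfl⟩ := exists_isVertical hq hx
    refine ⟨γ 0, ⟨_, hγ.zero_mem⟩, hγ.pathDist_le hq _ _, hγ.pathDist_le hq _ _, ?_, ?_⟩
    · rintro ⟨v, hv⟩
      have h2 := hγ.code_eq h0 h1
      rw [mem_range_vertexMap.1 hv] at h2
      cases h2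
    · intro e' a' δ s hδ h0' h1' hs
      rw [(hδ.eq_of_interior hq hγ h0' h1' h0 h1 hs).1]

theorem exists_vertical_of_mem_edgeSpaces (hq : IsCoveringMap q) {S : Set Xt}
    (hS : S ∈ 𝒳.edgeSpaces q) {x : Xt} (hx : x ∈ S) :
    ∃ e a γ, IsVertical q e a γ ∧ γ mid = x ∧ S = edgeSpace q x := by
  obtain ⟨e, x', hx', rfl⟩ := hS
  have hm : q x ∈ 𝒳.midSlice e := (show JoinedIn (q ⁻¹' 𝒳.midSlice e) x' x from hx).target_mem
  obtain ⟨⟨a, t⟩, ht, ha⟩ := hm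
  obtain rfl : t = mid := Subtype.ext ht
  obtain ⟨γ, hγ, hγx⟩ := exists_isVertical hq ha.symm
  refine ⟨e, a, γ, hγ, hγx, ?_⟩
  rw [← edgeSpace_eq hx']
  exact edgeSpace_congr hx

/-- The universal cover of a graph of spaces, with its map to the Bass-Serre tree. -/
theorem exists_coarseTree (hq : IsCoveringMap q) [SimplyConnectedSpace Xt] :
    ∃ X : CoarseTree (𝒳.pathDist q) (𝒳.vertexSpaces q) (𝒳.edgeSpaces q),
      (∀ P, X.vs P = P) ∧ ∀ S, X.es S = S := by
  classical
  choose foot hfootv hfoot hfoot' hfoot_eq hfoot_vert using exists_foot hq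
  have hedge : ∀ S : 𝒳.edgeSpaces q, ∃ e a γ, IsVertical q e a γ ∧ S.1 = edgeSpace q (γ mid) := by
    rintro ⟨S, hS⟩
    obtain ⟨x, hx⟩ : S.Nonempty := by
      obtain ⟨e, x, hx, rfl⟩ := hS
      exact ⟨x, mem_pathComponentIn_self hx⟩
    obtain ⟨e, a, γ, hγ, rfl, h⟩ := exists_vertical_of_mem_edgeSpaces hq hS hx
    exact ⟨e, a, γ, hγ, h⟩
  choose eS aS γS hγS hSeq using hedge
  have hvertex : ∀ P : 𝒳.vertexSpaces q, ∃ x, (∃ v, q x ∈ range (𝒳.vertexMap v)) ∧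
      P.1 = vertexSpace q x := by
    rintro ⟨P, v, x, hx, rfl⟩
    exact ⟨x, ⟨v, hx⟩, (vertexSpace_eq hx).symm⟩
  choose pt hpt hpteq using hvertex
  choose h hint hvconst hcross hnocross using fun S : 𝒳.edgeSpaces q =>
    exists_crossing_number hq S.2
  let vsp : ∀ x, (∃ v, q x ∈ range (𝒳.vertexMap v)) → 𝒳.vertexSpaces q := fun x hx =>
    ⟨vertexSpace q x, by obtain ⟨v, hv⟩ := hx; exact vertexSpace_mem hv⟩
  have hpt_vsp : ∀ S x hx, h S (pt (vsp x hx)) = h S x := by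
    intro S x hx
    have h1 : vertexSpace q x = vertexSpace q (pt (vsp x hx)) := hpteq (vsp x hx)
    obtain ⟨v, hv⟩ := hx
    have h2 : x ∈ vertexSpace q x := ⟨v, JoinedIn.refl hv⟩
    rw [h1] at h2
    obtain ⟨v', hj⟩ := h2
    exact hvconst S _ _ v' hj
  have hmid_self : ∀ S, γS S mid ∈ S.1 := by
    intro S
    rw [hSeq]
    exact ⟨eS S, JoinedIn.refl (hγS S).mid_mem⟩
  -- two edge-spaces with a common point coincide
  have hedge_eq : ∀ (S : 𝒳.edgeSpaces q) (x : Xt), x ∈ S.1 → S.1 = edgeSpace q x := by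
    intro S x hx
    obtain ⟨e, a, γ, -, -, h'⟩ := exists_vertical_of_mem_edgeSpaces hq S.2 hx
    exact h'
  let bd : Bool → 𝒳.edgeSpaces q → 𝒳.vertexSpaces q := fun i S =>
    bif i then vsp (γS S 1) ⟨_, (hγS S).one_mem⟩ else vsp (γS S 0) ⟨_, (hγS S).zero_mem⟩
  -- the endpoints of any vertical path across an edge-space
  have hbd : ∀ S e a γ (hγ : IsVertical q e a γ), γ mid ∈ S.1 →
      bd false S = vsp (γ 0) ⟨_, hγ.zero_mem⟩ ∧ bd true S = vsp (γ 1) ⟨_, hγ.one_mem⟩ := by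
    intro S e a γ hγ hmid
    rw [hSeq] at hmid
    obtain ⟨e', hj⟩ := hmid
    obtain ⟨b, hb⟩ := mem_midSlice.1 hj.source_mem
    rw [(hγS S).code_eq unitInterval.mid_ne_zero unitInterval.mid_ne_one] at hb
    obtain ⟨h1, -⟩ := Sigma.mk.inj_iff.1 (Sum.inr_injective hb)
    obtain ⟨b', hb'⟩ := mem_midSlice.1 hj.target_mem
    rw [hγ.code_eq unitInterval.mid_ne_zero unitInterval.mid_ne_one] at hb'
    obtain ⟨h2, -⟩ := Sigma.mk.inj_iff.1 (Sum.inr_injective hb')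
    subst h2
    have hγ' := hγS S
    generalize aS S = a₀ at hγ'
    revert a₀
    rw [h1]
    intro a₀ hγ'
    obtain ⟨j0, j1⟩ := hγ'.joinedIn hq hγ hj
    exact ⟨Subtype.ext (vertexSpace_congr j0), Subtype.ext (vertexSpace_congr j1)⟩
  -- `h S` is an integer on vertex-spaces and a half-integer at the midpoint of `S`, so the
  -- inequality cuts exactly at `S`.
  let side : 𝒳.edgeSpaces q → 𝒳.vertexSpaces q → Prop := fun S P => h S (γS S mid) < h S (pt P)
  have side_vsp : ∀ S x hx, side S (vsp x hx) ↔ h S (γS S mid) < h S x := by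
    intro S x hx
    change _ < h S (pt (vsp x hx)) ↔ _
    rw [hpt_vsp S x hx]
  have hmid_val : ((mid : unitInterval) : ℝ) = 1 / 2 := rfl
  have side_bd : ∀ S S', (side S (bd false S') ↔ side S (bd true S')) ↔ S' ≠ S := by
    intro S S'
    change (side S (vsp _ ⟨_, (hγS S').zero_mem⟩) ↔ side S (vsp _ ⟨_, (hγS S').one_mem⟩)) ↔ _
    rw [side_vsp S _ ⟨_, (hγS S').zero_mem⟩, side_vsp S _ ⟨_, (hγS S').one_mem⟩]
    by_cases hSS : S' = S
    · subst hSS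
      have h0 := hcross S' _ _ _ (hγS S') (hmid_self S') mid 0
      have h1 := hcross S' _ _ _ (hγS S') (hmid_self S') mid 1
      rw [hmid_val] at h0 h1
      simp only [ne_eq, not_true_eq_false, iff_false]
      intro hiff
      have h2 : h S' (γS S' mid) < h S' (γS S' 1) := by
        have : ((1 : unitInterval) : ℝ) = 1 := rfl
        linarith
      have h3 := hiff.2 h2
      have : ((0 : unitInterval) : ℝ) = 0 := rfl
      linarith
    · have hne : γS S' mid ∉ S.1 := fun hmem => hSS
        (Subtype.ext ((hSeq S').trans (hedge_eq S _ hmem).symm))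
      rw [hnocross S _ _ _ (hγS S') hne 0 1]
      simp [hSS]
  let proj : Xt → 𝒳.vertexSpaces q := fun x => vsp (foot x) (hfootv x)
  have proj_vertex : ∀ x hx, proj x = vsp x hx := by
    intro x hx
    refine Subtype.ext ?_
    change vertexSpace q (foot x) = vertexSpace q x
    rw [hfoot_eq x hx]
  have proj_vert : ∀ S e a γ, IsVertical q e a γ → γ mid ∈ S.1 → ∀ s, ∃ i, proj (γ s) = bd i S := by
    intro S e a γ hγ hmid s
    obtain ⟨hb0, hb1⟩ := hbd S e a γ hγ hmid
    by_cases h0 : s = 0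
    · subst h0
      exact ⟨false, hb0 ▸ proj_vertex _ ⟨_, hγ.zero_mem⟩⟩
    · by_cases h1 : s = 1
      · subst h1
        exact ⟨true, hb1 ▸ proj_vertex _ ⟨_, hγ.one_mem⟩⟩
      · refine ⟨false, ?_⟩
        rw [hb0]
        refine Subtype.ext ?_
        change vertexSpace q (foot (γ s)) = vertexSpace q (γ 0)
        rw [hfoot_vert (γ s) e a γ s hγ h0 h1 rfl]
  have proj_joined : ∀ x y v, JoinedIn (q ⁻¹' range (𝒳.vertexMap v)) x y → proj x = proj y := by
    intro x y v hj
    rw [proj_vertex x ⟨v, hj.source_mem⟩, proj_vertex y ⟨v, hj.target_mem⟩]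
    exact Subtype.ext (vertexSpace_congr hj)
  -- the two kinds of steps
  have hstep : ∀ x y l, 𝒳.VertexCellStep q x y l ∨ 𝒳.EdgeCellStep q x y l →
      (proj x = proj y ∧ ∀ S, h S x = h S y) ∨
      ∃ (S₀ : 𝒳.edgeSpaces q) (m : Xt) (r : ℝ) (i j : Bool), m ∈ S₀.1 ∧ 𝒳.pathDist q x m ≤ 1 ∧
        proj x = bd i S₀ ∧ proj y = bd j S₀ ∧ |r| ≤ l ∧
        ∀ S, h S x - h S y = if S = S₀ then r else 0 := by
    rintro x y l (hv | he)
    · obtain ⟨v, hj⟩ := hv.joinedIn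
      exact Or.inl ⟨proj_joined x y v hj, fun S => hvconst S x y v hj⟩
    · right
      obtain ⟨e, a, b, γ, δ, s, t, hγ, hδ, hj, rfl, rfl, hl⟩ := he.exists_isVertical
      have hmem : γ mid ∈ edgeSpace q (γ mid) := ⟨e, JoinedIn.refl hj.source_mem⟩
      have hmem' : δ mid ∈ edgeSpace q (γ mid) := ⟨e, hj⟩
      obtain ⟨i, hi⟩ := proj_vert ⟨_, edgeSpace_mem hj.source_mem⟩ e a γ hγ hmem s
      obtain ⟨j, hj'⟩ := proj_vert ⟨_, edgeSpace_mem hj.source_mem⟩ e b δ hδ hmem' t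
      refine ⟨⟨_, edgeSpace_mem hj.source_mem⟩, γ mid, (s : ℝ) - t, i, j, hmem,
        hγ.pathDist_le hq _ _, hi, hj', hl, fun S => ?_⟩
      have h0 := hvconst S _ _ _ (hγ.joinedIn hq hδ hj).1
      by_cases hS : γ mid ∈ S.1
      · have hS' : δ mid ∈ S.1 := mem_of_joinedIn_midSlice S.2 hS hj
        rw [if_pos (Subtype.ext (hedge_eq S _ hS))]
        have h1 := hcross S _ _ _ hγ hS 0 s
        have h2 := hcross S _ _ _ hδ hS' 0 t
        have h3 : ((0 : unitInterval) : ℝ) = 0 := rfl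
        linarith
      · have hS' : δ mid ∉ S.1 := fun hm => hS (mem_of_joinedIn_midSlice S.2 hm hj.symm)
        rw [if_neg (by rintro rfl; exact hS hmem), hnocross S _ _ _ hγ hS 0 s,
          hnocross S _ _ _ hδ hS' 0 t, h0, sub_self]
  refine ⟨{
    bd := bd
    side := side
    side_bd := side_bd
    vs := Subtype.val
    es := Subtype.val
    proj := proj
    setDist_vs_proj := ?_
    setDist_vs_bd := ?_
    crossing := ?_
    encard_separating_le := ?_
    encard_separating_bd_le := ?_
    joined := ?_ }, fun _ => rfl, fun _ => rfl⟩
  · refine ⟨1, fun x => ?_⟩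
    obtain ⟨v, hv⟩ := hfootv x
    exact (setDist_le_of_mem (a := foot x) (A := vertexSpace q (foot x))
      ⟨v, JoinedIn.refl hv⟩).trans (hfoot x)
  · refine ⟨1, fun S s hs i => ?_⟩
    obtain ⟨e, a, γ, hγ, rfl, -⟩ := exists_vertical_of_mem_edgeSpaces hq S.2 hs
    obtain ⟨hb0, hb1⟩ := hbd S e a γ hγ hs
    cases i
    · rw [hb0]
      exact (setDist_le_of_mem (a := γ 0) (A := vertexSpace q (γ 0))
        ⟨_, JoinedIn.refl hγ.zero_mem⟩).trans (hγ.pathDist_le hq _ _)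
    · rw [hb1]
      exact (setDist_le_of_mem (a := γ 1) (A := vertexSpace q (γ 1))
        ⟨_, JoinedIn.refl hγ.one_mem⟩).trans (hγ.pathDist_le hq _ _)
  · intro k
    refine ⟨k + 1, fun x y S hxy hsep => ?_⟩
    -- On the far side from `y`, the distance to `S` truncated below at one; on the side of `y`,
    -- one. Along a step it drops by at most the cost, since a step can change side only in a cell
    -- crossing `S`, where the distance to `S` is at most one. This explains the bound `k + 1`.
    let ψ : Xt → ℝ≥0∞ := fun x => if side S (proj x) ↔ side S (proj y) then 1 else
      max (setDist (𝒳.pathDist q) x S) 1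
    have hψ1 : ∀ x, 1 ≤ ψ x := by
      intro x
      simp only [ψ]
      split_ifs
      exacts [le_rfl, le_max_right _ _]
    have hψ : ∀ x z, ψ x ≤ 𝒳.stepCost q x z + ψ z := by
      intro x z
      by_cases hx : side S (proj x) ↔ side S (proj y)
      · have : ψ x = 1 := if_pos hx
        rw [this]
        exact (hψ1 z).trans le_add_self
      · have hψx : ψ x = max (setDist (𝒳.pathDist q) x S) 1 := if_neg hx
        by_cases hz : side S (proj z) ↔ side S (proj y)
        · refine le_stepCost_add fun l hl => ?_
          refine le_trans ?_ ((hψ1 z).trans le_add_self)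
          rw [hψx]
          refine max_le ?_ le_rfl
          rcases hstep x z l hl with ⟨hp, -⟩ | ⟨S₀, m, r, i, j, hm, hd, hi, hj, -, -⟩
          · rw [hp] at hx
            exact absurd hz hx
          · have : S₀ = S := by
              by_contra hne
              have := (side_bd S S₀).2 hne
              rw [hi] at hx
              rw [hj] at hz
              apply hx
              rw [← hz]
              cases i <;> cases j <;> tauto
            subst this
            exact (setDist_le_of_mem hm).trans hd
        · have hψz : ψ z = max (setDist (𝒳.pathDist q) z S) 1 := if_neg hz
          rw [hψx, hψz]
          refine max_le ?_ ((le_max_right _ _).trans le_add_self)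
          refine (setDist_le_add pathDist_triangle x z _).trans ?_
          exact add_le_add (pathDist_le_stepCost _ _) (le_max_left _ _)
    have h1 := le_pathDist_add hψ x y
    have h2 : ψ x = max (setDist (𝒳.pathDist q) x S) 1 := if_neg hsep
    have h3 : ψ y = 1 := if_pos Iff.rfl
    rw [h2, h3] at h1
    refine (le_max_left _ _).trans (h1.trans ?_)
    rw [ENNReal.coe_add, ENNReal.coe_one]
    exact add_le_add hxy le_rfl
  · intro k
    -- Each foot is within one of its point, hence the extra `2`.
    refine ⟨⌈k⌉₊ + 2, fun x y hxy => ?_⟩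
    by_contra hlt
    rw [not_le] at hlt
    have hle : ((⌈k⌉₊ + 3 : ℕ) : ℕ∞) ≤
        {S | ¬ (side S (proj x) ↔ side S (proj y))}.encard := by
      have := Order.add_one_le_of_lt hlt
      exact_mod_cast this
    obtain ⟨F', hF', hcard⟩ := exists_subset_encard_eq hle
    have hfin : F'.Finite := finite_of_encard_eq_coe hcard
    set F := hfin.toFinset with hF
    have hFcard : F.card = ⌈k⌉₊ + 3 := by
      rw [hfin.encard_eq_coe_toFinset_card] at hcard
      exact_mod_cast hcard
    let ε : 𝒳.edgeSpaces q → ℝ := fun S => if h S (foot y) < h S (foot x) then 1 else -1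
    have hε : ∀ S, |ε S| = 1 := by
      intro S
      simp only [ε]
      split_ifs <;> simp
    let Φ : Xt → ℝ := fun z => ∑ S ∈ F, ε S * h S z
    have hΦ : ∀ x z, ENNReal.ofReal (Φ x - Φ (foot y)) ≤
        𝒳.stepCost q x z + ENNReal.ofReal (Φ z - Φ (foot y)) := by
      intro x z
      refine le_stepCost_add fun l hl => ?_
      have hxz : Φ x - Φ z ≤ l := by
        have hdiff : Φ x - Φ z = ∑ S ∈ F, ε S * (h S x - h S z) := by
          simp only [Φ, mul_sub, Finset.sum_sub_distrib]
        rw [hdiff]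
        rcases hstep x z l hl with ⟨-, hp⟩ | ⟨S₀, m, r, i, j, hm, hd, hi, hj, hr, hS⟩
        · have hl0 : 0 ≤ l := by
            rcases hl with ⟨_, _, _, _, _, _, _, _, _, _, _, _, rfl⟩ |
              ⟨_, _, _, _, _, _, _, _, _, _, _, _, rfl⟩ <;> exact Real.sqrt_nonneg _
          simpa [hp] using hl0
        · simp only [hS, mul_ite, mul_zero, Finset.sum_ite_eq']
          split_ifs
          · calc ε S₀ * r ≤ |ε S₀ * r| := le_abs_self _
              _ = |r| := by rw [abs_mul, hε, one_mul]
              _ ≤ l := hr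
          · exact (abs_nonneg r).trans hr
      have : Φ x - Φ (foot y) ≤ l + (Φ z - Φ (foot y)) := by linarith
      exact (ENNReal.ofReal_le_ofReal this).trans ENNReal.ofReal_add_le
    have h1 := le_pathDist_add hΦ (foot x) (foot y)
    rw [sub_self, ENNReal.ofReal_zero, add_zero] at h1
    have h2 : 𝒳.pathDist q (foot x) (foot y) ≤ ((⌈k⌉₊ + 2 : ℕ) : ℝ≥0∞) := by
      calc 𝒳.pathDist q (foot x) (foot y)
          ≤ 𝒳.pathDist q (foot x) x + 𝒳.pathDist q x (foot y) := pathDist_triangle _ _ _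
        _ ≤ 𝒳.pathDist q (foot x) x + (𝒳.pathDist q x y + 𝒳.pathDist q y (foot y)) :=
            add_le_add_right (pathDist_triangle _ _ _) _
        _ ≤ 1 + ((⌈k⌉₊ : ℝ≥0∞) + 1) := by
            refine add_le_add (hfoot' x) (add_le_add (hxy.trans ?_) (hfoot y))
            exact_mod_cast Nat.le_ceil k
        _ = ((⌈k⌉₊ + 2 : ℕ) : ℝ≥0∞) := by
            push_cast
            ring
    have h3 := h1.trans h2
    rw [ENNReal.ofReal_le_natCast] at h3
    have h4 : (F.card : ℝ) ≤ Φ (foot x) - Φ (foot y) := by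
      have hdiff : Φ (foot x) - Φ (foot y) = ∑ S ∈ F, ε S * (h S (foot x) - h S (foot y)) := by
        simp only [Φ, mul_sub, Finset.sum_sub_distrib]
      rw [hdiff, Finset.card_eq_sum_ones, Nat.cast_sum]
      refine Finset.sum_le_sum fun S hS => ?_
      rw [hF, Finite.mem_toFinset] at hS
      have hSsep := hF' hS
      simp only [mem_ofPred_eq] at hSsep
      rw [show proj x = vsp (foot x) (hfootv x) from rfl,
        show proj y = vsp (foot y) (hfootv y) from rfl, side_vsp S _ (hfootv x),
        side_vsp S _ (hfootv y)] at hSsep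
      obtain ⟨vx, hvx⟩ := hfootv x
      obtain ⟨vy, hvy⟩ := hfootv y
      obtain ⟨n, hn⟩ := hint S _ _ hvx
      obtain ⟨m, hm⟩ := hint S _ _ hvy
      rw [hn, hm] at hSsep
      simp only [ε, hn, hm]
      push_cast
      split_ifs with hlt
      · have : m + 1 ≤ n := by exact_mod_cast hlt
        have : ((m + 1 : ℤ) : ℝ) ≤ n := by exact_mod_cast this
        push_cast at this
        linarith
      · have hne : n ≠ m := by
          rintro rfl
          exact hSsep Iff.rfl
        have hle : n ≤ m := by exact_mod_cast not_lt.1 hlt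
        have : n + 1 ≤ m := by omega
        have : ((n + 1 : ℤ) : ℝ) ≤ m := by exact_mod_cast this
        push_cast at this
        linarith
    rw [hFcard] at h4
    push_cast at h3 h4
    linarith
  · refine ⟨1, fun S s hs i => ?_⟩
    obtain ⟨e, a, γ, hγ, rfl, -⟩ := exists_vertical_of_mem_edgeSpaces hq S.2 hs
    obtain ⟨j, hj⟩ := proj_vert S e a γ hγ hs mid
    have hsub : {S' | ¬ (side S' (proj (γ mid)) ↔ side S' (bd i S))} ⊆ {S} := by
      intro S' hS'
      by_contra hne
      have := (side_bd S' S).2 (Ne.symm hne)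
      rw [mem_ofPred_eq, hj] at hS'
      apply hS'
      cases i <;> cases j <;> tauto
    refine (encard_le_encard hsub).trans ?_
    simp
  · intro x y hxy
    let R := Relation.ReflTransGen (fun v w => ∃ S i, bd i S = v ∧ bd (!i) S = w)
    -- No step leads between vertices that are joined to `proj y` and vertices that are not, so the
    -- latter are at infinite distance.
    let ψ : Xt → ℝ≥0∞ := fun x => if R (proj x) (proj y) then 0 else ⊤
    have hψ : ∀ x z, ψ x ≤ 𝒳.stepCost q x z + ψ z := by
      intro x z
      by_cases hz : R (proj z) (proj y)
      · refine le_stepCost_add fun l hl => ?_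
        have hx : R (proj x) (proj y) := by
          rcases hstep x z l hl with ⟨hp, -⟩ | ⟨S₀, m, r, i, j, hm, hd, hi, hj, -, -⟩
          · rw [hp]; exact hz
          · rw [hi]
            rw [hj] at hz
            by_cases hij : i = j
            · rw [hij]; exact hz
            · refine Relation.ReflTransGen.head ⟨S₀, i, rfl, rfl⟩ ?_
              have : (!i) = j := by revert hij; cases i <;> cases j <;> simp
              rw [this]
              exact hz
        have : ψ x = 0 := if_pos hx
        rw [this]
        exact bot_le
      · have : ψ z = ⊤ := if_neg hz
        rw [this, add_top]
        exact le_top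
    have h1 := le_pathDist_add hψ x y
    have h2 : ψ y = 0 := if_pos Relation.ReflTransGen.refl
    rw [h2, add_zero] at h1
    by_contra hcon
    have h3 : ψ x = ⊤ := if_neg hcon
    rw [h3] at h1
    exact absurd (lt_of_le_of_lt h1 hxy) (lt_irrefl _)

end GraphOfSpaces

/-! ### The dichotomy and the theorem -/

theorem IsCoarselyConnected.range {Z M : Type*} [MetricSpace Z] {d : M → M → ℝ≥0∞} {f : Z → M}
    (hZ : IsCoarselyConnected (fun x y : Z => edist x y) univ) (hf : IsCoarseEmbedding d f) :
    ∃ k : ℝ≥0, IsKConnected d k (range f) := by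
  obtain ⟨k, -, hk⟩ := hZ
  obtain ⟨ρ₁, ρ, -, hρ, -, h⟩ := hf
  refine ⟨ρ k, ?_⟩
  rintro _ ⟨x, rfl⟩ _ ⟨y, rfl⟩
  refine ⟨⟨x, rfl⟩, ⟨y, rfl⟩, Relation.ReflTransGen.lift f ?_ _ _ (hk x trivial y trivial).2.2⟩
  intro a b hab
  refine ⟨⟨a, rfl⟩, ⟨b, rfl⟩, (h a b).2.trans (ENNReal.coe_le_coe.2 (hρ ?_))⟩
  have : edist a b ≤ k := hab.2.2
  rwa [edist_nndist, ENNReal.coe_le_coe] at this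

/-- The dichotomy for coarse embeddings in the universal cover of a graph of spaces. -/
theorem GraphOfSpaces.coarselySeparates_or_subset_nbhd {V : Type*} {E : Type*}
    {𝒢 : GraphOfGroups.{_, _, w} V E} {𝒳 : GraphOfSpaces 𝒢} {Xt : Type*} [TopologicalSpace Xt]
    [SimplyConnectedSpace Xt] {q : Xt → 𝒳.Total} (hq : IsCoveringMap q) {Z : Type*} [MetricSpace Z]
    (hZ : IsCoarselyConnected (fun x y : Z => edist x y) univ) {f : Z → Xt}
    (hf : IsCoarseEmbedding (𝒳.pathDist q) f) :
    CoarselySeparates (𝒳.pathDist q) (𝒳.edgeSpaces q) (range f) ∨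
      ∃ P ∈ 𝒳.vertexSpaces q, ∃ R : ℝ≥0, range f ⊆ nbhd (𝒳.pathDist q) P R := by
  obtain ⟨k, hk⟩ := hZ.range hf
  rcases isEmpty_or_nonempty Z with hZe | ⟨⟨z⟩⟩
  -- For empty `Z` any vertex-space will do; the foot of a point shows that there is one.
  · obtain ⟨x⟩ : Nonempty Xt := inferInstance
    obtain ⟨y, ⟨v, hv⟩, -⟩ := exists_foot hq x
    exact Or.inr ⟨_, vertexSpace_mem hv, 0, range_subset_iff.2 hZe.elim⟩
  · obtain ⟨X, hvs, hes⟩ := exists_coarseTree (𝒳 := 𝒳) hq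
    rcases X.subset_nbhd_or_separates pathDist_triangle hk (mem_range_self z) with
      ⟨P, R, hR⟩ | ⟨L, hL⟩
    · rw [hvs] at hR
      exact Or.inr ⟨P, P.2, R, hR⟩
    · refine Or.inl ⟨k, L, hk, fun D => ?_⟩
      obtain ⟨S, hS⟩ := hL D
      rw [hes] at hS
      exact ⟨S, S.2, hS⟩

theorem theorem4p1 :
    -- the dichotomy for coarse embeddings into the universal cover of a graph of spaces
    (∀ (V : Type*) (E : Type*) (𝒢 : GraphOfGroups.{_, _, w} V E) (𝒳 : GraphOfSpaces 𝒢)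
      (Xt : Type*) [TopologicalSpace Xt] [SimplyConnectedSpace Xt] (q : Xt → 𝒳.Total),
      IsCoveringMap q →
      ∀ (Z : Type*) [MetricSpace Z],
        IsCoarselyConnected (fun x y : Z => edist x y) Set.univ →
        ∀ f : Z → Xt, IsCoarseEmbedding (𝒳.pathDist q) f →
          CoarselySeparates (𝒳.pathDist q) (𝒳.edgeSpaces q) (Set.range f) ∨
          ∃ P ∈ 𝒳.vertexSpaces q, ∃ R : ℝ≥0, Set.range f ⊆ nbhd (𝒳.pathDist q) P R) ∧
    -- edge-groups of subexponential relative growth, and spaces in `𝔐_exp`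
    (∀ (V : Type*) (E : Type*) [Finite V] [Finite E] (𝒢 : GraphOfGroups.{_, _, w} V E) (T : Set E),
      𝒢.IsSpanningTree T →
      ∀ S : Finset (𝒢.FundGroup T), Subgroup.closure (S : Set (𝒢.FundGroup T)) = ⊤ →
        (∀ e, HasSubexpRelativeGrowth S (𝒢.edgeSubgroup T e)) →
        ∀ (Z : Type*) [MetricSpace Z], MemMExp Z →
          ∀ f : Z → 𝒢.FundGroup T, IsCoarseEmbedding (wordDist S) f →
            ∃ (v : V) (g : 𝒢.FundGroup T) (R : ℝ≥0), Set.range f ⊆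
              nbhd (wordDist S) ((fun h => g * h) '' (𝒢.vertexSubgroup T v : Set _)) R) ∧
    -- edge-groups of relative growth at most `r ^ d`, and spaces in `𝔐_{d+1}`
    (∀ (V : Type*) (E : Type*) [Finite V] [Finite E] (𝒢 : GraphOfGroups.{_, _, w} V E) (T : Set E),
      𝒢.IsSpanningTree T →
      ∀ S : Finset (𝒢.FundGroup T), Subgroup.closure (S : Set (𝒢.FundGroup T)) = ⊤ →
        ∀ d : ℝ, 0 ≤ d →
        (∀ e, HasRelativeGrowthAtMost d S (𝒢.edgeSubgroup T e)) →
        ∀ (Z : Type*) [MetricSpace Z], MemMPoly (d + 1) Z →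
          ∀ f : Z → 𝒢.FundGroup T, IsCoarseEmbedding (wordDist S) f →
            ∃ (v : V) (g : 𝒢.FundGroup T) (R : ℝ≥0), Set.range f ⊆
              nbhd (wordDist S) ((fun h => g * h) '' (𝒢.vertexSubgroup T v : Set _)) R) := by
  refine ⟨fun V E 𝒢 𝒳 Xt _ _ q hq Z _ hZ f hf =>
    GraphOfSpaces.coarselySeparates_or_subset_nbhd hq hZ hf, ?_, ?_⟩
  · intro V E _ _ 𝒢 T hT S hS hB Z _ ⟨W, H, hH, φ, hφ⟩ f hf
    have := Fintype.ofFinite E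
    exact 𝒢.subset_coset_of_not_growth_le hT hS hH hφ hf
      fun C hC K l L hl => exists_sum_relativeGrowth_lt_exp hB hC K l L hl
  · intro V E _ _ 𝒢 T hT S hS d hd hB Z _ ⟨W, H, hH, φ, hφ⟩ f hf
    have := Fintype.ofFinite E
    exact 𝒢.subset_coset_of_not_growth_le hT hS hH hφ hf
      fun C hC K l L hl => exists_sum_relativeGrowth_lt_rpow hd hB hC K l L hl
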